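/- Let $\mathbb M=\langle M,\mathcal C\rangle$ be a countable transitive model of $\mathsf{GB}^-$: $M$ is a countable transitive set, $\mathcal C$ is a countable set of subsets of $M$, $M$ satisfies the axioms of $\mathsf{ZF}$ without power set and with Collection, where parameters from $\mathcal C$ are allowed in Separation and Collection, and first-order class comprehension holds. A notion of class forcing for $\mathbb M$ is a preorder $\mathbb P=\langle P,\le_{\mathbb P}\rangle$ with $P,\le_{\mathbb P}\in\mathcal C$. A filter $G$ on $\mathbb P$ is generic if it meets every dense subset of $\mathbb P$ that is in $\mathcal C$. $\mathbb P$-names are the sets of pairs $\langle\tau,p\rangle$ with $\tau$ a $\mathbb P$-name and $p\in P$; $M^{\mathbb P}$ is the set of $\mathbb P$-names in $M$, and $\mathcal C^{\mathbb P}$ is the set of those $\Gamma\in\mathcal C$ all of whose elements are pairs $\langle\tau,p\rangle$ with $\tau$ a $\mathbb P$-name and $p\in P$. Put $\sigma^G=\{\tau^G\mid\exists p\in G\ \langle\tau,p\rangle\in\sigma\}$ (and likewise $\Gamma^G$) and $M[G]=\{\sigma^G\mid\sigma\in M^{\mathbb P}\}$. Let $\mathcal L^n$ be the language of set theory with $n$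 additional unary predicates. For an $\mathcal L^n$-formula $\varphi(v_0,\dots,v_{m-1})$, $\vec\Gamma\in(\mathcal C^{\mathbb P})^n$, $p\in P$ and $\sigma_i\in M^{\mathbb P}$, write $p\Vdash^{\vec\Gamma}\varphi(\vec\sigma)$ if $\langle M[G],\in,\Gamma_0^G,\dots,\Gamma_{n-1}^G\rangle\models\varphi(\sigma_0^G,\dots,\sigma_{m-1}^G)$ for every generic filter $G$ with $p\in G$. The definability lemma for $\varphi$ says that $\{\langle p,\vec\sigma\rangle\mid p\Vdash^{\vec\Gamma}\varphi(\vec\sigma)\}\in\mathcal C$ for all $\vec\Gamma$; the truth lemma says that, for all $\vec\Gamma$, $\vec\sigma$ and every generic $G$, if $\langle M[G],\in,\vec\Gamma^G\rangle\models\varphi(\vec\sigma^G)$, then some $p\in G$ satisfies $p\Vdash^{\vec\Gamma}\varphi(\vec\sigma)$. The forcing theorem for $\varphi$ is the conjunction of the two. $\mathbb P$ is approachable by projections if it has a largest condition $\mathbb 1$, and there are sets $P_\alpha\in M$ ($\alpha\in\mathrm{Ord}^M$), ordered by the restriction of $\le_{\mathbb P}$, with $\langle P_\alpha\mid\alpha\in\mathrm{Ord}^M\rangle\in\mathcal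 C$, increasing, continuous at nonzero limits and with union $P$, and maps $\pi_{\alpha+1}:P\to P_{\alpha+1}$ with $\{\langle\alpha,p,\pi_{\alpha+1}(p)\rangle\mid\alpha\in\mathrm{Ord}^M,\ p\in P\}\in\mathcal C$, such that for all $\alpha\in\mathrm{Ord}^M$: 1. $\pi_{\alpha+1}(\mathbb 1)=\mathbb 1$; 2. $p\le_{\mathbb P} q$ implies $\pi_{\alpha+1}(p)\le_{\mathbb P}\pi_{\alpha+1}(q)$ for all $p,q\in P$; 3. for all $p\in P$ and all $q\in P_{\alpha+1}$ with $q\le_{\mathbb P}\pi_{\alpha+1}(p)$ there is $r\le_{\mathbb P} p$ with $\pi_{\alpha+1}(r)\le_{\mathbb P} q$; 4. for all $p\in P_\alpha$ and $q\in P$, $\pi_{\alpha+1}(q)\le_{\mathbb P} p$ implies $q\le_{\mathbb P} p$; 5. $\pi_{\alpha+1}$ is the identity on $P_\alpha$. **Theorem.** (a) If a notion of class forcing $\mathbb P$ for $\mathbb M$ is approachable by projections, then $\mathbb P$ satisfies the definability lemma for the formula $v_0=v_1$, and $\mathbb P$ satisfies the forcing theorem for every $\mathcal L^n$-formula, for every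 $n$. (b) Each of the following three is a notion of class forcing for $\mathbb M$, is approachable by projections, and satisfies the forcing theorem for every $\mathcal L^n$-formula, for every $n$: - $\mathrm{Col}(\omega,\mathrm{Ord})^M$, the finite partial functions from $\omega$ to $\mathrm{Ord}^M$ ordered by reverse inclusion; - $\mathrm{Col}_*(\omega,\mathrm{Ord})^M$, its suborder of all conditions $p$ with $\mathrm{dom}(p)\in\omega$; - $\mathrm{Col}_{\ge}(\omega,\mathrm{Ord})^M$, the finite partial functions from $\omega$ to $\mathrm{Ord}^M\cup\{{\ge}\alpha\mid\alpha\in\mathrm{Ord}^M\}$, where $p\le q$ if and only if $\mathrm{dom}(q)\subseteq\mathrm{dom}(p)$ and for every $n\in\mathrm{dom}(q)$ either $p(n)=q(n)$, or $q(n)$ is ${\ge}\alpha$ for some $\alpha$ and $p(n)\in\{\beta,{\ge}\beta\}$ for some $\beta\ge\alpha$. Here the objects ${\ge}\alpha$ are any pairwise distinct elements of $M\setminus\mathrm{Ord}^M$ such that the map $\alpha\mapsto{\ge}\alpha$ belongs to $\mathcal C$. -/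

import Mathlib

universe u

namespace ClassForcing

/-! ### The languages `L^n` and satisfaction in structures `⟨N, ∈, A₀, …, A_{n-1}⟩` -/

/-- The relation symbols of `L^n`: the binary symbol `∈` and unary predicates `A₀, …, A_{n-1}`. -/
inductive SetRel (n : ℕ) : ℕ → Type
  | mem : SetRel n 2
  | pred (i : Fin n) : SetRel n 1

/-- The first-order language `L^n` (with equality). For `n = 0` it is the language of set theory. -/
def LSet (n : ℕ) : FirstOrder.Language.{0, 0} where
  Functions := fun _ => Empty
  Relations := SetRel n

/-- The `L^n`-structure `⟨N, ∈, A₀, …, A_{n-1}⟩`. -/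
@[reducible] def setStructure {n : ℕ} (N : Set ZFSet.{u}) (A : Fin n → Set ZFSet.{u}) :
    (LSet n).Structure N where
  funMap := fun f _ => nomatch f
  RelMap := fun r => match r with
    | SetRel.mem => fun v => (v 0 : ZFSet.{u}) ∈ (v 1 : ZFSet.{u})
    | SetRel.pred i => fun v => (v 0 : ZFSet.{u}) ∈ A i

/-- `⟨N, ∈, A₀, …, A_{n-1}⟩ ⊨ φ(v₀, …, v_{m-1})`. -/
def Sat {n m : ℕ} (N : Set ZFSet.{u}) (A : Fin n → Set ZFSet.{u})
    (φ : (LSet n).Formula (Fin m)) (v : Fin m → N) : Prop :=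
  @FirstOrder.Language.Formula.Realize (LSet n) N (setStructure N A) (Fin m) φ v

/-- The formula `v₀ = v₁` of `L_∈ = L^0`. -/
def eqFormula : (LSet 0).Formula (Fin 2) :=
  (FirstOrder.Language.Term.var 0).equal (FirstOrder.Language.Term.var 1)

/-! ### Countable transitive models of `GB⁻` -/

/-- `⟨M, C⟩` is a countable transitive model of `GB⁻`: the classes are subsets of `M`, the set
axioms are those of `ZF` without power set and with Collection, where class parameters are allowed
in Separation and Collection, and there is first-order class comprehension (only set quantifiers,
set and class parameters allowed). Extensionality and Foundation, for sets and for classes, hold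
automatically because `M` is transitive and classes are subsets of `M`; for the same reason
Pairing, Union and Infinity may be stated absolutely. -/
structure IsCTMGB (M : Set ZFSet.{u}) (C : Set (Set ZFSet.{u})) : Prop where
  countable_sets : M.Countable
  countable_classes : C.Countable
  transitive : ∀ x ∈ M, ∀ y ∈ x, y ∈ M
  class_subset : ∀ A ∈ C, A ⊆ M
  pairing : ∀ x ∈ M, ∀ y ∈ M, ({x, y} : ZFSet.{u}) ∈ M
  union : ∀ x ∈ M, ZFSet.sUnion x ∈ M
  infinity : ∃ w ∈ M, ∅ ∈ w ∧ ∀ x ∈ w, insert x x ∈ w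
  separation : ∀ (n k : ℕ) (A : Fin n → Set ZFSet.{u}), (∀ i, A i ∈ C) →
    ∀ (φ : (LSet n).Formula (Fin (k + 1))) (v : Fin k → M), ∀ x ∈ M,
      ∃ y ∈ M, ∀ z : M, (z : ZFSet.{u}) ∈ y ↔
        (z : ZFSet.{u}) ∈ x ∧ Sat M A φ (Matrix.vecCons z v)
  collection : ∀ (n k : ℕ) (A : Fin n → Set ZFSet.{u}), (∀ i, A i ∈ C) →
    ∀ (φ : (LSet n).Formula (Fin (k + 2))) (v : Fin k → M), ∀ x ∈ M,
      (∀ y : M, (y : ZFSet.{u}) ∈ x →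
        ∃ z : M, Sat M A φ (Matrix.vecCons y (Matrix.vecCons z v))) →
      ∃ w ∈ M, ∀ y : M, (y : ZFSet.{u}) ∈ x →
        ∃ z : M, (z : ZFSet.{u}) ∈ w ∧ Sat M A φ (Matrix.vecCons y (Matrix.vecCons z v))
  comprehension : ∀ (n k : ℕ) (A : Fin n → Set ZFSet.{u}), (∀ i, A i ∈ C) →
    ∀ (φ : (LSet n).Formula (Fin (k + 1))) (v : Fin k → M),
      {x : ZFSet.{u} | ∃ hx : x ∈ M, Sat M A φ (Matrix.vecCons ⟨x, hx⟩ v)} ∈ C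

/-- `Ord^M`. -/
def OrdOf (M : Set ZFSet.{u}) : Set ZFSet.{u} := {α | α ∈ M ∧ α.IsOrdinal}

/-- Nonzero limit ordinals. -/
def IsLimitOrd (l : ZFSet.{u}) : Prop :=
  l.IsOrdinal ∧ l ≠ ∅ ∧ ∀ β ∈ l, insert β β ∈ l

/-! ### Notions of class forcing, generic filters, names -/

/-- A set of conditions with a relation; only the restriction of `le` to `carrier` matters. -/
structure Forcing where
  carrier : Set ZFSet.{u}
  le : ZFSet.{u} → ZFSet.{u} → Prop

/-- The ordering of `P` as a class of ordered pairs. -/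
def Forcing.leClass (P : Forcing.{u}) : Set ZFSet.{u} :=
  {z | ∃ p ∈ P.carrier, ∃ q ∈ P.carrier, z = ZFSet.pair p q ∧ P.le p q}

/-- `P` is a notion of class forcing for `⟨M, C⟩`: a preorder whose domain and ordering are
in `C`. -/
structure IsClassForcing (C : Set (Set ZFSet.{u})) (P : Forcing.{u}) : Prop where
  carrier_mem : P.carrier ∈ C
  le_mem : P.leClass ∈ C
  refl : ∀ p ∈ P.carrier, P.le p p
  trans : ∀ p ∈ P.carrier, ∀ q ∈ P.carrier, ∀ r ∈ P.carrier, P.le p q → P.le q r → P.le p r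

/-- `G` is a filter on `P`. -/
structure IsFilterOn (P : Forcing.{u}) (G : Set ZFSet.{u}) : Prop where
  subset : G ⊆ P.carrier
  nonempty : G.Nonempty
  upward : ∀ p ∈ G, ∀ q ∈ P.carrier, P.le p q → q ∈ G
  directed : ∀ p ∈ G, ∀ q ∈ G, ∃ r ∈ G, P.le r p ∧ P.le r q

/-- `D` is a dense subset of `P`. -/
def IsDenseIn (P : Forcing.{u}) (D : Set ZFSet.{u}) : Prop :=
  D ⊆ P.carrier ∧ ∀ p ∈ P.carrier, ∃ d ∈ D, P.le d p

/-- `G` is a `P`-generic filter over `⟨M, C⟩`. -/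
def IsGeneric (C : Set (Set ZFSet.{u})) (P : Forcing.{u}) (G : Set ZFSet.{u}) : Prop :=
  IsFilterOn P G ∧ ∀ D ∈ C, IsDenseIn P D → (D ∩ G).Nonempty

/-- `σ` is a `P`-name: every element of `σ` is of the form `⟨τ, p⟩`, where `p` is a condition and
`τ` is a `P`-name (the conditions are given by the set `P`). -/
inductive IsName (P : Set ZFSet.{u}) : ZFSet.{u} → Prop
  | mk (σ : ZFSet.{u}) (h₁ : ∀ x ∈ σ, ∃ τ, ∃ p ∈ P, x = ZFSet.pair τ p)
      (h₂ : ∀ τ p, ZFSet.pair τ p ∈ σ → IsName P τ) : IsName P σ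

/-- `M^P`. -/
def Names (M : Set ZFSet.{u}) (P : Forcing.{u}) : Set ZFSet.{u} :=
  {σ | σ ∈ M ∧ IsName P.carrier σ}

/-- `C^P`, the class names. -/
def ClassNames (C : Set (Set ZFSet.{u})) (P : Forcing.{u}) : Set (Set ZFSet.{u}) :=
  {Γ | Γ ∈ C ∧ ∀ x ∈ Γ, ∃ τ, ∃ p ∈ P.carrier, x = ZFSet.pair τ p ∧ IsName P.carrier τ}

theorem rank_lt_of_pair_mem {τ p σ : ZFSet.{u}} (h : ZFSet.pair τ p ∈ σ) : τ.rank < σ.rank := by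
  have h₁ : τ ∈ ({τ} : ZFSet.{u}) := by simp
  have h₂ : ({τ} : ZFSet.{u}) ∈ ZFSet.pair τ p := by simp [ZFSet.pair]
  exact (ZFSet.rank_lt_of_mem h₁).trans ((ZFSet.rank_lt_of_mem h₂).trans (ZFSet.rank_lt_of_mem h))

instance small_active (G : Set ZFSet.{u}) (σ : ZFSet.{u}) :
    Small.{u} {τ : ZFSet.{u} // ∃ p ∈ G, ZFSet.pair τ p ∈ σ} := by
  have h : {τ : ZFSet.{u} | ∃ p ∈ G, ZFSet.pair τ p ∈ σ} ⊆
      {τ | τ ∈ ZFSet.sUnion (ZFSet.sUnion σ)} := by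
    rintro τ ⟨p, -, hp⟩
    have h₂ : ({τ} : ZFSet.{u}) ∈ ZFSet.pair τ p := by simp [ZFSet.pair]
    exact ZFSet.mem_sUnion_of_mem (by simp) (ZFSet.mem_sUnion_of_mem h₂ hp)
  have : Small.{u} {τ | τ ∈ ZFSet.sUnion (ZFSet.sUnion σ)} :=
    ZFSet.small_coe (ZFSet.sUnion (ZFSet.sUnion σ))
  exact small_subset h

/-- The `G`-evaluation `σ^G = {τ^G | ∃ p ∈ G, ⟨τ, p⟩ ∈ σ}`. -/
noncomputable def evalName (G : Set ZFSet.{u}) (σ : ZFSet.{u}) : ZFSet.{u} :=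
  ZFSet.range fun τ : {τ : ZFSet.{u} // ∃ p ∈ G, ZFSet.pair τ p ∈ σ} => evalName G τ.1
termination_by σ.rank
decreasing_by
  obtain ⟨p, -, hp⟩ := τ.2
  exact rank_lt_of_pair_mem hp

theorem mem_evalName {G : Set ZFSet.{u}} {σ x : ZFSet.{u}} :
    x ∈ evalName G σ ↔ ∃ τ, ∃ p ∈ G, ZFSet.pair τ p ∈ σ ∧ evalName G τ = x := by
  rw [evalName, ZFSet.mem_range]
  constructor
  · rintro ⟨⟨τ, p, hp, h⟩, rfl⟩
    exact ⟨τ, p, hp, h, rfl⟩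
  · rintro ⟨τ, p, hp, h, rfl⟩
    exact ⟨⟨τ, p, hp, h⟩, rfl⟩

/-- The `G`-evaluation `Γ^G` of a class name. -/
def evalClass (G Γ : Set ZFSet.{u}) : Set ZFSet.{u} :=
  {x | ∃ τ, ∃ p ∈ G, ZFSet.pair τ p ∈ Γ ∧ evalName G τ = x}

/-- `M[G]`. -/
def Ext (M : Set ZFSet.{u}) (P : Forcing.{u}) (G : Set ZFSet.{u}) : Set ZFSet.{u} :=
  {x | ∃ σ ∈ Names M P, evalName G σ = x}

/-- `σ^G` as an element of `M[G]`. -/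
noncomputable def evalExt (M : Set ZFSet.{u}) (P : Forcing.{u}) (G : Set ZFSet.{u})
    (σ : Names M P) : Ext M P G :=
  ⟨evalName G σ, σ, σ.2, rfl⟩

/-- `φ(σ₀^G, …, σ_{m-1}^G)` holds in `M_Γ[G] = ⟨M[G], ∈, Γ₀^G, …, Γ_{n-1}^G⟩`. -/
def ExtSat {n m : ℕ} (M : Set ZFSet.{u}) (P : Forcing.{u}) (G : Set ZFSet.{u})
    (Γ : Fin n → Set ZFSet.{u}) (φ : (LSet n).Formula (Fin m)) (σ : Fin m → Names M P) : Prop :=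
  Sat (Ext M P G) (fun i => evalClass G (Γ i)) φ (fun i => evalExt M P G (σ i))

/-! ### The forcing relation and the forcing theorem -/

/-- `p ⊩ φ(σ₀, …, σ_{m-1})`, with class names `Γ` for the predicates. -/
def Forces {n m : ℕ} (M : Set ZFSet.{u}) (C : Set (Set ZFSet.{u})) (P : Forcing.{u})
    (Γ : Fin n → Set ZFSet.{u}) (p : ZFSet.{u}) (φ : (LSet n).Formula (Fin m))
    (σ : Fin m → Names M P) : Prop :=
  ∀ G, IsGeneric C P G → p ∈ G → ExtSat M P G Γ φ σ

/-- `⟨p, x₀, …, x_{m-1}⟩`, by iterated (Kuratowski) pairing. -/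
def tuple {m : ℕ} (p : ZFSet.{u}) (x : Fin m → ZFSet.{u}) : ZFSet.{u} :=
  (List.ofFn x).foldl ZFSet.pair p

/-- The definability lemma for `φ`: for all class names `Γ`, the class of tuples
`⟨p, σ₀, …, σ_{m-1}⟩` with `p ⊩ φ(σ₀, …, σ_{m-1})` is in `C`. -/
def DefinabilityLemma {n m : ℕ} (M : Set ZFSet.{u}) (C : Set (Set ZFSet.{u})) (P : Forcing.{u})
    (φ : (LSet n).Formula (Fin m)) : Prop :=
  ∀ Γ : Fin n → Set ZFSet.{u}, (∀ i, Γ i ∈ ClassNames C P) →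
    {z : ZFSet.{u} | ∃ p ∈ P.carrier, ∃ σ : Fin m → Names M P,
      z = tuple p (fun i => (σ i : ZFSet.{u})) ∧ Forces M C P Γ p φ σ} ∈ C

/-- The truth lemma for `φ`. -/
def TruthLemma {n m : ℕ} (M : Set ZFSet.{u}) (C : Set (Set ZFSet.{u})) (P : Forcing.{u})
    (φ : (LSet n).Formula (Fin m)) : Prop :=
  ∀ (σ : Fin m → Names M P) (Γ : Fin n → Set ZFSet.{u}), (∀ i, Γ i ∈ ClassNames C P) →
    ∀ G, IsGeneric C P G → ExtSat M P G Γ φ σ → ∃ p ∈ G, Forces M C P Γ p φ σ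

/-- `P` satisfies the forcing theorem for every `L^n`-formula, for every `n`. -/
def ForcingTheorem (M : Set ZFSet.{u}) (C : Set (Set ZFSet.{u})) (P : Forcing.{u}) : Prop :=
  ∀ (n m : ℕ) (φ : (LSet n).Formula (Fin m)), DefinabilityLemma M C P φ ∧ TruthLemma M C P φ

/-! ### Approachability by projections -/

/-- `Q` and `π` witness that `P`, with largest condition `one`, is approachable by projections:
`Q α` is the domain of the set forcing `P_α` (whose ordering is the one induced by `P`), and `π α`
is the map `π_{α+1} : P → P_{α+1}`; values at arguments other than `α ∈ Ord^M` and `p ∈ P` are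
irrelevant. -/
structure IsProjectionSystem (M : Set ZFSet.{u}) (C : Set (Set ZFSet.{u})) (P : Forcing.{u})
    (one : ZFSet.{u}) (Q : ZFSet.{u} → ZFSet.{u}) (π : ZFSet.{u} → ZFSet.{u} → ZFSet.{u}) :
    Prop where
  one_mem : one ∈ P.carrier
  le_one : ∀ p ∈ P.carrier, P.le p one
  set_forcing : ∀ α ∈ OrdOf M, Q α ∈ M
  seq_mem : {z : ZFSet.{u} | ∃ α ∈ OrdOf M, z = ZFSet.pair α (Q α)} ∈ C
  increasing : ∀ α ∈ OrdOf M, ∀ β ∈ OrdOf M, α ⊆ β → Q α ⊆ Q β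
  continuous : ∀ l ∈ OrdOf M, IsLimitOrd l → ∀ p, p ∈ Q l ↔ ∃ α ∈ l, p ∈ Q α
  iUnion_eq : ∀ p, p ∈ P.carrier ↔ ∃ α ∈ OrdOf M, p ∈ Q α
  proj_mem : {z : ZFSet.{u} | ∃ α ∈ OrdOf M, ∃ p ∈ P.carrier,
    z = ZFSet.pair (ZFSet.pair α p) (π α p)} ∈ C
  maps_to : ∀ α ∈ OrdOf M, ∀ p ∈ P.carrier, π α p ∈ Q (insert α α)
  map_one : ∀ α ∈ OrdOf M, π α one = one
  monotone : ∀ α ∈ OrdOf M, ∀ p ∈ P.carrier, ∀ q ∈ P.carrier, P.le p q → P.le (π α p) (π α q)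
  lift : ∀ α ∈ OrdOf M, ∀ p ∈ P.carrier, ∀ q ∈ Q (insert α α), P.le q (π α p) →
    ∃ r ∈ P.carrier, P.le r p ∧ P.le (π α r) q
  reflect : ∀ α ∈ OrdOf M, ∀ p ∈ Q α, ∀ q ∈ P.carrier, P.le (π α q) p → P.le q p
  identity : ∀ α ∈ OrdOf M, ∀ p ∈ Q α, π α p = p

/-- `P` is approachable by projections. -/
def ApproachableByProjections (M : Set ZFSet.{u}) (C : Set (Set ZFSet.{u})) (P : Forcing.{u}) :
    Prop :=
  ∃ one Q π, IsProjectionSystem M C P one Q π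

/-! ### Collapse forcings -/

/-- The finite partial functions from `ω` to `X`, as sets of ordered pairs. -/
def FinPartFun (X : Set ZFSet.{u}) : Set ZFSet.{u} :=
  {p | (p : Set ZFSet.{u}).Finite ∧
    (∀ z ∈ p, ∃ n ∈ ZFSet.omega, ∃ x ∈ X, z = ZFSet.pair n x) ∧
    ∀ n x y, ZFSet.pair n x ∈ p → ZFSet.pair n y ∈ p → x = y}

/-- `Col(ω, Ord)^M`, ordered by reverse inclusion. -/
def Col (M : Set ZFSet.{u}) : Forcing.{u} where
  carrier := FinPartFun (OrdOf M)
  le := fun p q => q ⊆ p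

/-- `Col_*(ω, Ord)^M`, the suborder of `Col(ω, Ord)^M` of all `p` with `dom p ∈ ω`. -/
def ColStar (M : Set ZFSet.{u}) : Forcing.{u} where
  carrier := {p | p ∈ FinPartFun (OrdOf M) ∧
    ∃ k ∈ ZFSet.omega, ∀ n, n ∈ k ↔ ∃ x, ZFSet.pair n x ∈ p}
  le := fun p q => q ⊆ p

/-- `ge` is an admissible choice of the objects `≥α`: distinct elements of `M` outside `Ord^M`,
chosen by a function in `C`. -/
structure IsGeCode (M : Set ZFSet.{u}) (C : Set (Set ZFSet.{u})) (ge : ZFSet.{u} → ZFSet.{u}) :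
    Prop where
  mem : ∀ α ∈ OrdOf M, ge α ∈ M ∧ ge α ∉ OrdOf M
  inj : ∀ α ∈ OrdOf M, ∀ β ∈ OrdOf M, ge α = ge β → α = β
  graph_mem : {z : ZFSet.{u} | ∃ α ∈ OrdOf M, z = ZFSet.pair α (ge α)} ∈ C

/-- `Col_≥(ω, Ord)^M`, where `ge α` is the object `≥α`. We have `p ≤ q` if and only if every `n` in
the domain of `q` is in the domain of `p` and either `p(n) = q(n)`, or `q(n)` is `≥α` and
`p(n) ∈ {β, ≥β}` for some `β ≥ α`. -/
def ColGe (M : Set ZFSet.{u}) (ge : ZFSet.{u} → ZFSet.{u}) : Forcing.{u} where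
  carrier := FinPartFun (OrdOf M ∪ ge '' OrdOf M)
  le := fun p q => ∀ n y, ZFSet.pair n y ∈ q → ∃ x, ZFSet.pair n x ∈ p ∧
    (x = y ∨ ∃ α ∈ OrdOf M, y = ge α ∧ ∃ β ∈ OrdOf M, α ⊆ β ∧ (x = β ∨ x = ge β))

end ClassForcing

/-! Everything reduces to one relation, "`p` forces `σ = τ`". It satisfies a recursion on names
(`FEq`), but each step quantifies over all conditions. For a proper class of conditions the values
of the recursion are therefore classes, and the axioms provide no such recursion. If the ordering
lives on a set `a`, one step for `σ` and `τ` consults only triples in `dom σ × dom τ × a`. The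
recursion is then witnessed by a set in `M`, hence definable (`FEq_iff_coind`, `dfn_FEq`).

Projections reduce the class case to the set case. Put `σ` and `τ` into a transitive set of `M`; the
conditions in that set all lie in some `P_α` (`exists_bound`). Then `p` forces `σ = τ` over `P` if
and only if `π_{α+1}(p)` does so over `P_{α+1}` (`FEq_proj_iff`). Indeed, the names only ask whether
a condition is below an element of `P_α`, which can be read off its projection, and every
strengthening of a projection is refined by the projection of a strengthening.

Once `FEq` is definable (`EqDefinable`), projections are no longer needed. Density of the conditions
that decide an equality gives the truth lemma for equality by induction on names
(`EqDefinable.truth`). Countability puts every condition into a generic filter, which identifies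
`FEq` with the semantic forcing relation (`EqDefinable.forces_iff`). The properties of `G` that
satisfy both the definability and the truth lemma (`Forceable`) include the atomic ones and are
closed under implication and quantification over names, so induction on formulas finishes (a).

For (b), all three orders consist of finite partial functions from `ω` to a class of values, ordered
pointwise, so it suffices to project the values (`IsValueSystem`, `IsPointwise.isProjectionSystem`).
An ordinal `x` goes to `min(x, α)`; in `Col_≥`, a value outside the set of index `α + 1` goes to
`≥α`. Besides, finiteness has to be definable over `M`, and the finite subsets of a set of `M` have
to form a set of `M` although power set is not assumed. -/

namespace ClassForcing

open FirstOrder FirstOrder.Language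

/-! ### Definability over `⟨M, C⟩` -/

/-- `R` is first-order definable over `M` from finitely many classes in `C`. -/
def Dfn (M : Set ZFSet.{u}) (C : Set (Set ZFSet.{u})) (R : (ℕ → ZFSet.{u}) → Prop) : Prop :=
  ∃ (n : ℕ) (A : Fin n → Set ZFSet.{u}), (∀ i, A i ∈ C) ∧ ∃ φ : (LSet n).Formula ℕ,
    ∀ v : ℕ → M, R (fun i => v i) ↔ @Formula.Realize _ M (setStructure M A) ℕ φ v

/-- `t` is a function on `M` whose graph is definable over `⟨M, C⟩`. -/
def DFun (M : Set ZFSet.{u}) (C : Set (Set ZFSet.{u})) (t : (ℕ → ZFSet.{u}) → ZFSet.{u}) : Prop :=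
  (∀ v : ℕ → M, t (fun i => v i) ∈ M) ∧ Dfn M C (fun v => v 0 = t (fun i => v (i + 1)))

variable {M : Set ZFSet.{u}} {C : Set (Set ZFSet.{u})}

/-- Agreement is required only at assignments in `M`. This is how unbounded quantifiers are traded
for quantifiers over `M`, once the witnesses are known to lie in `M`. -/
theorem Dfn.congr {R S : (ℕ → ZFSet.{u}) → Prop} (h : Dfn M C R)
    (hRS : ∀ v : ℕ → M, S (fun i => v i) ↔ R (fun i => v i)) : Dfn M C S := by
  obtain ⟨n, A, hA, φ, hφ⟩ := h
  exact ⟨n, A, hA, φ, fun v => (hRS v).trans (hφ v)⟩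

/-- The symbol `∈` of `L^n`. -/
def memSymbol (n : ℕ) : (LSet n).Relations 2 := SetRel.mem

/-- The `i`-th predicate symbol of `L^n`. -/
def predSymbol {n : ℕ} (i : Fin n) : (LSet n).Relations 1 := SetRel.pred i

theorem Dfn.var_mem (i j : ℕ) : Dfn M C (fun v => v i ∈ v j) := by
  refine ⟨0, Fin.elim0, fun i => i.elim0,
    Relations.formula₂ (memSymbol 0) (Term.var i) (Term.var j), fun v => ?_⟩
  let := setStructure M (Fin.elim0 : Fin 0 → Set ZFSet.{u})
  rw [Formula.realize_rel₂]
  exact Iff.rfl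

theorem Dfn.var_eq (i j : ℕ) : Dfn M C (fun v => v i = v j) := by
  refine ⟨0, Fin.elim0, fun i => i.elim0,
    Term.equal (L := LSet 0) (Term.var i) (Term.var j), fun v => ?_⟩
  let := setStructure M (Fin.elim0 : Fin 0 → Set ZFSet.{u})
  rw [Formula.realize_equal]
  exact Subtype.ext_iff.symm

theorem Dfn.var_mem_class {A : Set ZFSet.{u}} (hA : A ∈ C) (i : ℕ) :
    Dfn M C (fun v => v i ∈ A) := by
  refine ⟨1, fun _ => A, fun _ => hA,
    Relations.formula₁ (predSymbol (0 : Fin 1)) (Term.var i), fun v => ?_⟩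
  let := setStructure M (fun _ : Fin 1 => A)
  rw [Formula.realize_rel₁]
  exact Iff.rfl

theorem Dfn.not {R : (ℕ → ZFSet.{u}) → Prop} (h : Dfn M C R) : Dfn M C (fun v => ¬ R v) := by
  obtain ⟨n, A, hA, φ, hφ⟩ := h
  exact ⟨n, A, hA, ∼φ, fun v => not_congr (hφ v)⟩

/-- The inclusion of `L^n` in `L^m` given by a renaming of the predicates. -/
def renamePred {n m : ℕ} (g : Fin n → Fin m) : LSet n →ᴸ LSet m where
  onFunction := fun _ f => nomatch f
  onRelation := fun _ r => match r with
    | SetRel.mem => SetRel.mem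
    | SetRel.pred i => SetRel.pred (g i)

theorem realize_renamePred {n m : ℕ} (N : Set ZFSet.{u}) (A : Fin m → Set ZFSet.{u})
    (g : Fin n → Fin m) {ι : Type} (φ : (LSet n).Formula ι) (v : ι → N) :
    @Formula.Realize _ N (setStructure N A) ι ((renamePred g).onFormula φ) v ↔
      @Formula.Realize _ N (setStructure N (A ∘ g)) ι φ v := by
  let := setStructure N A
  let := setStructure N (A ∘ g)
  have : (renamePred g).IsExpansionOn N :=
    ⟨fun f _ => (nomatch f), fun {k} r _ => by change SetRel n k at r; cases r <;> rfl⟩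
  exact LHom.realize_onFormula _ _

theorem Dfn.and {R S : (ℕ → ZFSet.{u}) → Prop} (h : Dfn M C R) (h' : Dfn M C S) :
    Dfn M C (fun v => R v ∧ S v) := by
  obtain ⟨n, A, hA, φ, hφ⟩ := h
  obtain ⟨m, B, hB, ψ, hψ⟩ := h'
  refine ⟨n + m, Fin.append A B, fun i => ?_,
    (renamePred (Fin.castAdd m)).onFormula φ ⊓ (renamePred (Fin.natAdd n)).onFormula ψ, fun v => ?_⟩
  · refine Fin.addCases (fun i => ?_) (fun i => ?_) i
    · simpa using hA i
    · simpa using hB i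
  · let := setStructure M (Fin.append A B)
    rw [Formula.realize_inf]
    refine and_congr ?_ ?_
    · rw [realize_renamePred, hφ]
      have : Fin.append A B ∘ Fin.castAdd m = A := by ext1 i; simp
      rw [this]
    · rw [realize_renamePred, hψ]
      have : Fin.append A B ∘ Fin.natAdd n = B := by ext1 i; simp
      rw [this]

theorem Dfn.reindex {R : (ℕ → ZFSet.{u}) → Prop} (h : Dfn M C R) (f : ℕ → ℕ) :
    Dfn M C (fun v => R (fun i => v (f i))) := by
  obtain ⟨n, A, hA, φ, hφ⟩ := h
  refine ⟨n, A, hA, φ.relabel f, fun v => ?_⟩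
  let := setStructure M A
  rw [Formula.realize_relabel]
  exact hφ (v ∘ f)

/-- Variables work like de Bruijn indices: under a quantifier the bound variable is `v 0` and the
earlier ones are shifted by one. With this convention formulas can be assembled mechanically from
closure rules. -/
theorem Dfn.ex {R : (ℕ → ZFSet.{u}) → ZFSet.{u} → Prop}
    (h : Dfn M C (fun v => R (fun i => v (i + 1)) (v 0))) :
    Dfn M C (fun v => ∃ x ∈ M, R v x) := by
  obtain ⟨n, A, hA, φ, hφ⟩ := h
  let := setStructure M A
  let g : ℕ → ℕ ⊕ Fin 1 := fun i => Nat.casesOn i (Sum.inr 0) Sum.inl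
  let ψ : (LSet n).BoundedFormula ℕ 1 := BoundedFormula.relabel (n := 1) (k := 0) g φ
  refine ⟨n, A, hA, ψ.ex, fun v => ?_⟩
  have key : ∀ x : M, (R (fun i => v i) x ↔ ψ.Realize v (Fin.snoc default x)) := by
    intro x
    rw [BoundedFormula.realize_relabel]
    have e := hφ (fun i => Nat.casesOn i x v)
    refine e.trans ?_
    rw [Formula.Realize, iff_eq_eq]
    congr 1
    · funext i
      cases i with
      | zero => simp [g, Fin.snoc]
      | succ i => simp [g]
    · exact Subsingleton.elim _ _
  refine Iff.trans ?_ (BoundedFormula.realize_ex).symm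
  constructor
  · rintro ⟨x, hx, hR⟩
    exact ⟨⟨x, hx⟩, (key ⟨x, hx⟩).1 hR⟩
  · rintro ⟨x, hR⟩
    exact ⟨x, x.2, (key x).2 hR⟩

theorem Dfn.or {R S : (ℕ → ZFSet.{u}) → Prop} (h : Dfn M C R) (h' : Dfn M C S) :
    Dfn M C (fun v => R v ∨ S v) :=
  (h.not.and h'.not).not.congr fun v => by tauto

theorem Dfn.imp {R S : (ℕ → ZFSet.{u}) → Prop} (h : Dfn M C R) (h' : Dfn M C S) :
    Dfn M C (fun v => R v → S v) :=
  (h.and h'.not).not.congr fun v => by tauto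

theorem Dfn.iff {R S : (ℕ → ZFSet.{u}) → Prop} (h : Dfn M C R) (h' : Dfn M C S) :
    Dfn M C (fun v => R v ↔ S v) :=
  ((h.imp h').and (h'.imp h)).congr fun v => by tauto

theorem Dfn.all {R : (ℕ → ZFSet.{u}) → ZFSet.{u} → Prop}
    (h : Dfn M C (fun v => R (fun i => v (i + 1)) (v 0))) :
    Dfn M C (fun v => ∀ x ∈ M, R v x) :=
  (Dfn.ex (R := fun v x => ¬ R v x) h.not).not.congr fun v => by simp

/-- A proposition without variables is either true or false outside `M`, so a trivial formula
expresses it. -/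
theorem Dfn.prop (p : Prop) : Dfn M C (fun _ => p) := by
  by_cases hp : p
  · exact (Dfn.var_eq 0 0).congr fun v => by simp [hp]
  · exact (Dfn.var_eq 0 0).not.congr fun v => by simp [hp]

theorem DFun.congr {s t : (ℕ → ZFSet.{u}) → ZFSet.{u}} (h : DFun M C s)
    (hst : ∀ v : ℕ → M, t (fun i => v i) = s (fun i => v i)) : DFun M C t :=
  ⟨fun v => by rw [hst]; exact h.1 v,
    h.2.congr fun v => by rw [hst (fun i => v (i + 1))]⟩

theorem DFun.var (i : ℕ) : DFun M C (fun v => v i) :=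
  ⟨fun v => (v i).2, Dfn.var_eq 0 (i + 1)⟩

theorem DFun.reindex {t : (ℕ → ZFSet.{u}) → ZFSet.{u}} (h : DFun M C t) (f : ℕ → ℕ) :
    DFun M C (fun v => t (fun i => v (f i))) :=
  ⟨fun v => h.1 (fun i => v (f i)),
    (h.2.reindex (fun i => Nat.casesOn i 0 (fun i => f i + 1))).congr fun _ => Iff.rfl⟩

/-- Substitution of a definable function for the first variable. -/
theorem Dfn.subst {R : (ℕ → ZFSet.{u}) → ZFSet.{u} → Prop} {t : (ℕ → ZFSet.{u}) → ZFSet.{u}}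
    (h : Dfn M C (fun v => R (fun i => v (i + 1)) (v 0))) (ht : DFun M C t) :
    Dfn M C (fun v => R v (t v)) :=
  (Dfn.ex (R := fun v x => x = t v ∧ R v x) (ht.2.and h)).congr fun v =>
    ⟨fun hR => ⟨_, ht.1 v, rfl, hR⟩, fun ⟨_, _, h₁, h₂⟩ => h₁ ▸ h₂⟩

section
variable {s t t' : (ℕ → ZFSet.{u}) → ZFSet.{u}}

theorem Dfn.mem (hs : DFun M C s) (ht : DFun M C t) : Dfn M C (fun v => s v ∈ t v) := by
  have h₁ : Dfn M C (fun v => s v ∈ v 0) :=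
    Dfn.subst (R := fun v x => x ∈ v 0) (Dfn.var_mem 0 1) hs
  exact Dfn.subst (R := fun v x => s v ∈ x)
    (Dfn.subst (R := fun v x => x ∈ v 0) (Dfn.var_mem 0 1) (hs.reindex (· + 1))) ht

theorem Dfn.eq (hs : DFun M C s) (ht : DFun M C t) : Dfn M C (fun v => s v = t v) :=
  Dfn.subst (R := fun v x => x = t v) ht.2 hs

theorem Dfn.mem_class {A : Set ZFSet.{u}} (hA : A ∈ C) (ht : DFun M C t) :
    Dfn M C (fun v => t v ∈ A) :=
  Dfn.subst (R := fun _ x => x ∈ A) (Dfn.var_mem_class hA 0) ht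

end

end ClassForcing

namespace ClassForcing

open FirstOrder FirstOrder.Language

variable {M : Set ZFSet.{u}} {C : Set (Set ZFSet.{u})}

/-! ### Set theory in a model of `GB⁻` -/

namespace IsCTMGB

variable (hM : IsCTMGB M C)

include hM

theorem nonempty : M.Nonempty :=
  let ⟨w, hw, _⟩ := hM.infinity
  ⟨w, hw⟩

theorem mem_of_dfn {S : ZFSet.{u} → Prop} (h : Dfn M C (fun v => S (v 0))) :
    {x | x ∈ M ∧ S x} ∈ C := by
  obtain ⟨n, A, hA, φ, hφ⟩ := h
  -- Only `v 0` matters, so all variables may be identified and evaluated at a constant assignment.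
  convert hM.comprehension n 0 A hA (φ.relabel fun _ => 0) Matrix.vecEmpty using 1
  ext x
  simp only [Set.mem_ofPred_eq]
  rw [← exists_prop]
  refine exists_congr fun hx => (hφ fun _ => ⟨x, hx⟩).trans ?_
  let := setStructure M A
  rw [Sat, Formula.realize_relabel]
  exact Iff.rfl

theorem sep_mem {S : ZFSet.{u} → Prop} (h : Dfn M C (fun v => S (v 0))) {x : ZFSet.{u}}
    (hx : x ∈ M) : ZFSet.sep S x ∈ M := by
  obtain ⟨n, A, hA, φ, hφ⟩ := h
  obtain ⟨y, hy, H⟩ := hM.separation n 0 A hA (φ.relabel fun _ => 0) Matrix.vecEmpty x hx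
  convert hy
  ext z
  have key : ∀ z : M, (z : ZFSet.{u}) ∈ y ↔ (z : ZFSet.{u}) ∈ x ∧ S z := by
    intro z
    refine (H z).trans (and_congr_right fun _ => Iff.trans ?_ (hφ fun _ => z).symm)
    let := setStructure M A
    rw [Sat, Formula.realize_relabel]
    exact Iff.rfl
  rw [ZFSet.mem_sep]
  exact ⟨fun h => (key ⟨z, hM.transitive _ hx _ h.1⟩).2 h,
    fun h => (key ⟨z, hM.transitive _ hy _ h⟩).1 h⟩

theorem collect_aux {S : ZFSet.{u} → ZFSet.{u} → Prop} (h : Dfn M C (fun v => S (v 0) (v 1)))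
    {x : ZFSet.{u}} (hx : x ∈ M) (H : ∀ y ∈ x, ∃ z ∈ M, S y z) :
    ∃ w ∈ M, ∀ y ∈ x, ∃ z ∈ w, S y z := by
  obtain ⟨n, A, hA, φ, hφ⟩ := h
  let f : ℕ → Fin (0 + 2) := fun i => Nat.casesOn i 0 fun _ => 1
  have key : ∀ y z : M, S y z ↔
      Sat M A (φ.relabel f) (Matrix.vecCons y (Matrix.vecCons z Matrix.vecEmpty)) := by
    intro y z
    rw [Sat]
    let := setStructure M A
    rw [Formula.realize_relabel]
    exact hφ (Matrix.vecCons y (Matrix.vecCons z Matrix.vecEmpty) ∘ f)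
  obtain ⟨w, hw, H'⟩ := hM.collection n 0 A hA (φ.relabel f) Matrix.vecEmpty x hx
    (fun y hy => by
      obtain ⟨z, hz, h⟩ := H y hy
      exact ⟨⟨z, hz⟩, (key y ⟨z, hz⟩).1 h⟩)
  refine ⟨w, hw, fun y hy => ?_⟩
  obtain ⟨z, hz, h⟩ := H' ⟨y, hM.transitive _ hx _ hy⟩ hy
  exact ⟨z, hz, (key _ _).2 h⟩

/-- Set parameters are absorbed into class parameters through singletons. Hence `const`, and hence
the axiom schemes are elsewhere needed only without set parameters. -/
theorem singleton_class_mem {a : ZFSet.{u}} (ha : a ∈ M) : ({a} : Set ZFSet.{u}) ∈ C := by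
  convert hM.comprehension 0 1 Fin.elim0 (fun i => i.elim0)
    (Term.equal (Term.var 0) (Term.var 1)) ![⟨a, ha⟩] using 1
  ext x
  simp only [Set.mem_singleton_iff, Set.mem_ofPred_eq]
  let := setStructure M (Fin.elim0 : Fin 0 → Set ZFSet.{u})
  have : ∀ hx : x ∈ M, Sat M (Fin.elim0 : Fin 0 → Set ZFSet.{u})
      (Term.equal (Term.var 0) (Term.var 1)) (Matrix.vecCons ⟨x, hx⟩ ![⟨a, ha⟩]) ↔ x = a := by
    intro hx
    rw [Sat, Formula.realize_equal]
    exact Subtype.ext_iff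
  exact ⟨fun h => ⟨h ▸ ha, (this _).2 h⟩, fun ⟨hx, h⟩ => (this hx).1 h⟩

theorem const {a : ZFSet.{u}} (ha : a ∈ M) : DFun M C (fun _ => a) :=
  ⟨fun _ => ha, Dfn.var_mem_class (hM.singleton_class_mem ha) 0⟩

variable {s t t' : (ℕ → ZFSet.{u}) → ZFSet.{u}}

theorem bex {R : (ℕ → ZFSet.{u}) → ZFSet.{u} → Prop} (ht : DFun M C t)
    (h : Dfn M C (fun v => R (fun i => v (i + 1)) (v 0))) :
    Dfn M C (fun v => ∃ x ∈ t v, R v x) :=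
  (Dfn.ex (R := fun v x => x ∈ t v ∧ R v x)
    ((Dfn.mem (DFun.var 0) (ht.reindex (· + 1))).and h)).congr fun v =>
      ⟨fun ⟨x, hx, hR⟩ => ⟨x, hM.transitive _ (ht.1 v) _ hx, hx, hR⟩,
        fun ⟨x, _, hx, hR⟩ => ⟨x, hx, hR⟩⟩

theorem ball {R : (ℕ → ZFSet.{u}) → ZFSet.{u} → Prop} (ht : DFun M C t)
    (h : Dfn M C (fun v => R (fun i => v (i + 1)) (v 0))) :
    Dfn M C (fun v => ∀ x ∈ t v, R v x) :=
  (hM.bex (R := fun v x => ¬ R v x) ht h.not).not.congr fun v => by simp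

theorem subset (hs : DFun M C s) (ht : DFun M C t) : Dfn M C (fun v => s v ⊆ t v) :=
  (hM.ball (R := fun v x => x ∈ t v) hs (Dfn.mem (DFun.var 0) (ht.reindex (· + 1)))).congr
    fun _ => Iff.rfl

theorem ext_of_mem {x y : ZFSet.{u}} (hx : x ∈ M) (hy : y ∈ M) (h : ∀ z ∈ M, z ∈ x ↔ z ∈ y) :
    x = y :=
  ZFSet.ext fun z => ⟨fun hz => (h z (hM.transitive _ hx _ hz)).1 hz,
    fun hz => (h z (hM.transitive _ hy _ hz)).2 hz⟩

/-- By extensionality in the transitive set `M`, the graph of a function is definable as soon as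
membership in its values is. -/
theorem dfun_of_mem_iff (h : ∀ v : ℕ → M, t (fun i => v i) ∈ M)
    (h' : Dfn M C (fun v => v 0 ∈ t (fun i => v (i + 1)))) : DFun M C t :=
  ⟨h, (Dfn.all (R := fun v x => x ∈ v 0 ↔ x ∈ t (fun i => v (i + 1)))
    ((Dfn.var_mem 0 1).iff
      (h'.reindex (fun i => Nat.casesOn i 0 (fun i => i + 2))))).congr fun v =>
      ⟨fun e _ _ => e ▸ Iff.rfl, fun H => hM.ext_of_mem (v 0).2 (h fun i => v (i + 1)) H⟩⟩

theorem empty_mem : (∅ : ZFSet.{u}) ∈ M :=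
  let ⟨_, hw, h, _⟩ := hM.infinity
  hM.transitive _ hw _ h

theorem singleton_mem {x : ZFSet.{u}} (hx : x ∈ M) : ({x} : ZFSet.{u}) ∈ M := by
  simpa using hM.pairing x hx x hx

theorem pair_mem {x y : ZFSet.{u}} (hx : x ∈ M) (hy : y ∈ M) : ZFSet.pair x y ∈ M :=
  hM.pairing _ (hM.singleton_mem hx) _ (hM.pairing _ hx _ hy)

theorem of_pair_mem {x y : ZFSet.{u}} (h : ZFSet.pair x y ∈ M) : x ∈ M ∧ y ∈ M := by
  have : ({x, y} : ZFSet.{u}) ∈ M := hM.transitive _ h _ (by simp [ZFSet.pair])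
  exact ⟨hM.transitive _ this _ (by simp), hM.transitive _ this _ (by simp)⟩

theorem union_mem {x y : ZFSet.{u}} (hx : x ∈ M) (hy : y ∈ M) : x ∪ y ∈ M :=
  hM.union _ (hM.pairing _ hx _ hy)

theorem insert_mem {x y : ZFSet.{u}} (hx : x ∈ M) (hy : y ∈ M) : insert x y ∈ M := by
  rw [ZFSet.insert_eq]
  exact hM.union_mem (hM.singleton_mem hx) hy

theorem dfun_upair (hs : DFun M C s) (ht : DFun M C t) :
    DFun M C (fun v => ({s v, t v} : ZFSet.{u})) :=
  hM.dfun_of_mem_iff (fun v => hM.pairing _ (hs.1 v) _ (ht.1 v))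
    (((Dfn.eq (DFun.var 0) (hs.reindex (· + 1))).or
      (Dfn.eq (DFun.var 0) (ht.reindex (· + 1)))).congr fun _ => ZFSet.mem_pair)

theorem dfun_singleton (hs : DFun M C s) : DFun M C (fun v => ({s v} : ZFSet.{u})) :=
  (hM.dfun_upair hs hs).congr fun _ => by simp

theorem dfun_pair (hs : DFun M C s) (ht : DFun M C t) :
    DFun M C (fun v => ZFSet.pair (s v) (t v)) :=
  hM.dfun_upair (hM.dfun_singleton hs) (hM.dfun_upair hs ht)

theorem dfun_sUnion (hs : DFun M C s) : DFun M C (fun v => (ZFSet.sUnion (s v))) :=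
  hM.dfun_of_mem_iff (fun v => hM.union _ (hs.1 v))
    ((hM.bex (R := fun v x => v 0 ∈ x) (hs.reindex (· + 1)) (Dfn.var_mem 1 0)).congr
      fun _ => ZFSet.mem_sUnion)

theorem dfun_union (hs : DFun M C s) (ht : DFun M C t) : DFun M C (fun v => s v ∪ t v) :=
  hM.dfun_sUnion (hM.dfun_upair hs ht)

theorem dfun_insert (hs : DFun M C s) (ht : DFun M C t) : DFun M C (fun v => insert (s v) (t v)) :=
  (hM.dfun_union (hM.dfun_singleton hs) ht).congr fun _ => ZFSet.insert_eq _ _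

theorem dfun_empty : DFun M C (fun _ => (∅ : ZFSet.{u})) := hM.const hM.empty_mem

theorem collect {S : ZFSet.{u} → ZFSet.{u} → Prop} (h : Dfn M C (fun v => S (v 0) (v 1)))
    {x : ZFSet.{u}} (hx : x ∈ M) (H : ∀ y ∈ x, ∃ z ∈ M, S y z) :
    ∃ w ∈ M, (∀ y ∈ x, ∃ z ∈ w, S y z) ∧ ∀ z ∈ w, ∃ y ∈ x, S y z := by
  obtain ⟨w, hw, hw'⟩ := hM.collect_aux h hx H
  refine ⟨w.sep fun z => ∃ y ∈ x, S y z, hM.sep_mem ?_ hw, fun y hy => ?_, fun z hz => ?_⟩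
  · exact hM.bex (R := fun v y => S y (v 0)) (hM.const hx) h
  · obtain ⟨z, hz, h⟩ := hw' y hy
    exact ⟨z, ZFSet.mem_sep.2 ⟨hz, y, hy, h⟩, h⟩
  · exact (ZFSet.mem_sep.1 hz).2

theorem replace {F : ZFSet.{u} → ZFSet.{u}} (h : DFun M C (fun v => F (v 0)))
    {x : ZFSet.{u}} (hx : x ∈ M) : ∃ w ∈ M, ∀ z, z ∈ w ↔ ∃ y ∈ x, z = F y := by
  obtain ⟨w, hw, h₁, h₂⟩ := hM.collect (S := fun y z => z = F y)
    (Dfn.eq (DFun.var 1) (h.reindex fun _ => 0)) hx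
    (fun y hy => ⟨_, h.1 (fun _ => ⟨y, hM.transitive _ hx _ hy⟩), rfl⟩)
  refine ⟨w, hw, fun z => ⟨h₂ z, ?_⟩⟩
  rintro ⟨y, hy, rfl⟩
  obtain ⟨z, hz, rfl⟩ := h₁ y hy
  exact hz

/-- Without power set, the slices `{a} × y` come from replacement; they are collected and then
united. -/
theorem exists_prod {x y : ZFSet.{u}} (hx : x ∈ M) (hy : y ∈ M) : ZFSet.prod x y ∈ M := by
  obtain ⟨w, hw, h₁, h₂⟩ := hM.collect
    (S := fun a z => ∀ c ∈ M, c ∈ z ↔ ∃ b ∈ y, c = ZFSet.pair a b) (x := x)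
    (by apply_rules [Dfn.all, Dfn.iff, hM.bex, Dfn.mem, Dfn.eq, hM.dfun_pair, DFun.var, hM.const])
    hx (fun a ha => by
      obtain ⟨z, hz, h⟩ := hM.replace (F := fun b => ZFSet.pair a b) (x := y)
        (hM.dfun_pair (hM.const (hM.transitive _ hx _ ha)) (DFun.var 0)) hy
      exact ⟨z, hz, fun c _ => h c⟩)
  convert hM.union w hw
  ext c
  rw [ZFSet.mem_prod, ZFSet.mem_sUnion]
  constructor
  · rintro ⟨a, ha, b, hb, rfl⟩
    obtain ⟨z, hz, h⟩ := h₁ a ha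
    exact ⟨z, hz, (h _ (hM.pair_mem (hM.transitive _ hx _ ha) (hM.transitive _ hy _ hb))).2
      ⟨b, hb, rfl⟩⟩
  · rintro ⟨z, hz, hc⟩
    obtain ⟨a, ha, h⟩ := h₂ z hz
    have hzM := hM.transitive _ hw _ hz
    obtain ⟨b, hb, e⟩ := (h c (hM.transitive _ hzM _ hc)).1 hc
    exact ⟨a, ha, b, hb, e⟩

end IsCTMGB

end ClassForcing

/-! ### Recursive predicates on `M` witnessed by sets -/

namespace ClassForcing

variable {M : Set ZFSet.{u}} {C : Set (Set ZFSet.{u})}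

/-- Induction along the relation "`⟨τ, p⟩ ∈ σ` for some `p`". -/
theorem pair_induction {S : ZFSet.{u} → Prop}
    (h : ∀ σ, (∀ τ p, ZFSet.pair τ p ∈ σ → S τ) → S σ) (σ : ZFSet.{u}) : S σ :=
  (InvImage.wf ZFSet.rank Ordinal.lt_wf).induction (C := S) σ fun σ ih =>
    h σ fun τ _ hp => ih τ (rank_lt_of_pair_mem hp)

theorem mem_sUnion_sUnion_of_pair_mem {τ p σ : ZFSet.{u}} (h : ZFSet.pair τ p ∈ σ) :
    τ ∈ ZFSet.sUnion (ZFSet.sUnion σ) :=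
  ZFSet.mem_sUnion_of_mem (y := τ) (z := {τ}) (by simp)
    (ZFSet.mem_sUnion_of_mem (y := {τ}) (by simp [ZFSet.pair]) h)

/-- `y` belongs to a set of `M` each of whose elements satisfies `Ψ` relative to that set. -/
def Coind (M : Set ZFSet.{u}) (Ψ : ZFSet.{u} → ZFSet.{u} → Prop) (y : ZFSet.{u}) : Prop :=
  ∃ S ∈ M, y ∈ S ∧ ∀ z ∈ S, Ψ S z

namespace IsCTMGB

variable (hM : IsCTMGB M C)

include hM

theorem pair_left_mem {τ p σ : ZFSet.{u}} (hσ : σ ∈ M) (h : ZFSet.pair τ p ∈ σ) : τ ∈ M :=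
  (hM.of_pair_mem (hM.transitive _ hσ _ h)).1

theorem pair_right_mem {τ p σ : ZFSet.{u}} (hσ : σ ∈ M) (h : ZFSet.pair τ p ∈ σ) : p ∈ M :=
  (hM.of_pair_mem (hM.transitive _ hσ _ h)).2

theorem ex_class {A : Set ZFSet.{u}} {R : (ℕ → ZFSet.{u}) → ZFSet.{u} → Prop} (hA : A ∈ C)
    (h : Dfn M C (fun v => R (fun i => v (i + 1)) (v 0))) :
    Dfn M C (fun v => ∃ x ∈ A, R v x) :=
  (Dfn.ex (R := fun v x => x ∈ A ∧ R v x) ((Dfn.mem_class hA (DFun.var 0)).and h)).congr fun _ =>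
    ⟨fun ⟨x, hx, hR⟩ => ⟨x, hM.class_subset _ hA hx, hx, hR⟩, fun ⟨x, _, hx, hR⟩ => ⟨x, hx, hR⟩⟩

theorem all_class {A : Set ZFSet.{u}} {R : (ℕ → ZFSet.{u}) → ZFSet.{u} → Prop} (hA : A ∈ C)
    (h : Dfn M C (fun v => R (fun i => v (i + 1)) (v 0))) :
    Dfn M C (fun v => ∀ x ∈ A, R v x) :=
  (hM.ex_class (R := fun v x => ¬ R v x) hA h.not).not.congr fun v => by simp

theorem dfn_coind {Ψ : (ℕ → ZFSet.{u}) → ZFSet.{u} → ZFSet.{u} → Prop}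
    {t : (ℕ → ZFSet.{u}) → ZFSet.{u}}
    (h : Dfn M C (fun v => Ψ (fun i => v (i + 1 + 1)) (v 1) (v 0))) (ht : DFun M C t) :
    Dfn M C (fun v => Coind M (Ψ v) (t v)) :=
  Dfn.ex (R := fun v S => t v ∈ S ∧ ∀ z ∈ S, Ψ v S z)
    ((Dfn.mem (ht.reindex (· + 1)) (DFun.var 0)).and
      (hM.ball (R := fun v z => Ψ (fun i => v (i + 1)) (v 0) z) (DFun.var 0) h))

/-- Collection gathers witnesses for the elements of `x`. Since `Ψ` is monotone in the set, their
union is again a witness, common to all of them. -/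
theorem coind_collect {Ψ : ZFSet.{u} → ZFSet.{u} → Prop} (h : Dfn M C (fun v => Ψ (v 1) (v 0)))
    (mono : ∀ S S' z, S ⊆ S' → Ψ S z → Ψ S' z) {x : ZFSet.{u}} (hx : x ∈ M) :
    ∃ S ∈ M, (∀ z ∈ S, Ψ S z) ∧ ∀ y ∈ x, Coind M Ψ y → y ∈ S := by
  have hB : Dfn M C (fun v => Coind M Ψ (v 0)) :=
    hM.dfn_coind (Ψ := fun _ => Ψ) h (DFun.var 0)
  obtain ⟨w, hw, h₁, h₂⟩ := hM.collect (S := fun y S => y ∈ S ∧ ∀ z ∈ S, Ψ S z)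
    ((Dfn.var_mem 0 1).and (hM.ball (R := fun v z => Ψ (v 1) z) (DFun.var 1)
      (h.reindex fun i => Nat.casesOn i 0 fun _ => 2)))
    (hM.sep_mem hB hx) (fun y hy => (ZFSet.mem_sep.1 hy).2)
  refine ⟨ZFSet.sUnion w, hM.union _ hw, fun z hz => ?_, fun y hy hyB => ?_⟩
  · obtain ⟨S, hS, hz⟩ := ZFSet.mem_sUnion.1 hz
    obtain ⟨y, -, -, H⟩ := h₂ S hS
    exact mono S _ z (fun u hu => ZFSet.mem_sUnion_of_mem hu hS) (H z hz)
  · obtain ⟨S, hS, hyS, -⟩ := h₁ y (ZFSet.mem_sep.2 ⟨hy, hyB⟩)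
    exact ZFSet.mem_sUnion_of_mem hyS hS

/-- This replaces a recursion step: if `Ψ` at `z` consults only elements of the set `x`, then adding
`z` to the common witness for `x` gives a witness for `z`. -/
theorem coind_intro {Ψ : ZFSet.{u} → ZFSet.{u} → Prop} (h : Dfn M C (fun v => Ψ (v 1) (v 0)))
    (mono : ∀ S S' z, S ⊆ S' → Ψ S z → Ψ S' z) {x z : ZFSet.{u}} (hx : x ∈ M) (hz : z ∈ M)
    (H : ∀ S : ZFSet.{u}, (∀ y ∈ x, Coind M Ψ y → y ∈ S) → Ψ S z) : Coind M Ψ z := by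
  obtain ⟨S, hS, h₁, h₂⟩ := hM.coind_collect h mono hx
  have hsub : S ⊆ insert z S := fun u hu => ZFSet.mem_insert_of_mem _ hu
  refine ⟨insert z S, hM.insert_mem hz hS, ZFSet.mem_insert _ _, fun y hy => ?_⟩
  rcases ZFSet.mem_insert_iff.1 hy with rfl | hy
  · exact mono _ _ _ hsub (H S h₂)
  · exact mono _ _ _ hsub (h₁ y hy)

/-- A set `S` is transitive exactly if each of its elements `y` satisfies `y ⊆ S`, which is a
`Coind` condition. -/
theorem exists_transitive {x : ZFSet.{u}} (hx : x ∈ M) : ∃ T ∈ M, x ∈ T ∧ T.IsTransitive := by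
  suffices Coind M (fun S y => y ⊆ S) x from this
  induction x using ZFSet.inductionOn with
  | h x ih =>
    refine hM.coind_intro (Ψ := fun S y => y ⊆ S) (hM.subset (DFun.var 0) (DFun.var 1))
      (fun S S' z h h' => h'.trans h) hx hx
      fun S hS y hy => hS y hy (ih y hy (hM.transitive _ hx _ hy))

/-- The inductive notion agrees with the coinductive one because passing from a name to the names in
it is well-founded. The coinductive one needs a single quantifier over `M`. -/
theorem dfn_isName {A : Set ZFSet.{u}} (hA : A ∈ C) {t : (ℕ → ZFSet.{u}) → ZFSet.{u}}
    (ht : DFun M C t) : Dfn M C (fun v => IsName A (t v)) := by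
  let Ψ : ZFSet.{u} → ZFSet.{u} → Prop := fun S σ => ∀ x ∈ σ, ∃ τ ∈ S, ∃ p ∈ A, x = ZFSet.pair τ p
  have hΨ : Dfn M C (fun v => Ψ (v 1) (v 0)) := by
    apply_rules [hM.ball, hM.bex, hM.ex_class, Dfn.eq, hM.dfun_pair, DFun.var]
  refine (hM.dfn_coind (Ψ := fun _ => Ψ) hΨ ht).congr fun v => ⟨fun h => ?_, ?_⟩
  · have hv := ht.1 v
    generalize t (fun i => v i) = σ at h hv
    induction h with
    | mk σ h₁ h₂ ih =>
      refine hM.coind_intro hΨ (fun S S' z h h' x hx => ?_)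
        (hM.union _ (hM.union _ hv)) hv fun S hS x hx => ?_
      · obtain ⟨τ, hτ, H⟩ := h' x hx
        exact ⟨τ, h hτ, H⟩
      · obtain ⟨τ, p, hp, rfl⟩ := h₁ x hx
        exact ⟨τ, hS τ (mem_sUnion_sUnion_of_pair_mem hx)
          (ih τ p hx (hM.pair_left_mem hv hx)), p, hp, rfl⟩
  · rintro ⟨S, -, hσ, hS⟩
    generalize t (fun i => v i) = σ at hσ
    induction σ using pair_induction with
    | h σ ih =>
      refine .mk σ (fun x hx => ?_) fun τ p hτ => ?_
      · obtain ⟨τ, -, p, hp, rfl⟩ := hS σ hσ x hx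
        exact ⟨τ, p, hp, rfl⟩
      · obtain ⟨τ', hτ', p', -, e⟩ := hS σ hσ _ hτ
        obtain ⟨rfl, rfl⟩ := ZFSet.pair_inj.1 e
        exact ih _ _ hτ hτ'

theorem names_mem {P : Forcing.{u}} (hP : P.carrier ∈ C) : Names M P ∈ C :=
  hM.mem_of_dfn (hM.dfn_isName hP (DFun.var 0))

/-! ### Ordinals of `M` -/

theorem ordOf_mem : OrdOf M ∈ C := by
  have : Dfn M C (fun v => (∀ y ∈ v 0, y ⊆ v 0) ∧ ∀ x ∈ v 0, ∀ y ∈ x, y ⊆ x) := by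
    apply_rules [Dfn.and, hM.subset, hM.ball, DFun.var]
  convert hM.mem_of_dfn (S := fun x => (∀ y ∈ x, y ⊆ x) ∧ ∀ y ∈ x, ∀ z ∈ y, z ⊆ y) this using 1
  ext x
  exact and_congr_right fun _ => ZFSet.isOrdinal_iff_forall_mem_isTransitive

theorem ordOf_trans {α β : ZFSet.{u}} (hα : α ∈ OrdOf M) (hβ : β ∈ α) : β ∈ OrdOf M :=
  ⟨hM.transitive _ hα.1 _ hβ, hα.2.mem hβ⟩

theorem succ_mem_ordOf {α : ZFSet.{u}} (hα : α ∈ OrdOf M) : insert α α ∈ OrdOf M :=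
  ⟨hM.insert_mem hα.1 hα.1, ZFSet.isOrdinal_succ hα.2⟩

theorem empty_mem_ordOf : (∅ : ZFSet.{u}) ∈ OrdOf M := ⟨hM.empty_mem, ZFSet.isOrdinal_empty⟩

theorem sUnion_mem_ordOf {w : ZFSet.{u}} (hw : w ∈ M) (h : ∀ α ∈ w, α.IsOrdinal) :
    ZFSet.sUnion w ∈ OrdOf M := by
  refine ⟨hM.union _ hw, ZFSet.isOrdinal_iff_forall_mem_isTransitive.2
    ⟨ZFSet.IsTransitive.sUnion' fun α hα => (h α hα).isTransitive, fun y hy => ?_⟩⟩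
  obtain ⟨α, hα, hy⟩ := ZFSet.mem_sUnion.1 hy
  exact ((h α hα).mem hy).isTransitive

end IsCTMGB

end ClassForcing

namespace ClassForcing

variable {M : Set ZFSet.{u}} {C : Set (Set ZFSet.{u})}

/-! ### Forcing equality of names, by recursion -/

/-- The set `σ` is forced to be included in `τ` by `p`, when `E` is the relation of being forced to
be equal, with respect to the ordering `L`. -/
def FSub (L : ZFSet.{u} → ZFSet.{u} → Prop) (E : ZFSet.{u} → ZFSet.{u} → ZFSet.{u} → Prop)
    (σ τ p : ZFSet.{u}) : Prop :=
  ∀ ρ r, ZFSet.pair ρ r ∈ σ → ∀ q, L q p → L q r →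
    ∃ q', L q' q ∧ ∃ ρ' r', ZFSet.pair ρ' r' ∈ τ ∧ L q' r' ∧ E ρ ρ' q'

/-- One step of the recursion defining `FEq`. -/
def FStep (L : ZFSet.{u} → ZFSet.{u} → Prop) (E : ZFSet.{u} → ZFSet.{u} → ZFSet.{u} → Prop)
    (σ τ p : ZFSet.{u}) : Prop :=
  FSub L E σ τ p ∧ FSub L (fun ρ' ρ => E ρ ρ') τ σ p

theorem FSub.mono {L : ZFSet.{u} → ZFSet.{u} → Prop}
    {E E' : ZFSet.{u} → ZFSet.{u} → ZFSet.{u} → Prop} {σ τ p : ZFSet.{u}} (h : FSub L E σ τ p)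
    (H : ∀ ρ r ρ' r' q, ZFSet.pair ρ r ∈ σ → ZFSet.pair ρ' r' ∈ τ → L q r' → E ρ ρ' q → E' ρ ρ' q) :
    FSub L E' σ τ p := fun ρ r hr q hqp hqr =>
  let ⟨q', h₁, ρ', r', h₂, h₃, h₄⟩ := h ρ r hr q hqp hqr
  ⟨q', h₁, ρ', r', h₂, h₃, H ρ r ρ' r' q' hr h₂ h₃ h₄⟩

/-- The clause `L q r''` records that `q` lies in the field of the ordering; if the field is
contained in a set, this bounds the triples that `FStep` consults. -/
theorem FStep.mono {L : ZFSet.{u} → ZFSet.{u} → Prop}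
    {E E' : ZFSet.{u} → ZFSet.{u} → ZFSet.{u} → Prop} {σ τ p : ZFSet.{u}} (h : FStep L E σ τ p)
    (H : ∀ ρ r ρ' r' q r'', ZFSet.pair ρ r ∈ σ → ZFSet.pair ρ' r' ∈ τ → L q r'' →
      E ρ ρ' q → E' ρ ρ' q) : FStep L E' σ τ p :=
  ⟨h.1.mono fun ρ r ρ' r' q h₁ h₂ h₃ => H ρ r ρ' r' q r' h₁ h₂ h₃,
    h.2.mono fun ρ' r' ρ r q h₂ h₁ h₃ => H ρ r ρ' r' q r h₁ h₂ h₃⟩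

theorem FSub.downward {L : ZFSet.{u} → ZFSet.{u} → Prop} (hL : ∀ p q r, L p q → L q r → L p r)
    {E : ZFSet.{u} → ZFSet.{u} → ZFSet.{u} → Prop} {σ τ p p' : ZFSet.{u}} (h : FSub L E σ τ p)
    (hp : L p' p) : FSub L E σ τ p' :=
  fun ρ r hr q hqp hqr => h ρ r hr q (hL _ _ _ hqp hp) hqr

/-- The relation `p ⊩ σ = τ` for the ordering `L`, defined by recursion on names. -/
def FEq (L : ZFSet.{u} → ZFSet.{u} → Prop) (σ τ p : ZFSet.{u}) : Prop :=
  FStep L (fun ρ ρ' q => ∃ _ : ∃ r, ZFSet.pair ρ r ∈ σ, FEq L ρ ρ' q) σ τ p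
termination_by σ.rank
decreasing_by
  rename_i h
  exact rank_lt_of_pair_mem h.choose_spec

/-- The side condition in the definition only ensures termination: `FStep` consults the relation at
names `ρ` occurring in `σ` and nowhere else. -/
theorem FEq_iff {L : ZFSet.{u} → ZFSet.{u} → Prop} {σ τ p : ZFSet.{u}} :
    FEq L σ τ p ↔ FStep L (FEq L) σ τ p := by
  rw [FEq]
  exact ⟨fun h => h.mono fun _ _ _ _ _ _ _ _ _ h => h.2,
    fun h => h.mono fun ρ r _ _ _ _ hr _ _ h => ⟨⟨r, hr⟩, h⟩⟩

theorem FEq.downward {L : ZFSet.{u} → ZFSet.{u} → Prop} (hL : ∀ p q r, L p q → L q r → L p r)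
    {σ τ p p' : ZFSet.{u}} (h : FEq L σ τ p) (hp : L p' p) : FEq L σ τ p' :=
  FEq_iff.2 ⟨(FEq_iff.1 h).1.downward hL hp, (FEq_iff.1 h).2.downward hL hp⟩

/-- The operator whose greatest fixed point, restricted to sets in `M`, codes `FEq`. -/
def FCode (L : ZFSet.{u} → ZFSet.{u} → Prop) (S z : ZFSet.{u}) : Prop :=
  ∃ σ τ p, z = ZFSet.pair (ZFSet.pair σ τ) p ∧
    FStep L (fun ρ ρ' q => ZFSet.pair (ZFSet.pair ρ ρ') q ∈ S) σ τ p

namespace IsCTMGB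

variable (hM : IsCTMGB M C)

include hM

/-- By `hLM` the quantifiers over conditions may be restricted to `M`; transitivity does the same
for the quantifiers over names. -/
theorem dfn_fsub {L : (ℕ → ZFSet.{u}) → ZFSet.{u} → ZFSet.{u} → Prop}
    {E : (ℕ → ZFSet.{u}) → ZFSet.{u} → ZFSet.{u} → ZFSet.{u} → Prop}
    (hLM : ∀ (v : ℕ → M) q p, L (fun i => v i) q p → q ∈ M)
    (hL : Dfn M C (fun v => L (fun i => v (i + 2)) (v 0) (v 1)))
    (hE : Dfn M C (fun v => E (fun i => v (i + 3)) (v 0) (v 1) (v 2)))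
    {s t p : (ℕ → ZFSet.{u}) → ZFSet.{u}} (hs : DFun M C s) (ht : DFun M C t) (hp : DFun M C p) :
    Dfn M C (fun v => FSub (L v) (E v) (s v) (t v) (p v)) := by
  have hL' : ∀ {f : ℕ → ℕ} {i j}, Dfn M C (fun v => L (fun k => v (f k)) (v i) (v j)) :=
    fun {f i j} => (hL.reindex (fun k => Nat.casesOn k i fun k => Nat.casesOn k j f)).congr
      fun _ => Iff.rfl
  have hE' : ∀ {f : ℕ → ℕ} {i j l},
      Dfn M C (fun v => E (fun k => v (f k)) (v i) (v j) (v l)) := fun {f i j l} =>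
    (hE.reindex (fun k => Nat.casesOn k i fun k => Nat.casesOn k j fun k =>
      Nat.casesOn k l f)).congr fun _ => Iff.rfl
  have key : Dfn M C (fun v => FSub (L fun k => v (k + 3)) (E fun k => v (k + 3))
      (v 0) (v 1) (v 2)) := by
    have : Dfn M C (fun v => ∀ ρ ∈ M, ∀ r ∈ M, ZFSet.pair ρ r ∈ v 0 → ∀ q ∈ M,
        L (fun k => v (k + 3)) q (v 2) → L (fun k => v (k + 3)) q r →
        ∃ q' ∈ M, L (fun k => v (k + 3)) q' q ∧ ∃ ρ' ∈ M, ∃ r' ∈ M,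
          ZFSet.pair ρ' r' ∈ v 1 ∧ L (fun k => v (k + 3)) q' r' ∧
            E (fun k => v (k + 3)) ρ ρ' q') := by
      apply_rules [Dfn.and, Dfn.all, Dfn.ex, Dfn.imp, Dfn.mem, hM.dfun_pair, DFun.var]
    refine this.congr fun v => ?_
    constructor
    · intro h ρ _ r _ hr q _ hqp hqr
      obtain ⟨q', h₁, ρ', r', h₂, h₃, h₄⟩ := h ρ r hr q hqp hqr
      exact ⟨q', hLM (fun k => v (k + 3)) _ _ h₁, h₁, ρ', hM.pair_left_mem (v 1).2 h₂, r',
        hM.pair_right_mem (v 1).2 h₂, h₂, h₃, h₄⟩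
    · intro h ρ r hr q hqp hqr
      obtain ⟨q', -, h₁, ρ', -, r', -, h₂, h₃, h₄⟩ := h ρ (hM.pair_left_mem (v 0).2 hr) r
        (hM.pair_right_mem (v 0).2 hr) hr q (hLM (fun k => v (k + 3)) _ _ hqp) hqp hqr
      exact ⟨q', h₁, ρ', r', h₂, h₃, h₄⟩
  have k₁ := Dfn.subst (R := fun v x => FSub (L fun k => v (k + 2)) (E fun k => v (k + 2))
    x (v 0) (v 1)) key (hs.reindex (· + 2))
  have k₂ := Dfn.subst (R := fun v x => FSub (L fun k => v (k + 1)) (E fun k => v (k + 1))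
    (s fun k => v (k + 1)) x (v 0)) k₁ (ht.reindex (· + 1))
  exact Dfn.subst (R := fun v x => FSub (L v) (E v) (s v) (t v) x) k₂ hp

theorem dfn_fstep {L : (ℕ → ZFSet.{u}) → ZFSet.{u} → ZFSet.{u} → Prop}
    {E : (ℕ → ZFSet.{u}) → ZFSet.{u} → ZFSet.{u} → ZFSet.{u} → Prop}
    (hLM : ∀ (v : ℕ → M) q p, L (fun i => v i) q p → q ∈ M)
    (hL : Dfn M C (fun v => L (fun i => v (i + 2)) (v 0) (v 1)))
    (hE : Dfn M C (fun v => E (fun i => v (i + 3)) (v 0) (v 1) (v 2)))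
    {s t p : (ℕ → ZFSet.{u}) → ZFSet.{u}} (hs : DFun M C s) (ht : DFun M C t) (hp : DFun M C p) :
    Dfn M C (fun v => FStep (L v) (E v) (s v) (t v) (p v)) := by
  refine (hM.dfn_fsub hLM hL hE hs ht hp).and
    (hM.dfn_fsub (E := fun v ρ' ρ => E v ρ ρ') hLM hL ?_ ht hs hp)
  exact (hE.reindex (fun k => Nat.casesOn k 1 fun k => Nat.casesOn k 0 fun k => k + 2)).congr
    fun _ => Iff.rfl

theorem dfn_fcode {L : (ℕ → ZFSet.{u}) → ZFSet.{u} → ZFSet.{u} → Prop}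
    (hLM : ∀ (v : ℕ → M) q p, L (fun i => v i) q p → q ∈ M)
    (hL : Dfn M C (fun v => L (fun i => v (i + 2)) (v 0) (v 1))) :
    Dfn M C (fun v => FCode (L fun i => v (i + 1 + 1)) (v 1) (v 0)) := by
  have h₁ : Dfn M C (fun v => FStep (L fun i => v (i + 5))
      (fun ρ ρ' q => ZFSet.pair (ZFSet.pair ρ ρ') q ∈ v 4) (v 2) (v 1) (v 0)) := by
    refine hM.dfn_fstep (L := fun v => L fun i => v (i + 5))
      (E := fun v ρ ρ' q => ZFSet.pair (ZFSet.pair ρ ρ') q ∈ v 4)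
      (fun v => hLM fun i => v (i + 5)) ?_ ?_ (DFun.var 2) (DFun.var 1) (DFun.var 0)
    · exact (hL.reindex (fun k => Nat.casesOn k 0 fun k => Nat.casesOn k 1 fun k => k + 7)).congr
        fun _ => Iff.rfl
    · apply_rules [Dfn.mem, hM.dfun_pair, DFun.var]
  have h₂ : Dfn M C (fun v => ∃ σ ∈ M, ∃ τ ∈ M, ∃ p ∈ M, v 0 = ZFSet.pair (ZFSet.pair σ τ) p ∧
      FStep (L fun i => v (i + 2)) (fun ρ ρ' q => ZFSet.pair (ZFSet.pair ρ ρ') q ∈ v 1) σ τ p) := by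
    apply_rules [Dfn.ex, Dfn.and, Dfn.eq, hM.dfun_pair, DFun.var]
  refine h₂.congr fun v => ⟨?_, fun ⟨σ, _, τ, _, p, _, h⟩ => ⟨σ, τ, p, h⟩⟩
  rintro ⟨σ, τ, p, h, h'⟩
  have hz : ZFSet.pair (ZFSet.pair σ τ) p ∈ M := h ▸ (v 0).2
  exact ⟨σ, (hM.of_pair_mem (hM.of_pair_mem hz).1).1, τ, (hM.of_pair_mem (hM.of_pair_mem hz).1).2,
    p, (hM.of_pair_mem hz).2, h, h'⟩

/-- This is where set size is essential: conditions come from `a`, so one step consults only a set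
of triples and `coind_intro` applies. Conversely, any witness is correct, by induction on `σ`. -/
theorem FEq_iff_coind {L : ZFSet.{u} → ZFSet.{u} → Prop} {a : ZFSet.{u}} (ha : a ∈ M)
    (hLa : ∀ q p, L q p → q ∈ a) (hL : Dfn M C (fun v => L (v 0) (v 1)))
    {σ τ p : ZFSet.{u}} (hσ : σ ∈ M) (hτ : τ ∈ M) (hp : p ∈ M) :
    FEq L σ τ p ↔ Coind M (FCode L) (ZFSet.pair (ZFSet.pair σ τ) p) := by
  constructor
  · intro h
    induction σ using pair_induction generalizing τ p with
    | h σ ih =>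
      refine hM.coind_intro (hM.dfn_fcode (L := fun _ => L)
        (fun _ q p h => hM.transitive _ ha _ (hLa q p h)) hL) ?_
        (x := ZFSet.prod (ZFSet.prod (ZFSet.sUnion (ZFSet.sUnion σ))
          (ZFSet.sUnion (ZFSet.sUnion τ))) a)
        (hM.exists_prod (hM.exists_prod (hM.union _ (hM.union _ hσ)) (hM.union _ (hM.union _ hτ)))
          ha) (hM.pair_mem (hM.pair_mem hσ hτ) hp) ?_
      · rintro S S' z hS ⟨σ, τ, p, rfl, h⟩
        exact ⟨σ, τ, p, rfl, h.mono fun _ _ _ _ _ _ _ _ _ h => hS h⟩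
      · refine fun S hS => ⟨σ, τ, p, rfl, (FEq_iff.1 h).mono fun ρ r ρ' r' q r'' h₁ h₂ h₃ h₄ => ?_⟩
        refine hS _ (by
          rw [ZFSet.pair_mem_prod, ZFSet.pair_mem_prod]
          exact ⟨⟨mem_sUnion_sUnion_of_pair_mem h₁, mem_sUnion_sUnion_of_pair_mem h₂⟩,
            hLa _ _ h₃⟩) (ih ρ r h₁ (hM.pair_left_mem hσ h₁) (hM.pair_left_mem hτ h₂)
            (hM.transitive _ ha _ (hLa _ _ h₃)) h₄)
  · rintro ⟨S, -, h, hS⟩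
    clear hσ hτ hp
    induction σ using pair_induction generalizing τ p with
    | h σ ih =>
      obtain ⟨σ', τ', p', e, h'⟩ := hS _ h
      obtain ⟨e₁, rfl⟩ := ZFSet.pair_inj.1 e
      obtain ⟨rfl, rfl⟩ := ZFSet.pair_inj.1 e₁
      exact FEq_iff.2 (h'.mono fun ρ r ρ' r' q _ h₁ _ _ h₄ => ih ρ r h₁ h₄)

/-- The ordering may vary with the parameters, which is needed to quantify over the stages
`P_{α+1}`. The hypothesis `hL` gives the formula, while `hL'` serves its correctness at fixed
parameters. -/
theorem dfn_FEq {L : (ℕ → ZFSet.{u}) → ZFSet.{u} → ZFSet.{u} → Prop}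
    {a s t p : (ℕ → ZFSet.{u}) → ZFSet.{u}} (ha : DFun M C a)
    (hLa : ∀ (v : ℕ → M) q p, L (fun i => v i) q p → q ∈ a (fun i => v i))
    (hL : Dfn M C (fun v => L (fun i => v (i + 2)) (v 0) (v 1)))
    (hL' : ∀ v : ℕ → M, Dfn M C (fun w => L (fun i => v i) (w 0) (w 1)))
    (hs : DFun M C s) (ht : DFun M C t) (hp : DFun M C p) :
    Dfn M C (fun v => FEq (L v) (s v) (t v) (p v)) := by
  refine (hM.dfn_coind (Ψ := fun v => FCode (L v))
    (t := fun v => ZFSet.pair (ZFSet.pair (s v) (t v)) (p v))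
    (hM.dfn_fcode (fun v q p h => hM.transitive _ (ha.1 v) _ (hLa v q p h)) hL)
    (hM.dfun_pair (hM.dfun_pair hs ht) hp)).congr fun v => ?_
  exact hM.FEq_iff_coind (ha.1 v) (hLa v) (hL' v) (hs.1 v) (ht.1 v) (hp.1 v)

end IsCTMGB

end ClassForcing

/-! ### Transfer of forced equality along projections -/

namespace ClassForcing

variable {M : Set ZFSet.{u}} {C : Set (Set ZFSet.{u})} {P : Forcing.{u}}

/-- The ordering of `P`, restricted to its conditions. -/
def Forcing.Le (P : Forcing.{u}) (p q : ZFSet.{u}) : Prop :=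
  p ∈ P.carrier ∧ q ∈ P.carrier ∧ P.le p q

theorem Forcing.pair_mem_leClass {p q : ZFSet.{u}} :
    ZFSet.pair p q ∈ P.leClass ↔ P.Le p q := by
  constructor
  · rintro ⟨p', hp, q', hq, e, h⟩
    obtain ⟨rfl, rfl⟩ := ZFSet.pair_inj.1 e
    exact ⟨hp, hq, h⟩
  · rintro ⟨hp, hq, h⟩
    exact ⟨p, hp, q, hq, rfl, h⟩

theorem IsClassForcing.le_refl (hP : IsClassForcing C P) {p : ZFSet.{u}} (hp : p ∈ P.carrier) :
    P.Le p p := ⟨hp, hp, hP.refl p hp⟩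

theorem IsClassForcing.le_trans (hP : IsClassForcing C P) (p q r : ZFSet.{u}) (h : P.Le p q)
    (h' : P.Le q r) : P.Le p r :=
  ⟨h.1, h'.2.1, hP.trans p h.1 q h.2.1 r h'.2.1 h.2.2 h'.2.2⟩

theorem IsCTMGB.dfn_le (hM : IsCTMGB M C) (hP : IsClassForcing C P)
    {s t : (ℕ → ZFSet.{u}) → ZFSet.{u}} (hs : DFun M C s) (ht : DFun M C t) :
    Dfn M C (fun v => P.Le (s v) (t v)) :=
  (Dfn.mem_class hP.le_mem (hM.dfun_pair hs ht)).congr fun _ => Forcing.pair_mem_leClass.symm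

/-- The ordering of `P`, restricted to the conditions in the set `a`. -/
def Forcing.LeOn (P : Forcing.{u}) (a p q : ZFSet.{u}) : Prop := p ∈ a ∧ q ∈ a ∧ P.Le p q

theorem IsClassForcing.leOn_trans (hP : IsClassForcing C P) (a p q r : ZFSet.{u})
    (h : P.LeOn a p q) (h' : P.LeOn a q r) : P.LeOn a p r :=
  ⟨h.1, h'.2.1, hP.le_trans _ _ _ h.2.2 h'.2.2⟩

namespace IsProjectionSystem

variable {one : ZFSet.{u}} {Q : ZFSet.{u} → ZFSet.{u}} {π : ZFSet.{u} → ZFSet.{u} → ZFSet.{u}}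

theorem mem_carrier (h : IsProjectionSystem M C P one Q π) {α p : ZFSet.{u}} (hα : α ∈ OrdOf M)
    (hp : p ∈ Q α) : p ∈ P.carrier := (h.iUnion_eq p).2 ⟨α, hα, hp⟩

theorem proj_mem_carrier (h : IsProjectionSystem M C P one Q π) (hM : IsCTMGB M C)
    {α p : ZFSet.{u}} (hα : α ∈ OrdOf M) (hp : p ∈ P.carrier) : π α p ∈ P.carrier :=
  h.mem_carrier (hM.succ_mem_ordOf hα) (h.maps_to α hα p hp)

theorem leOn_proj (h : IsProjectionSystem M C P one Q π) (hM : IsCTMGB M C)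
    {α p q : ZFSet.{u}} (hα : α ∈ OrdOf M) (hpq : P.Le p q) :
    P.LeOn (Q (insert α α)) (π α p) (π α q) :=
  ⟨h.maps_to α hα p hpq.1, h.maps_to α hα q hpq.2.1, h.proj_mem_carrier hM hα hpq.1,
    h.proj_mem_carrier hM hα hpq.2.1, h.monotone α hα p hpq.1 q hpq.2.1 hpq.2.2⟩

theorem exists_lift (h : IsProjectionSystem M C P one Q π) (hM : IsCTMGB M C)
    {α p q : ZFSet.{u}} (hα : α ∈ OrdOf M) (hp : p ∈ P.carrier)
    (hq : P.LeOn (Q (insert α α)) q (π α p)) :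
    ∃ r, P.Le r p ∧ P.LeOn (Q (insert α α)) (π α r) q := by
  obtain ⟨r, hr, hrp, hrq⟩ := h.lift α hα p hp q hq.1 hq.2.2.2.2
  exact ⟨r, ⟨hr, hp, hrp⟩, h.maps_to α hα r hr, hq.1, h.proj_mem_carrier hM hα hr, hq.2.2.1, hrq⟩

/-- Together with `leOn_proj` and `identity`: being below an element of `Q α` is decided by the
projection. -/
theorem le_of_proj_le (h : IsProjectionSystem M C P one Q π) {α p q : ZFSet.{u}}
    (hα : α ∈ OrdOf M) (hp : p ∈ P.carrier) (hq : q ∈ Q α)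
    (hpq : P.LeOn (Q (insert α α)) (π α p) q) : P.Le p q :=
  ⟨hp, hpq.2.2.2.1, h.reflect α hα q hq p hp hpq.2.2.2.2⟩

/-- From left to right, a condition `s` below `π p` is lifted to some `t` below `p`; the answer
found below `t` is projected back. From right to left, the answer `s` found below `π q` is lifted to
some `t` below `q`. In both cases `reflect` transfers the comparison with conditions in the names.
Since `π t` is only below `s`, not equal to it, `E'` has to be downward closed. -/
theorem FSub_proj_iff (h : IsProjectionSystem M C P one Q π) (hM : IsCTMGB M C)
    (hP : IsClassForcing C P) {α σ τ p : ZFSet.{u}} (hα : α ∈ OrdOf M)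
    (hσ : ∀ ρ, ∀ r ∈ P.carrier, ZFSet.pair ρ r ∈ σ → r ∈ Q α)
    (hτ : ∀ ρ, ∀ r ∈ P.carrier, ZFSet.pair ρ r ∈ τ → r ∈ Q α) (hp : p ∈ P.carrier)
    {E E' : ZFSet.{u} → ZFSet.{u} → ZFSet.{u} → Prop}
    (hE : ∀ ρ r ρ' r', ZFSet.pair ρ r ∈ σ → ZFSet.pair ρ' r' ∈ τ → ∀ q ∈ P.carrier,
      E ρ ρ' q ↔ E' ρ ρ' (π α q))
    (hE' : ∀ ρ ρ' q q', P.LeOn (Q (insert α α)) q' q → E' ρ ρ' q → E' ρ ρ' q') :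
    FSub P.Le E σ τ p ↔ FSub (P.LeOn (Q (insert α α))) E' σ τ (π α p) := by
  have htr := hP.leOn_trans (Q (insert α α))
  constructor
  · intro H ρ r hr s hsp hsr
    have hrα := hσ ρ r hsr.2.2.2.1 hr
    obtain ⟨t, htp, hts⟩ := h.exists_lift hM hα hp hsp
    obtain ⟨q', hq't, ρ', r', hr', hq'r', hE₁⟩ :=
      H ρ r hr t htp (h.le_of_proj_le hα htp.1 hrα (htr _ _ _ hts hsr))
    refine ⟨π α q', htr _ _ _ (h.leOn_proj hM hα hq't) hts, ρ', r', hr', ?_,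
      (hE ρ r ρ' r' hr hr' q' hq't.1).1 hE₁⟩
    have := h.leOn_proj hM hα hq'r'
    rwa [h.identity α hα r' (hτ ρ' r' hq'r'.2.1 hr')] at this
  · intro H ρ r hr q hqp hqr
    have hqr' := h.leOn_proj hM hα hqr
    rw [h.identity α hα r (hσ ρ r hqr.2.1 hr)] at hqr'
    obtain ⟨s, hsq, ρ', r', hr', hsr', hE₁⟩ := H ρ r hr _ (h.leOn_proj hM hα hqp) hqr'
    obtain ⟨t, htq, hts⟩ := h.exists_lift hM hα hqp.1 hsq
    exact ⟨t, htq, ρ', r', hr', h.le_of_proj_le hα htq.1 (hτ ρ' r' hsr'.2.2.2.1 hr')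
      (htr _ _ _ hts hsr'), (hE ρ r ρ' r' hr hr' t htq.1).2 (hE' _ _ _ _ hts hE₁)⟩

theorem FEq_proj_iff (h : IsProjectionSystem M C P one Q π) (hM : IsCTMGB M C)
    (hP : IsClassForcing C P) {α T : ZFSet.{u}} (hα : α ∈ OrdOf M) (hT : T.IsTransitive)
    (hTα : ∀ p ∈ T, p ∈ P.carrier → p ∈ Q α) {σ τ p : ZFSet.{u}} (hσ : σ ∈ T) (hτ : τ ∈ T)
    (hp : p ∈ P.carrier) :
    FEq P.Le σ τ p ↔ FEq (P.LeOn (Q (insert α α))) σ τ (π α p) := by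
  have hpair : ∀ {τ p}, ZFSet.pair τ p ∈ T → τ ∈ T ∧ p ∈ T := by
    intro τ p h'
    have h₁ : ({τ, p} : ZFSet.{u}) ∈ T := hT _ h' (by simp [ZFSet.pair])
    exact ⟨hT _ h₁ (by simp), hT _ h₁ (by simp)⟩
  have hcond : ∀ {σ}, σ ∈ T → ∀ ρ, ∀ r ∈ P.carrier, ZFSet.pair ρ r ∈ σ → r ∈ Q α :=
    fun hσ ρ r hr h' => hTα r (hpair (hT _ hσ h')).2 hr
  induction σ using pair_induction generalizing τ p with
  | h σ ih =>
    rw [FEq_iff, FEq_iff]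
    have hE : ∀ ρ r ρ' r', ZFSet.pair ρ r ∈ σ → ZFSet.pair ρ' r' ∈ τ → ∀ q ∈ P.carrier,
        (FEq P.Le ρ ρ' q ↔ FEq (P.LeOn (Q (insert α α))) ρ ρ' (π α q)) :=
      fun ρ r ρ' r' hr hr' q hq => ih ρ r hr (hpair (hT _ hσ hr)).1 (hpair (hT _ hτ hr')).1 hq
    exact and_congr
      (h.FSub_proj_iff hM hP hα (hcond hσ) (hcond hτ) hp hE
        fun _ _ _ _ h₁ h₂ => h₂.downward (hP.leOn_trans _) h₁)
      (h.FSub_proj_iff hM hP hα (hcond hτ) (hcond hσ) hp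
        (fun ρ r ρ' r' hr hr' => hE ρ' r' ρ r hr' hr)
        fun _ _ _ _ h₁ h₂ => h₂.downward (hP.leOn_trans _) h₁)

/-- `Q` is arbitrary off `Ord^M`, so definitions refer to it through its graph class. -/
theorem exists_seq_class (h : IsProjectionSystem M C P one Q π) :
    ∃ A ∈ C, ∀ α S, ZFSet.pair α S ∈ A ↔ α ∈ OrdOf M ∧ S = Q α := by
  refine ⟨_, h.seq_mem, fun α S => ⟨?_, ?_⟩⟩
  · rintro ⟨α', hα', e⟩
    obtain ⟨rfl, rfl⟩ := ZFSet.pair_inj.1 e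
    exact ⟨hα', rfl⟩
  · rintro ⟨hα, rfl⟩
    exact ⟨α, hα, rfl⟩

theorem exists_proj_class (h : IsProjectionSystem M C P one Q π) :
    ∃ B ∈ C, ∀ α p q, ZFSet.pair (ZFSet.pair α p) q ∈ B ↔
      α ∈ OrdOf M ∧ p ∈ P.carrier ∧ q = π α p := by
  refine ⟨_, h.proj_mem, fun α p q => ⟨?_, ?_⟩⟩
  · rintro ⟨α', hα', p', hp', e⟩
    obtain ⟨e₁, rfl⟩ := ZFSet.pair_inj.1 e
    obtain ⟨rfl, rfl⟩ := ZFSet.pair_inj.1 e₁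
    exact ⟨hα', hp', rfl⟩
  · rintro ⟨hα, hp, rfl⟩
    exact ⟨α, hα, p, hp, rfl⟩

/-- Collection yields a set of indices for the conditions in `T`; their supremum works because the
sequence is increasing. -/
theorem exists_bound (h : IsProjectionSystem M C P one Q π) (hM : IsCTMGB M C)
    (hP : IsClassForcing C P) {T : ZFSet.{u}} (hT : T ∈ M) :
    ∃ α ∈ OrdOf M, ∀ p ∈ T, p ∈ P.carrier → p ∈ Q α := by
  obtain ⟨A, hA, hseq⟩ := h.exists_seq_class
  obtain ⟨w, hw, h₁, h₂⟩ := hM.collect (x := T.sep (· ∈ P.carrier))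
    (S := fun p α => α ∈ OrdOf M ∧ ∃ S ∈ M,
      ZFSet.pair α S ∈ A ∧ p ∈ S)
    (by apply_rules [Dfn.mem_class, Dfn.and, Dfn.ex, hM.ordOf_mem, Dfn.mem, hM.dfun_pair, DFun.var])
    (hM.sep_mem (Dfn.mem_class hP.carrier_mem (DFun.var 0)) hT) (fun p hp => by
      obtain ⟨α, hα, hpα⟩ := (h.iUnion_eq p).1 (ZFSet.mem_sep.1 hp).2
      exact ⟨α, hα.1, hα, Q α, h.set_forcing α hα, (hseq _ _).2 ⟨hα, rfl⟩, hpα⟩)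
  have hord : ∀ α ∈ w, α ∈ OrdOf M := fun α hα => let ⟨_, _, h', _⟩ := h₂ α hα; h'
  have hsup := hM.sUnion_mem_ordOf hw fun α hα => (hord α hα).2
  refine ⟨_, hsup, fun p hp hpP => ?_⟩
  obtain ⟨α, hα, hα', S, -, hS, hpS⟩ := h₁ p (ZFSet.mem_sep.2 ⟨hp, hpP⟩)
  obtain ⟨-, rfl⟩ := (hseq _ _).1 hS
  exact h.increasing α hα' _ hsup (fun x hx => ZFSet.mem_sUnion_of_mem hx hα) hpS

end IsProjectionSystem

/-- The recursively defined relation `p ⊩ σ = τ` is definable. -/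
def EqDefinable (M : Set ZFSet.{u}) (C : Set (Set ZFSet.{u})) (P : Forcing.{u}) : Prop :=
  Dfn M C (fun v => v 2 ∈ P.carrier ∧ FEq P.Le (v 0) (v 1) (v 2))

/-- The defining formula guesses a transitive set `T` containing both names, a bound `α` for its
conditions, and the data `Q α`, `Q (α + 1)` and `π α p`. By `FEq_proj_iff` every guess gives the
same answer, and by `exists_bound` some guess exists. -/
theorem ApproachableByProjections.eqDefinable (hM : IsCTMGB M C) (hP : IsClassForcing C P)
    (h : ApproachableByProjections M C P) : EqDefinable M C P := by
  obtain ⟨one, Q, π, h⟩ := h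
  obtain ⟨A, hA, memA⟩ := h.exists_seq_class
  obtain ⟨B, hB, memB⟩ := h.exists_proj_class
  have hLeOn : ∀ {s t t' : (ℕ → ZFSet.{u}) → ZFSet.{u}}, DFun M C s → DFun M C t → DFun M C t' →
      Dfn M C (fun v => P.LeOn (s v) (t v) (t' v)) := fun hs ht ht' =>
    (Dfn.mem ht hs).and ((Dfn.mem ht' hs).and (hM.dfn_le hP ht ht'))
  have hF : ∀ {a s t p : (ℕ → ZFSet.{u}) → ZFSet.{u}}, DFun M C a → DFun M C s → DFun M C t →
      DFun M C p → Dfn M C (fun v => FEq (P.LeOn (a v)) (s v) (t v) (p v)) :=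
    fun {a _ _ _} ha hs ht hp => hM.dfn_FEq (L := fun v => P.LeOn (a v)) ha
      (fun _ _ _ h => h.1) (hLeOn (ha.reindex (· + 2)) (DFun.var 0) (DFun.var 1))
      (fun v => hLeOn (hM.const (ha.1 v)) (DFun.var 0) (DFun.var 1)) hs ht hp
  have hD : Dfn M C (fun v => v 2 ∈ P.carrier ∧ ∃ T ∈ M, ∃ α ∈ OrdOf M, ∃ a ∈ M, ∃ b ∈ M, ∃ q ∈ M,
      (∀ x ∈ T, x ⊆ T) ∧ v 0 ∈ T ∧ v 1 ∈ T ∧ ZFSet.pair α a ∈ A ∧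
      ZFSet.pair (insert α α) b ∈ A ∧ ZFSet.pair (ZFSet.pair α (v 2)) q ∈ B ∧
      (∀ x ∈ T, x ∈ P.carrier → x ∈ a) ∧ FEq (P.LeOn b) (v 0) (v 1) q) := by
    have := hM.ordOf_mem
    have := hP.carrier_mem
    apply_rules (maxDepth := 200) [Dfn.mem_class, hF, Dfn.and, Dfn.ex, hM.ex_class, hM.subset,
      hM.ball, Dfn.imp, Dfn.mem,
      hM.dfun_pair, hM.dfun_insert, DFun.var]
  refine hD.congr fun v => and_congr_right fun hp => ?_
  constructor
  · intro hF
    obtain ⟨T, hT, h₁, h₂⟩ := hM.exists_transitive (hM.pairing _ (v 0).2 _ (v 1).2)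
    have hv0 : (v 0 : ZFSet.{u}) ∈ T := h₂ _ h₁ (by simp)
    have hv1 : (v 1 : ZFSet.{u}) ∈ T := h₂ _ h₁ (by simp)
    obtain ⟨α, hα, hTα⟩ := h.exists_bound hM hP hT
    have hα' := hM.succ_mem_ordOf hα
    exact ⟨T, hT, α, hα, Q α, h.set_forcing α hα, Q (insert α α), h.set_forcing _ hα', π α (v 2),
      hM.class_subset _ hP.carrier_mem (h.proj_mem_carrier hM hα hp), h₂, hv0, hv1,
      (memA ..).2 ⟨hα, rfl⟩, (memA ..).2 ⟨hα', rfl⟩, (memB ..).2 ⟨hα, hp, rfl⟩, hTα,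
      (h.FEq_proj_iff hM hP hα h₂ hTα hv0 hv1 hp).1 hF⟩
  · rintro ⟨T, -, α, hα, a, -, b, -, q, -, h₂, hv0, hv1, ha, hb, hq, hTα, hF⟩
    obtain ⟨-, rfl⟩ := (memA ..).1 ha
    obtain ⟨-, rfl⟩ := (memA ..).1 hb
    obtain ⟨-, -, rfl⟩ := (memB ..).1 hq
    exact (h.FEq_proj_iff hM hP hα h₂ hTα hv0 hv1 hp).2 hF

end ClassForcing

namespace ClassForcing

open FirstOrder FirstOrder.Language

variable {M : Set ZFSet.{u}} {C : Set (Set ZFSet.{u})}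

/-! ### Finitely many variables, tuples -/

theorem Dfn.exists_support {R : (ℕ → ZFSet.{u}) → Prop} (h : Dfn M C R) :
    ∃ N, ∀ v w : ℕ → M, (∀ i < N, v i = w i) → (R (fun i => v i) ↔ R (fun i => w i)) := by
  obtain ⟨n, A, -, φ, hφ⟩ := h
  obtain ⟨N, hN⟩ := φ.freeVarFinset.bddAbove
  refine ⟨N + 1, fun v w hvw => (hφ v).trans (Iff.trans ?_ (hφ w).symm)⟩
  let := setStructure M A
  have key : ∀ v' : ℕ → M, (∀ a : φ.freeVarFinset, v a = v' a) →
      ((BoundedFormula.restrictFreeVar φ (fun a => (a : ℕ))).Realize v default ↔ φ.Realize v') :=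
    fun v' h => BoundedFormula.realize_restrictFreeVar v' h
  exact (key v fun _ => rfl).symm.trans
    (key w fun a => hvw a (Nat.lt_succ_of_le (hN (Finset.mem_coe.2 a.2))))

theorem Dfn.update {R : (ℕ → ZFSet.{u}) → Prop} (h : Dfn M C R) (hM : IsCTMGB M C) (k : ℕ)
    {a : ZFSet.{u}} (ha : a ∈ M) : Dfn M C (fun v => R (Function.update v k a)) := by
  refine Dfn.subst (R := fun v x => R (Function.update v k x)) ?_ (hM.const ha)
  refine (h.reindex (Function.update (fun i => i + 1) k 0)).congr fun v => iff_of_eq ?_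
  congr 1
  funext i
  by_cases hi : i = k
  · subst hi; simp
  · simp [hi]

/-- All variables but `v 0` may be replaced by parameters in `M`. -/
theorem Dfn.fix {R : (ℕ → ZFSet.{u}) → ZFSet.{u} → Prop} (hM : IsCTMGB M C)
    (h : Dfn M C (fun v => R (fun i => v (i + 1)) (v 0))) (v : ℕ → M) :
    Dfn M C (fun w => R (fun i => v i) (w 0)) := by
  obtain ⟨N, hN⟩ := h.exists_support
  -- Parameters are substituted one at a time; a formula has finitely many free variables, so
  -- finitely many substitutions suffice.
  have key : ∀ k, Dfn M C (fun w => R (fun i => if i < k then v i else w (i + 1)) (w 0)) := by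
    intro k
    induction k with
    | zero => simpa using h
    | succ k ih =>
      refine (ih.update hM (k + 1) (v k).2).congr fun w => iff_of_eq ?_
      congr 1
      · funext i
        by_cases hi : i = k
        · subst hi; simp
        · have : i < k + 1 ↔ i < k := by omega
          simp [hi, this]
  refine (key N).congr fun w => ?_
  have := hN (fun i => Nat.casesOn i (w 0) v)
    (fun i => Nat.casesOn i (w 0) fun i => if i < N then v i else w (i + 1)) (fun i hi => ?_)
  · refine this.trans (iff_of_eq ?_)
    congr 1
    funext i
    by_cases hi : i < N <;> simp [hi]
  · cases i with
    | zero => rfl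
    | succ i => simp [show i < N by omega]

theorem Dfn.ex_tuple {m : ℕ} {R : (ℕ → ZFSet.{u}) → (Fin m → ZFSet.{u}) → Prop}
    (h : Dfn M C (fun v => R (fun i => v (i + m)) (fun i => v i))) :
    Dfn M C (fun v => ∃ x : Fin m → ZFSet.{u}, (∀ i, x i ∈ M) ∧ R v x) := by
  induction m with
  | zero =>
    refine h.congr fun v => ⟨fun ⟨x, _, hx⟩ => ?_, fun hR => ⟨_, fun i => i.elim0, hR⟩⟩
    exact (congrArg (R fun i => v i) (Subsingleton.elim _ _)).mp hx
  | succ m ih =>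
    have h' := ih (R := fun w x => R (fun i => w (i + 1)) (Fin.cons (w 0) x))
      -- After the inner `m` quantifiers the outer variable `x₀` has index `m`; it must become the
      -- head of the tuple, so the first `m + 1` indices are rotated.
      ((h.reindex fun k => if k = 0 then m else if k ≤ m then k - 1 else k).congr fun v => by
        refine iff_of_eq ?_
        congr 1
        · funext i
          have h₁ : i + (m + 1) ≠ 0 := by omega
          have h₂ : ¬ i + (m + 1) ≤ m := by omega
          simp only [h₁, h₂, if_false]
          congr 2
          omega
        · funext i
          refine Fin.cases ?_ (fun i => ?_) i
          · simp
          · have : (i : ℕ) + 1 ≤ m := i.2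
            simp [this])
    refine (Dfn.ex (R := fun v x₀ => ∃ x : Fin m → ZFSet.{u}, (∀ i, x i ∈ M) ∧
      R v (Fin.cons x₀ x)) h').congr fun v => ⟨?_, ?_⟩
    · rintro ⟨x, hx, hR⟩
      exact ⟨x 0, hx 0, Fin.tail x, fun i => hx _, by rwa [Fin.cons_self_tail]⟩
    · rintro ⟨x₀, hx₀, x, hx, hR⟩
      exact ⟨Fin.cons x₀ x, fun i => Fin.cases hx₀ hx i, hR⟩

theorem Dfn.all_fin {m : ℕ} {R : (ℕ → ZFSet.{u}) → Fin m → Prop}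
    (h : ∀ i, Dfn M C (fun v => R v i)) : Dfn M C (fun v => ∀ i, R v i) := by
  induction m with
  | zero => exact (Dfn.prop True).congr fun v => by simp
  | succ m ih =>
    exact ((h 0).and (ih fun i => h i.succ)).congr fun v => Fin.forall_fin_succ

theorem IsCTMGB.dfun_tuple (hM : IsCTMGB M C) {m : ℕ} {p : (ℕ → ZFSet.{u}) → ZFSet.{u}}
    {x : Fin m → (ℕ → ZFSet.{u}) → ZFSet.{u}} (hp : DFun M C p) (hx : ∀ i, DFun M C (x i)) :
    DFun M C (fun v => tuple (p v) (fun i => x i v)) := by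
  induction m generalizing p with
  | zero => exact hp.congr fun v => by simp [tuple]
  | succ m ih =>
    refine (ih (hM.dfun_pair hp (hx 0)) fun i => hx i.succ).congr fun v => ?_
    simp [tuple, List.ofFn_succ]

end ClassForcing

namespace ClassForcing

variable {M : Set ZFSet.{u}} {C : Set (Set ZFSet.{u})} {P : Forcing.{u}} {G : Set ZFSet.{u}}

/-! ### Generic filters -/

/-- Rasiowa–Sikorski: enumerate `C`, descend into each class that is dense, stay put at the others,
and take the upward closure of the resulting sequence. -/
theorem exists_generic (hM : IsCTMGB M C) (hP : IsClassForcing C P) {p : ZFSet.{u}}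
    (hp : p ∈ P.carrier) : ∃ G, IsGeneric C P G ∧ p ∈ G := by
  obtain ⟨f, hf⟩ := hM.countable_classes.exists_eq_range ⟨_, hP.carrier_mem⟩
  have hstep : ∀ (n : ℕ) (q : P.carrier), ∃ r : P.carrier, P.le r q ∧
      (IsDenseIn P (f n) → (r : ZFSet.{u}) ∈ f n) := by
    intro n q
    by_cases hn : IsDenseIn P (f n)
    · obtain ⟨d, hd, hdq⟩ := hn.2 q q.2
      exact ⟨⟨d, hn.1 hd⟩, hdq, fun _ => hd⟩
    · exact ⟨q, hP.refl q q.2, fun h => absurd h hn⟩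
  choose g hg hg' using hstep
  let s : ℕ → P.carrier := fun n => Nat.rec (motive := fun _ => P.carrier) ⟨p, hp⟩ g n
  have hs : ∀ n, P.Le (s (n + 1)) (s n) := by
    intro n
    exact ⟨(s (n + 1)).2, (s n).2, hg n (s n)⟩
  have hs' : ∀ n k, P.Le (s (n + k)) (s n) := by
    intro n k
    induction k with
    | zero => exact hP.le_refl (s n).2
    | succ k ih => exact hP.le_trans _ _ _ (hs (n + k)) ih
  refine ⟨{q | ∃ n, P.Le (s n) q}, ⟨⟨?_, ⟨p, 0, hP.le_refl hp⟩, ?_, ?_⟩, ?_⟩, 0, hP.le_refl hp⟩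
  · rintro q ⟨n, hn⟩
    exact hn.2.1
  · rintro q ⟨n, hn⟩ r hr hqr
    exact ⟨n, hP.le_trans _ _ _ hn ⟨hn.2.1, hr, hqr⟩⟩
  · rintro q ⟨n, hn⟩ r ⟨k, hk⟩
    refine ⟨s (n + k), ⟨n + k, hP.le_refl (s (n + k)).2⟩, (hP.le_trans _ _ _ (hs' n k) hn).2.2,
      (hP.le_trans _ _ _ (add_comm k n ▸ hs' k n) hk).2.2⟩
  · intro D hD hdense
    obtain ⟨n, rfl⟩ : D ∈ Set.range f := hf ▸ hD
    exact ⟨s (n + 1), hg' n (s n) hdense, n + 1, hP.le_refl (s (n + 1)).2⟩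

theorem IsGeneric.exists_le (hG : IsGeneric C P G) {p q : ZFSet.{u}} (hp : p ∈ G) (hq : q ∈ G) :
    ∃ r ∈ G, P.Le r p ∧ P.Le r q := by
  obtain ⟨r, hr, h₁, h₂⟩ := hG.1.directed p hp q hq
  have := hG.1.subset
  exact ⟨r, hr, ⟨this hr, this hp, h₁⟩, ⟨this hr, this hq, h₂⟩⟩

theorem IsGeneric.mem_of_le (hG : IsGeneric C P G) {p q : ZFSet.{u}} (hp : p ∈ G)
    (hpq : P.Le p q) : q ∈ G := hG.1.upward p hp q hpq.2.1 hpq.2.2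

theorem IsGeneric.exists_mem (hG : IsGeneric C P G) (hM : IsCTMGB M C) (hP : IsClassForcing C P)
    {D : ZFSet.{u} → Prop} (hD : Dfn M C (fun v => v 0 ∈ P.carrier ∧ D (v 0)))
    (h : ∀ q ∈ P.carrier, ∃ d, P.Le d q ∧ D d) : ∃ d ∈ G, D d := by
  obtain ⟨d, hd, hdG⟩ := hG.2 _ (hM.mem_of_dfn (S := fun x => x ∈ P.carrier ∧ D x) hD)
    ⟨fun x hx => hx.2.1, fun q hq => by
      obtain ⟨d, hd, hdD⟩ := h q hq
      exact ⟨d, ⟨hM.class_subset _ hP.carrier_mem hd.1, hd.1, hdD⟩, hd.2.2⟩⟩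
  exact ⟨d, hdG, hd.2.2⟩

/-- A class dense below `p` becomes dense when the conditions incompatible with `p` are added, and
no such condition lies in a filter containing `p`. -/
theorem IsGeneric.exists_mem_below (hG : IsGeneric C P G) (hM : IsCTMGB M C)
    (hP : IsClassForcing C P) {D : ZFSet.{u} → Prop}
    (hD : Dfn M C (fun v => v 0 ∈ P.carrier ∧ D (v 0))) {p : ZFSet.{u}} (hp : p ∈ G)
    (h : ∀ q, P.Le q p → ∃ d, P.Le d q ∧ D d) : ∃ d ∈ G, D d := by
  have hpP := hG.1.subset hp
  have hpM := hM.class_subset _ hP.carrier_mem hpP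
  obtain ⟨d, hdG, hd⟩ := hG.exists_mem hM hP
    (D := fun d => (d ∈ P.carrier ∧ D d) ∨ ¬ ∃ r ∈ M, P.Le r d ∧ P.Le r p) (by
      have hle := @IsCTMGB.dfn_le _ _ _ hM hP
      exact (Dfn.mem_class hP.carrier_mem (DFun.var 0)).and (hD.or (Dfn.not (Dfn.ex
        ((hle (DFun.var 0) (DFun.var 1)).and (hle (DFun.var 0) (hM.const hpM)))))))
    (fun q hq => by
      by_cases hc : ∃ r ∈ M, P.Le r q ∧ P.Le r p
      · obtain ⟨r, -, hrq, hrp⟩ := hc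
        obtain ⟨d, hd, hdD⟩ := h r hrp
        exact ⟨d, hP.le_trans _ _ _ hd hrq, Or.inl ⟨hd.1, hdD⟩⟩
      · exact ⟨q, hP.le_refl hq, Or.inr hc⟩)
  rcases hd with hd | hd
  · exact ⟨d, hdG, hd.2⟩
  · obtain ⟨r, hr, hrd, hrp⟩ := hG.exists_le hdG hp
    exact absurd ⟨r, hM.class_subset _ hP.carrier_mem hrd.1, hrd, hrp⟩ hd

/-! ### The truth lemma for equality -/

/-- The condition `p` decides that some element of `σ` is not in `τ`. -/
def Separates (P : Forcing.{u}) (E : ZFSet.{u} → ZFSet.{u} → ZFSet.{u} → Prop)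
    (σ τ p : ZFSet.{u}) : Prop :=
  ∃ ρ r, ZFSet.pair ρ r ∈ σ ∧ P.Le p r ∧
    ∀ q, P.Le q p → ∀ ρ' r', ZFSet.pair ρ' r' ∈ τ → P.Le q r' → ¬ E ρ ρ' q

theorem exists_separates {E : ZFSet.{u} → ZFSet.{u} → ZFSet.{u} → Prop} {σ τ p : ZFSet.{u}}
    (h : ¬ FSub P.Le E σ τ p) : ∃ q, P.Le q p ∧ Separates P E σ τ q := by
  unfold FSub at h
  push Not at h
  obtain ⟨ρ, r, hr, q, hqp, hqr, H⟩ := h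
  exact ⟨q, hqp, ρ, r, hr, hqr, H⟩

/-- If `ρ^G` were equal to some `ρ'^G` in `τ^G`, then by `ht` a condition in `G` would be related by
`E`; a common extension inside `G` contradicts the separation. `E` is kept abstract so that both
inclusions are covered. -/
theorem not_subset_of_separates (hG : IsGeneric C P G) (hP : IsClassForcing C P)
    {E : ZFSet.{u} → ZFSet.{u} → ZFSet.{u} → Prop} {σ τ p : ZFSet.{u}}
    (hE : ∀ ρ ρ' q q', P.Le q' q → E ρ ρ' q → E ρ ρ' q')
    (ht : ∀ ρ r ρ' r', ZFSet.pair ρ r ∈ σ → ZFSet.pair ρ' r' ∈ τ →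
      evalName G ρ = evalName G ρ' → ∃ p ∈ G, E ρ ρ' p)
    (hp : p ∈ G) (h : Separates P E σ τ p) : ¬ evalName G σ ⊆ evalName G τ := by
  intro hsub
  obtain ⟨ρ, r, hr, hpr, H⟩ := h
  obtain ⟨ρ', r', hr'G, hr', e⟩ :=
    mem_evalName.1 (hsub (mem_evalName.2 ⟨ρ, r, hG.mem_of_le hp hpr, hr, rfl⟩))
  obtain ⟨s, hs, hsE⟩ := ht ρ r ρ' r' hr hr' e.symm
  obtain ⟨t, ht, htp, htr'⟩ := hG.exists_le hp hr'G
  obtain ⟨q, hq, hqt, hqs⟩ := hG.exists_le ht hs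
  exact H q (hP.le_trans _ _ _ hqt htp) ρ' r' hr' (hP.le_trans _ _ _ hqt htr')
    (hE _ _ _ _ hqs hsE)

/-- Definability of `FEq` is available only at conditions, so the clause on the carrier is carried
along under every substitution. -/
theorem EqDefinable.dfn (h : EqDefinable M C P) {s t p : (ℕ → ZFSet.{u}) → ZFSet.{u}}
    (hs : DFun M C s) (ht : DFun M C t) (hp : DFun M C p) :
    Dfn M C (fun v => p v ∈ P.carrier ∧ FEq P.Le (s v) (t v) (p v)) := by
  have h₀ : Dfn M C (fun v => v 0 ∈ P.carrier ∧ FEq P.Le (v 2) (v 1) (v 0)) :=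
    h.reindex fun k => 2 - k
  have h₁ : Dfn M C (fun v => v 0 ∈ P.carrier ∧ FEq P.Le (s fun k => v (k + 2)) (v 1) (v 0)) :=
    Dfn.subst (R := fun v x => v 0 ∈ P.carrier ∧ FEq P.Le x (v 1) (v 0))
      (h₀.reindex fun k => Nat.casesOn k 1 fun k => Nat.casesOn k 2 fun _ => 0)
      (hs.reindex (· + 2))
  have h₂ : Dfn M C (fun v => v 0 ∈ P.carrier ∧
      FEq P.Le (s fun k => v (k + 1)) (t fun k => v (k + 1)) (v 0)) :=
    Dfn.subst (R := fun v x => v 0 ∈ P.carrier ∧ FEq P.Le (s fun k => v (k + 1)) x (v 0))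
      (h₁.reindex fun k => Nat.casesOn k 1 fun k => Nat.casesOn k 0 fun k => k + 2)
      (ht.reindex (· + 1))
  exact Dfn.subst (R := fun v x => x ∈ P.carrier ∧ FEq P.Le (s v) (t v) x) h₂ hp

/-- For `⟨ρ, r⟩` in `σ` with `r ∈ G`, the conditions that decide which `ρ'` from `τ` equals `ρ` are
dense below a common extension of `p` and `r` in `G`. -/
theorem subset_of_FSub (hM : IsCTMGB M C)
    (hP : IsClassForcing C P) (hG : IsGeneric C P G)
    {E : ZFSet.{u} → ZFSet.{u} → ZFSet.{u} → Prop}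
    (hE : Dfn M C (fun v => v 2 ∈ P.carrier ∧ E (v 0) (v 1) (v 2)))
    {σ τ p : ZFSet.{u}} (hσ : σ ∈ M) (hτ : τ ∈ M)
    (ht : ∀ ρ r ρ' r', ZFSet.pair ρ r ∈ σ → ZFSet.pair ρ' r' ∈ τ → ∀ p ∈ G, E ρ ρ' p →
      evalName G ρ = evalName G ρ')
    (hp : p ∈ G) (hF : FSub P.Le E σ τ p) : evalName G σ ⊆ evalName G τ := by
  intro x hx
  obtain ⟨ρ, r, hrG, hr, rfl⟩ := mem_evalName.1 hx
  obtain ⟨q, hq, hqp, hqr⟩ := hG.exists_le hp hrG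
  have hρ := hM.pair_left_mem hσ hr
  obtain ⟨d, hdG, ρ', -, r', -, hr', hdr', -, hd⟩ := hG.exists_mem_below hM hP
    (D := fun d => ∃ ρ' ∈ M, ∃ r' ∈ M, ZFSet.pair ρ' r' ∈ τ ∧ P.Le d r' ∧
      d ∈ P.carrier ∧ E ρ ρ' d)
    (by
      have hE' : Dfn M C (fun v => v 2 ∈ P.carrier ∧ E ρ (v 1) (v 2)) :=
        Dfn.subst (R := fun v x => v 2 ∈ P.carrier ∧ E x (v 1) (v 2))
          (hE.reindex fun k => Nat.casesOn k 0 fun k => k + 2) (hM.const hρ)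
      refine (Dfn.mem_class hP.carrier_mem (DFun.var 0)).and
        (Dfn.ex (Dfn.ex (Dfn.and ?_ (Dfn.and ?_ ?_))))
      · exact Dfn.mem (hM.dfun_pair (DFun.var 1) (DFun.var 0)) (hM.const hτ)
      · exact hM.dfn_le hP (DFun.var 2) (DFun.var 0)
      · exact hE')
    hq (fun q' hq' => by
      obtain ⟨d, hd, ρ', r', hr', hdr', hdE⟩ := hF ρ r hr q' (hP.le_trans _ _ _ hq' hqp)
        (hP.le_trans _ _ _ hq' hqr)
      exact ⟨d, hd, ρ', hM.pair_left_mem hτ hr', r', hM.pair_right_mem hτ hr', hr', hdr',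
        hd.1, hdE⟩)
  exact mem_evalName.2 ⟨ρ', r', hG.mem_of_le hdG hdr', hr', (ht ρ r ρ' r' hr hr' d hdG hd).symm⟩

theorem IsCTMGB.dfn_separates (hM : IsCTMGB M C) (hP : IsClassForcing C P)
    {E : ZFSet.{u} → ZFSet.{u} → ZFSet.{u} → Prop}
    (hE : Dfn M C (fun v => v 2 ∈ P.carrier ∧ E (v 0) (v 1) (v 2)))
    {σ τ : ZFSet.{u}} (hσ : σ ∈ M) (hτ : τ ∈ M) :
    Dfn M C (fun v => Separates P E σ τ (v 0)) := by
  have hE' : ∀ {i j k}, Dfn M C (fun v => v k ∈ P.carrier ∧ E (v i) (v j) (v k)) :=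
    fun {i j k} => hE.reindex fun l => Nat.casesOn l i fun l => Nat.casesOn l j fun _ => k
  have hle := @IsCTMGB.dfn_le _ _ _ hM hP
  have : Dfn M C (fun v => ∃ ρ ∈ M, ∃ r ∈ M, ZFSet.pair ρ r ∈ σ ∧ P.Le (v 0) r ∧
      ∀ q ∈ M, P.Le q (v 0) → ∀ ρ' ∈ M, ∀ r' ∈ M, ZFSet.pair ρ' r' ∈ τ → P.Le q r' →
        ¬ (q ∈ P.carrier ∧ E ρ ρ' q)) := by
    apply_rules (maxDepth := 200) [hle, hE', Dfn.not, Dfn.and, Dfn.ex, Dfn.all, Dfn.imp, Dfn.mem,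
      hM.dfun_pair, DFun.var, hM.const]
  refine this.congr fun v => ⟨?_, ?_⟩
  · rintro ⟨ρ, r, hr, hvr, H⟩
    exact ⟨ρ, hM.pair_left_mem hσ hr, r, hM.pair_right_mem hσ hr, hr, hvr,
      fun q _ hq ρ' _ r' _ hr' hqr' h => H q hq ρ' r' hr' hqr' h.2⟩
  · rintro ⟨ρ, -, r, -, hr, hvr, H⟩
    exact ⟨ρ, r, hr, hvr, fun q hq ρ' r' hr' hqr' h =>
      H q (hM.class_subset _ hP.carrier_mem hq.1) hq ρ' (hM.pair_left_mem hτ hr') r'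
        (hM.pair_right_mem hτ hr') hr' hqr' ⟨hq.1, h⟩⟩

theorem EqDefinable.swap (h : EqDefinable M C P) :
    Dfn M C (fun v => v 2 ∈ P.carrier ∧ (fun ρ' ρ => FEq P.Le ρ ρ') (v 0) (v 1) (v 2)) :=
  h.dfn (DFun.var 1) (DFun.var 0) (DFun.var 2)

theorem EqDefinable.truth (h : EqDefinable M C P) (hM : IsCTMGB M C) (hP : IsClassForcing C P)
    (hG : IsGeneric C P G) {σ τ : ZFSet.{u}} (hσ : σ ∈ M) (hτ : τ ∈ M) :
    evalName G σ = evalName G τ ↔ ∃ p ∈ G, FEq P.Le σ τ p := by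
  induction σ using pair_induction generalizing τ with
  | h σ ih =>
    have ih' : ∀ ρ r ρ' r', ZFSet.pair ρ r ∈ σ → ZFSet.pair ρ' r' ∈ τ →
        (evalName G ρ = evalName G ρ' ↔ ∃ p ∈ G, FEq P.Le ρ ρ' p) := fun ρ r ρ' r' hr hr' =>
      ih ρ r hr (hM.pair_left_mem hσ hr) (hM.pair_left_mem hτ hr')
    constructor
    · intro e
      -- A condition failing the recursion has a separating extension, so the conditions that decide
      -- `σ = τ` are dense.
      obtain ⟨p, hp, h₁⟩ := hG.exists_mem hM hP
        (D := fun p => (p ∈ P.carrier ∧ FEq P.Le σ τ p) ∨ Separates P (FEq P.Le) σ τ p ∨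
          Separates P (fun ρ' ρ => FEq P.Le ρ ρ') τ σ p)
        ((Dfn.mem_class hP.carrier_mem (DFun.var 0)).and
          ((h.dfn (hM.const hσ) (hM.const hτ) (DFun.var 0)).or
            ((hM.dfn_separates hP h hσ hτ).or (hM.dfn_separates hP h.swap hτ hσ))))
        (fun q hq => by
          by_cases h₁ : FSub P.Le (FEq P.Le) σ τ q
          · by_cases h₂ : FSub P.Le (fun ρ' ρ => FEq P.Le ρ ρ') τ σ q
            · exact ⟨q, hP.le_refl hq, Or.inl ⟨hq, FEq_iff.2 ⟨h₁, h₂⟩⟩⟩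
            · obtain ⟨r, hr, hs⟩ := exists_separates h₂
              exact ⟨r, hr, Or.inr (Or.inr hs)⟩
          · obtain ⟨r, hr, hs⟩ := exists_separates h₁
            exact ⟨r, hr, Or.inr (Or.inl hs)⟩)
      rcases h₁ with h₁ | h₁ | h₁
      · exact ⟨p, hp, h₁.2⟩
      · exact absurd e.le (not_subset_of_separates hG hP
          (fun _ _ _ _ h₁ h₂ => h₂.downward hP.le_trans h₁)
          (fun ρ r ρ' r' hr hr' => (ih' ρ r ρ' r' hr hr').1) hp h₁)
      · exact absurd e.ge (not_subset_of_separates hG hP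
          (fun _ _ _ _ h₁ h₂ => h₂.downward hP.le_trans h₁)
          (fun ρ' r' ρ r hr' hr e => (ih' ρ r ρ' r' hr hr').1 e.symm) hp h₁)
    · rintro ⟨p, hp, hF⟩
      have hF' := FEq_iff.1 hF
      exact le_antisymm
        (subset_of_FSub hM hP hG h hσ hτ
          (fun ρ r ρ' r' hr hr' p hp hE => (ih' ρ r ρ' r' hr hr').2 ⟨p, hp, hE⟩) hp hF'.1)
        (subset_of_FSub hM hP hG h.swap hτ hσ
          (fun ρ' r' ρ r hr' hr p hp hE => ((ih' ρ r ρ' r' hr hr').2 ⟨p, hp, hE⟩).symm) hp hF'.2)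

/-- If `FEq` fails at `p`, some extension separates the names, and a generic filter through that
extension makes their values differ. -/
theorem EqDefinable.forces_iff (h : EqDefinable M C P) (hM : IsCTMGB M C) (hP : IsClassForcing C P)
    {σ τ p : ZFSet.{u}} (hσ : σ ∈ M) (hτ : τ ∈ M) :
    (∀ G, IsGeneric C P G → p ∈ G → evalName G σ = evalName G τ) ↔ FEq P.Le σ τ p := by
  constructor
  · intro H
    by_contra hF
    have key : ∃ q, P.Le q p ∧ (Separates P (FEq P.Le) σ τ q ∨
          Separates P (fun ρ' ρ => FEq P.Le ρ ρ') τ σ q) := by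
      by_contra! hc
      refine hF (FEq_iff.2 ⟨?_, ?_⟩)
      · by_contra h₁
        obtain ⟨q, hq, hs⟩ := exists_separates h₁
        exact (hc q hq).1 hs
      · by_contra h₁
        obtain ⟨q, hq, hs⟩ := exists_separates h₁
        exact (hc q hq).2 hs
    obtain ⟨q, hqp, hs⟩ := key
    obtain ⟨G, hG, hqG⟩ := exists_generic hM hP hqp.1
    have e := H G hG (hG.mem_of_le hqG hqp)
    rcases hs with hs | hs
    · exact not_subset_of_separates hG hP (fun _ _ _ _ h₁ h₂ => h₂.downward hP.le_trans h₁)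
        (fun ρ r ρ' r' hr hr' => (h.truth hM hP hG (hM.pair_left_mem hσ hr)
          (hM.pair_left_mem hτ hr')).1) hqG hs e.le
    · exact not_subset_of_separates hG hP (fun _ _ _ _ h₁ h₂ => h₂.downward hP.le_trans h₁)
        (fun ρ' r' ρ r hr' hr e => (h.truth hM hP hG (hM.pair_left_mem hσ hr)
          (hM.pair_left_mem hτ hr')).1 e.symm) hqG hs e.ge
  · exact fun hF G hG hpG => (h.truth hM hP hG hσ hτ).2 ⟨p, hpG, hF⟩

end ClassForcing

namespace ClassForcing

open FirstOrder FirstOrder.Language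

variable {M : Set ZFSet.{u}} {C : Set (Set ZFSet.{u})} {P : Forcing.{u}}

/-! ### The forcing theorem from the definability of equality -/

/-- Every generic filter containing `p` satisfies `X`. -/
def Secures (C : Set (Set ZFSet.{u})) (P : Forcing.{u}) (X : Set ZFSet.{u} → Prop)
    (p : ZFSet.{u}) : Prop := ∀ G, IsGeneric C P G → p ∈ G → X G

theorem Secures.mono {X : Set ZFSet.{u} → Prop} {p q : ZFSet.{u}} (h : Secures C P X p)
    (hq : P.Le q p) : Secures C P X q := fun G hG hqG => h G hG (hG.mem_of_le hqG hq)

/-- A property of generic filters, depending on parameters in `M`, for which the definability and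
truth lemmas hold. -/
structure Forceable (M : Set ZFSet.{u}) (C : Set (Set ZFSet.{u})) (P : Forcing.{u})
    (X : (ℕ → ZFSet.{u}) → Set ZFSet.{u} → Prop) : Prop where
  dfn : Dfn M C (fun v => v 0 ∈ P.carrier ∧ Secures C P (X fun i => v (i + 1)) (v 0))
  truth : ∀ (v : ℕ → M) G, IsGeneric C P G → X (fun i => v i) G →
    ∃ p ∈ G, Secures C P (X fun i => v i) p

theorem secures_of_dense (hM : IsCTMGB M C) (hP : IsClassForcing C P) {X : Set ZFSet.{u} → Prop}
    (hX : Dfn M C (fun v => v 0 ∈ P.carrier ∧ Secures C P X (v 0))) {p : ZFSet.{u}}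
    (h : ∀ q, P.Le q p → ∃ r, P.Le r q ∧ Secures C P X r) : Secures C P X p := by
  intro G hG hpG
  obtain ⟨d, hd, hX⟩ := hG.exists_mem_below hM hP hX hpG h
  exact hX G hG hd

theorem exists_refutes (hM : IsCTMGB M C) (hP : IsClassForcing C P) {X : Set ZFSet.{u} → Prop}
    (hX : Dfn M C (fun v => v 0 ∈ P.carrier ∧ Secures C P X (v 0))) {p : ZFSet.{u}}
    (h : ¬ Secures C P X p) : ∃ q, P.Le q p ∧ ∀ r, P.Le r q → ¬ Secures C P X r := by
  by_contra! hc
  exact h (secures_of_dense hM hP hX hc)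

namespace Forceable

variable {X Y : (ℕ → ZFSet.{u}) → Set ZFSet.{u} → Prop}

theorem dfn_fix (hX : Forceable M C P X) (hM : IsCTMGB M C) (v : ℕ → M) :
    Dfn M C (fun w => w 0 ∈ P.carrier ∧ Secures C P (X fun i => v i) (w 0)) :=
  Dfn.fix (R := fun v p => p ∈ P.carrier ∧ Secures C P (X v) p) hM hX.dfn v

theorem bot (hM : IsCTMGB M C) (hP : IsClassForcing C P) :
    Forceable M C P (fun _ _ => False) where
  dfn := (Dfn.prop False).congr fun v => by
    simp only [iff_false, not_and]
    intro hp hs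
    obtain ⟨G, hG, hpG⟩ := exists_generic hM hP hp
    exact hs G hG hpG
  truth := fun _ _ _ h => h.elim

/-- The truth lemma for `X` turns "`X` holds of `G`" into a condition in `G`. The right-hand side
quantifies over conditions only and is therefore definable. -/
theorem secures_imp_iff (hX : Forceable M C P X) (v : ℕ → M) {p : ZFSet.{u}} :
    Secures C P (fun G => X (fun i => v i) G → Y (fun i => v i) G) p ↔
      ∀ q, P.Le q p → Secures C P (X fun i => v i) q → Secures C P (Y fun i => v i) q := by
  constructor
  · exact fun h q hq hX G hG hqG => h G hG (hG.mem_of_le hqG hq) (hX G hG hqG)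
  · intro h G hG hpG hXG
    obtain ⟨q, hq, hXq⟩ := hX.truth v G hG hXG
    obtain ⟨r, hr, hrp, hrq⟩ := hG.exists_le hpG hq
    exact h r hrp (hXq.mono hrq) G hG hr

theorem imp (hM : IsCTMGB M C) (hP : IsClassForcing C P) (hX : Forceable M C P X)
    (hY : Forceable M C P Y) : Forceable M C P (fun v G => X v G → Y v G) := by
  have hle := @IsCTMGB.dfn_le _ _ _ hM hP
  have hd : Dfn M C (fun v => v 0 ∈ P.carrier ∧
      Secures C P (fun G => X (fun i => v (i + 1)) G → Y (fun i => v (i + 1)) G) (v 0)) := by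
    have h : ∀ {Z}, Forceable M C P Z → Dfn M C (fun v => v 0 ∈ P.carrier ∧
        Secures C P (Z fun i => v (i + 1 + 1)) (v 0)) := fun hZ =>
      hZ.dfn.reindex fun k => Nat.casesOn k 0 fun k => k + 2
    have : Dfn M C (fun v => v 0 ∈ P.carrier ∧ ∀ q ∈ M, P.Le q (v 0) →
        (q ∈ P.carrier ∧ Secures C P (X fun i => v (i + 1)) q) →
        (q ∈ P.carrier ∧ Secures C P (Y fun i => v (i + 1)) q)) :=
      (Dfn.mem_class hP.carrier_mem (DFun.var 0)).and
        (Dfn.all ((hle (DFun.var 0) (DFun.var 1)).imp ((h hX).imp (h hY))))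
    refine this.congr fun v => and_congr_right fun hp => ?_
    refine (hX.secures_imp_iff fun i => v (i + 1)).trans ⟨fun H q _ hq h => ⟨h.1, H q hq h.2⟩,
      fun H q hq h => (H q (hM.class_subset _ hP.carrier_mem hq.1) hq ⟨hq.1, h⟩).2⟩
  refine ⟨hd, fun v G hG hXY => ?_⟩
  have hd' := Dfn.fix (R := fun v p => p ∈ P.carrier ∧
    Secures C P (fun G => X v G → Y v G) p) hM hd v
  have hX' := hX.dfn_fix hM v
  have hY' := hY.dfn_fix hM v
  obtain ⟨p, hp, h⟩ := hG.exists_mem hM hP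
    -- The second alternative is the negation of the implication in terms of conditions: `p` secures
    -- `X` and no extension of `p` secures `Y`.
    (D := fun p => (p ∈ P.carrier ∧
        Secures C P (fun G => X (fun i => v i) G → Y (fun i => v i) G) p) ∨
      (p ∈ P.carrier ∧ Secures C P (X fun i => v i) p) ∧
        ∀ q ∈ M, P.Le q p → ¬ (q ∈ P.carrier ∧ Secures C P (Y fun i => v i) q))
    ((Dfn.mem_class hP.carrier_mem (DFun.var 0)).and (hd'.or (hX'.and
      (Dfn.all ((hle (DFun.var 0) (DFun.var 1)).imp (hY'.reindex fun _ => 0).not)))))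
    (fun p hp => by
      by_cases h : Secures C P (fun G => X (fun i => v i) G → Y (fun i => v i) G) p
      · exact ⟨p, hP.le_refl hp, Or.inl ⟨hp, h⟩⟩
      · rw [hX.secures_imp_iff v] at h
        push Not at h
        obtain ⟨q, hq, hXq, hYq⟩ := h
        obtain ⟨r, hr, H⟩ := exists_refutes hM hP hY' hYq
        exact ⟨r, hP.le_trans _ _ _ hr hq, Or.inr ⟨⟨hr.1, hXq.mono hr⟩,
          fun s _ hs hs' => H s hs hs'.2⟩⟩)
  rcases h with h | ⟨h₁, h₂⟩
  · exact ⟨p, hp, h.2⟩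
  · obtain ⟨q, hq, hYq⟩ := hY.truth v G hG (hXY (h₁.2 G hG hp))
    obtain ⟨r, hr, hrp, hrq⟩ := hG.exists_le hp hq
    exact absurd ⟨hrp.1, hYq.mono hrq⟩ (h₂ r (hM.class_subset _ hP.carrier_mem hrp.1) hrp)

theorem all (hM : IsCTMGB M C) (hP : IsClassForcing C P)
    {X : (ℕ → ZFSet.{u}) → ZFSet.{u} → Set ZFSet.{u} → Prop}
    (hX : Forceable M C P (fun v G => X (fun i => v (i + 1)) (v 0) G)) :
    Forceable M C P (fun v G => ∀ x ∈ Names M P, X v x G) := by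
  have hle := @IsCTMGB.dfn_le _ _ _ hM hP
  have hN := hM.names_mem hP.carrier_mem
  have hiff : ∀ v p, Secures C P (fun G => ∀ x ∈ Names M P, X v x G) p ↔
      ∀ x ∈ Names M P, Secures C P (X v x) p := fun v p =>
    ⟨fun h x hx G hG hp => h G hG hp x hx, fun h G hG hp x hx => h x hx G hG hp⟩
  have hX₂ : Dfn M C (fun v => v 1 ∈ P.carrier ∧
      Secures C P (X (fun i => v (i + 1 + 1)) (v 0)) (v 1)) :=
    hX.dfn.reindex fun k => Nat.casesOn k 1 fun k => Nat.casesOn k 0 fun k => k + 2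
  have hd : Dfn M C (fun v => v 0 ∈ P.carrier ∧
      Secures C P (fun G => ∀ x ∈ Names M P, X (fun i => v (i + 1)) x G) (v 0)) := by
    have : Dfn M C (fun v => v 0 ∈ P.carrier ∧ ∀ x ∈ Names M P,
        v 0 ∈ P.carrier ∧ Secures C P (X (fun i => v (i + 1)) x) (v 0)) :=
      (Dfn.mem_class hP.carrier_mem (DFun.var 0)).and (hM.all_class hN hX₂)
    refine this.congr fun v => and_congr_right fun hp => (hiff _ _).trans ?_
    exact forall₂_congr fun x _ => ⟨fun h => ⟨hp, h⟩, fun h => h.2⟩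
  refine ⟨hd, fun v G hG hXG => ?_⟩
  have hd' := Dfn.fix (R := fun v p => p ∈ P.carrier ∧
    Secures C P (fun G => ∀ x ∈ Names M P, X v x G) p) hM hd v
  have hX' : Dfn M C (fun w => ∃ x ∈ Names M P, ∀ q ∈ M, P.Le q (w 0) →
      ¬ (q ∈ P.carrier ∧ Secures C P (X (fun i => v i) x) q)) :=
    Dfn.fix (R := fun v p => ∃ x ∈ Names M P, ∀ q ∈ M, P.Le q p →
      ¬ (q ∈ P.carrier ∧ Secures C P (X v x) q)) hM
      (hM.ex_class hN (Dfn.all ((hle (DFun.var 0) (DFun.var 2)).imp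
        (hX.dfn.reindex fun k => Nat.casesOn k 0 fun k => Nat.casesOn k 1 fun k => k + 3).not))) v
  have hXx : ∀ x ∈ Names M P,
      Dfn M C (fun w => w 0 ∈ P.carrier ∧ Secures C P (X (fun i => v i) x) (w 0)) := fun x hx =>
    (hX.dfn_fix hM (fun i => Nat.casesOn i ⟨x, hx.1⟩ v)).congr fun _ => Iff.rfl
  obtain ⟨p, hp, h⟩ := hG.exists_mem hM hP
    -- A condition not securing the universal statement fails to secure some instance, and
    -- `exists_refutes` gives an extension below which that instance is never secured.
    (D := fun p => (p ∈ P.carrier ∧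
        Secures C P (fun G => ∀ x ∈ Names M P, X (fun i => v i) x G) p) ∨
      ∃ x ∈ Names M P, ∀ q ∈ M, P.Le q p →
        ¬ (q ∈ P.carrier ∧ Secures C P (X (fun i => v i) x) q))
    ((Dfn.mem_class hP.carrier_mem (DFun.var 0)).and (hd'.or hX'))
    (fun p hp => by
      by_cases h : Secures C P (fun G => ∀ x ∈ Names M P, X (fun i => v i) x G) p
      · exact ⟨p, hP.le_refl hp, Or.inl ⟨hp, h⟩⟩
      · rw [hiff] at h
        push Not at h
        obtain ⟨x, hx, hxp⟩ := h
        obtain ⟨r, hr, H⟩ := exists_refutes hM hP (hXx x hx) hxp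
        exact ⟨r, hr, Or.inr ⟨x, hx, fun s _ hs hs' => H s hs hs'.2⟩⟩)
  rcases h with h | ⟨x, hx, h⟩
  · exact ⟨p, hp, h.2⟩
  · obtain ⟨q, hq, hXq⟩ := hX.truth (fun i => Nat.casesOn i ⟨x, hx.1⟩ v) G hG (hXG x hx)
    obtain ⟨r, hr, hrp, hrq⟩ := hG.exists_le hp hq
    exact absurd ⟨hrp.1, Secures.mono hXq hrq⟩
      (h r (hM.class_subset _ hP.carrier_mem hrp.1) hrp)

/-- Evaluation makes sense for arbitrary sets, so the parameters range over all of `M` and need not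
be names. -/
theorem eq (hE : EqDefinable M C P) (hM : IsCTMGB M C) (hP : IsClassForcing C P)
    {s t : (ℕ → ZFSet.{u}) → ZFSet.{u}} (hs : DFun M C s) (ht : DFun M C t) :
    Forceable M C P (fun v G => evalName G (s v) = evalName G (t v)) where
  dfn := (hE.dfn (hs.reindex (· + 1)) (ht.reindex (· + 1)) (DFun.var 0)).congr fun v =>
    and_congr_right fun _ => hE.forces_iff hM hP (hs.1 fun i => v (i + 1)) (ht.1 fun i => v (i + 1))
  truth := fun v G hG h => by
    obtain ⟨p, hp, hF⟩ := (hE.truth hM hP hG (hs.1 v) (ht.1 v)).1 h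
    exact ⟨p, hp, (hE.forces_iff hM hP (hs.1 v) (ht.1 v)).2 hF⟩

/-- A condition secures membership if and only if densely many conditions below it lie below some
`r` with `⟨τ, r⟩ ∈ A` and force `s = τ`. The class `A` may depend on the parameters, so set names
are covered as well. -/
theorem mem_class (hE : EqDefinable M C P) (hM : IsCTMGB M C) (hP : IsClassForcing C P)
    {s : (ℕ → ZFSet.{u}) → ZFSet.{u}} (hs : DFun M C s) {A : (ℕ → ZFSet.{u}) → Set ZFSet.{u}}
    (hA : Dfn M C (fun v => v 0 ∈ A fun i => v (i + 1)))
    (hAM : ∀ v : ℕ → M, A (fun i => v i) ⊆ M) :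
    Forceable M C P (fun v G => evalName G (s v) ∈ evalClass G (A v)) := by
  have hle := @IsCTMGB.dfn_le _ _ _ hM hP
  have htruth : ∀ (v : ℕ → M) G, IsGeneric C P G →
      evalName G (s fun i => v i) ∈ evalClass G (A fun i => v i) →
      ∃ p ∈ G, ∃ τ r, ZFSet.pair τ r ∈ A (fun i => v i) ∧ P.Le p r ∧
        FEq P.Le (s fun i => v i) τ p := by
    rintro v G hG ⟨τ, r, hr, hτ, e⟩
    obtain ⟨p, hp, hF⟩ := (hE.truth hM hP hG (hs.1 v) (hM.of_pair_mem (hAM v hτ)).1).1 e.symm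
    obtain ⟨q, hq, hqp, hqr⟩ := hG.exists_le hp hr
    exact ⟨q, hq, τ, r, hτ, hqr, hF.downward hP.le_trans hqp⟩
  have hsec : ∀ (v : ℕ → M) {q τ r}, ZFSet.pair τ r ∈ A (fun i => v i) → P.Le q r →
      FEq P.Le (s fun i => v i) τ q →
      Secures C P (fun G => evalName G (s fun i => v i) ∈ evalClass G (A fun i => v i)) q := by
    intro v q τ r hτ hqr hF G hG hq
    exact ⟨τ, r, hG.mem_of_le hq hqr, hτ,
      ((hE.truth hM hP hG (hs.1 v) (hM.of_pair_mem (hAM v hτ)).1).2 ⟨q, hq, hF⟩).symm⟩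
  have hA' : ∀ {t : (ℕ → ZFSet.{u}) → ZFSet.{u}} {f : ℕ → ℕ}, DFun M C t →
      Dfn M C (fun v => t v ∈ A fun i => v (f i)) := fun {t f} ht =>
    Dfn.subst (R := fun v x => x ∈ A fun i => v (f i))
      (hA.reindex fun k => Nat.casesOn k 0 fun k => f k + 1) ht
  have hR : Dfn M C (fun v => v 0 ∈ P.carrier ∧ ∃ τ ∈ M, ∃ r ∈ M,
      ZFSet.pair τ r ∈ A (fun i => v (i + 1)) ∧ P.Le (v 0) r ∧ v 0 ∈ P.carrier ∧
        FEq P.Le (s fun i => v (i + 1)) τ (v 0)) :=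
    (Dfn.mem_class hP.carrier_mem (DFun.var 0)).and (Dfn.ex (Dfn.ex
      ((hA' (hM.dfun_pair (DFun.var 1) (DFun.var 0))).and
        ((hle (DFun.var 2) (DFun.var 0)).and
          (hE.dfn (hs.reindex fun i => i + 1 + 1 + 1) (DFun.var 1) (DFun.var 2))))))
  constructor
  · have hd : Dfn M C (fun v => v 0 ∈ P.carrier ∧ ∀ q ∈ M, P.Le q (v 0) → ∃ q' ∈ M, P.Le q' q ∧
        (q' ∈ P.carrier ∧ ∃ τ ∈ M, ∃ r ∈ M, ZFSet.pair τ r ∈ A (fun i => v (i + 1)) ∧ P.Le q' r ∧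
          q' ∈ P.carrier ∧ FEq P.Le (s fun i => v (i + 1)) τ q')) :=
      (Dfn.mem_class hP.carrier_mem (DFun.var 0)).and (Dfn.all
        ((hle (DFun.var 0) (DFun.var 1)).imp (Dfn.ex ((hle (DFun.var 0) (DFun.var 1)).and
          (hR.reindex fun k => Nat.casesOn k 0 fun k => k + 3)))))
    refine hd.congr fun v => and_congr_right fun hp => ?_
    let v' : ℕ → M := fun i => v (i + 1)
    constructor
    · intro h q _ hq
      obtain ⟨G, hG, hqG⟩ := exists_generic hM hP hq.1
      obtain ⟨p', hp', τ, r, hτ, hpr, hF⟩ := htruth v' G hG (h G hG (hG.mem_of_le hqG hq))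
      obtain ⟨q', -, hq'q, hq'p⟩ := hG.exists_le hqG hp'
      have hτM := hM.of_pair_mem (hAM v' hτ)
      exact ⟨q', hM.class_subset _ hP.carrier_mem hq'q.1, hq'q, hq'q.1, τ, hτM.1, r, hτM.2, hτ,
        hP.le_trans _ _ _ hq'p hpr, hq'q.1, hF.downward hP.le_trans hq'p⟩
    · intro h G hG hpG
      obtain ⟨d, hd, τ, -, r, -, hτ, hdr, -, hF⟩ := hG.exists_mem_below hM hP
        (Dfn.fix (R := fun v d => d ∈ P.carrier ∧ ∃ τ ∈ M, ∃ r ∈ M, ZFSet.pair τ r ∈ A v ∧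
          P.Le d r ∧ d ∈ P.carrier ∧ FEq P.Le (s v) τ d) hM hR v') hpG
        (fun q hq => by
          obtain ⟨q', -, h₁, -, h₂⟩ := h q (hM.class_subset _ hP.carrier_mem hq.1) hq
          exact ⟨q', h₁, h₂⟩)
      exact hsec v' hτ hdr hF G hG hd
  · intro v G hG h
    obtain ⟨p, hp, τ, r, hτ, hpr, hF⟩ := htruth v G hG h
    exact ⟨p, hp, hsec v hτ hpr hF⟩

theorem mem (hE : EqDefinable M C P) (hM : IsCTMGB M C) (hP : IsClassForcing C P)
    {s t : (ℕ → ZFSet.{u}) → ZFSet.{u}} (hs : DFun M C s) (ht : DFun M C t) :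
    Forceable M C P (fun v G => evalName G (s v) ∈ evalName G (t v)) := by
  have h := mem_class hE hM hP hs (A := fun v => {x | x ∈ t v})
    (Dfn.mem (DFun.var 0) (ht.reindex (· + 1))) fun v x hx => hM.transitive _ (ht.1 v) _ hx
  have e : ∀ (G : Set ZFSet.{u}) x y, x ∈ evalClass G {x | x ∈ y} ↔ x ∈ evalName G y :=
    fun G x y => mem_evalName.symm
  simpa only [e] using h

end Forceable

/-! ### Formulas -/

/-- The variable that a term of `L^n` consists of. -/
def termVar {n : ℕ} {ι : Type} : (LSet n).Term ι → ι
  | Term.var i => i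
  | Term.func f _ => nomatch f

/-- Satisfaction of a formula in `M_Γ[G]`, in terms of names. -/
def NameSat {n : ℕ} {ι : Type} (M : Set ZFSet.{u}) (P : Forcing.{u}) (Γ : Fin n → Set ZFSet.{u})
    (G : Set ZFSet.{u}) : {l : ℕ} → (LSet n).BoundedFormula ι l → (ι → ZFSet.{u}) →
      (Fin l → ZFSet.{u}) → Prop
  | _, .falsum, _, _ => False
  | _, .equal t₁ t₂, s, x =>
      evalName G (Sum.elim s x (termVar t₁)) = evalName G (Sum.elim s x (termVar t₂))
  | _, .rel R ts, s, x => match R, ts with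
    | SetRel.mem, ts =>
        evalName G (Sum.elim s x (termVar (ts 0))) ∈ evalName G (Sum.elim s x (termVar (ts 1)))
    | SetRel.pred i, ts => evalName G (Sum.elim s x (termVar (ts 0))) ∈ evalClass G (Γ i)
  | _, .imp φ ψ, s, x => NameSat M P Γ G φ s x → NameSat M P Γ G ψ s x
  | _, .all φ, s, x => ∀ y ∈ Names M P, NameSat M P Γ G φ s (Fin.snoc x y)

theorem realize_termVar {n : ℕ} {ι : Type} (N : Type*) [(LSet n).Structure N] (t : (LSet n).Term ι)
    (v : ι → N) : t.realize v = v (termVar t) := by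
  cases t with
  | var i => rfl
  | func f _ => exact nomatch f

theorem nameSat_iff {n : ℕ} {ι : Type} (Γ : Fin n → Set ZFSet.{u}) (G : Set ZFSet.{u}) {l : ℕ}
    (φ : (LSet n).BoundedFormula ι l) (s : ι → Names M P) (x : Fin l → Names M P) :
    NameSat M P Γ G φ (fun i => s i) (fun i => x i) ↔
      @BoundedFormula.Realize _ _ (setStructure (Ext M P G) fun i => evalClass G (Γ i)) _ _ φ
        (fun i => evalExt M P G (s i)) (fun i => evalExt M P G (x i)) := by
  let := setStructure (Ext M P G) fun i => evalClass G (Γ i)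
  have ht : ∀ {l : ℕ} (x : Fin l → Names M P) (t : (LSet n).Term (ι ⊕ Fin l)),
      ((t.realize (Sum.elim (fun i => evalExt M P G (s i)) fun i => evalExt M P G (x i)) :
        Ext M P G) : ZFSet.{u}) = evalName G (Sum.elim (fun i => (s i : ZFSet.{u})) (fun i => x i)
          (termVar t)) := by
    intro l x t
    rw [realize_termVar]
    cases termVar t <;> rfl
  induction φ with
  | falsum => exact Iff.rfl
  | equal t₁ t₂ =>
    rw [NameSat, BoundedFormula.Realize, Subtype.ext_iff, ht, ht]
  | rel R ts =>
    rw [BoundedFormula.Realize]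
    cases R with
    | mem =>
      rw [NameSat, ← ht, ← ht]
      exact Iff.rfl
    | pred i =>
      rw [NameSat, ← ht]
      exact Iff.rfl
  | imp φ ψ ih₁ ih₂ => exact imp_congr (ih₁ x) (ih₂ x)
  | all φ ih =>
    rw [NameSat, BoundedFormula.Realize]
    have key : ∀ y : Names M P, NameSat M P Γ G φ (fun i => s i) (Fin.snoc (fun i => x i) y) ↔
        φ.Realize (fun i => evalExt M P G (s i))
          (Fin.snoc (fun i => evalExt M P G (x i)) (evalExt M P G y)) := by
      intro y
      refine Iff.trans ?_ ((ih (Fin.snoc x y)).trans ?_)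
      · refine iff_of_eq ?_
        congr 1
        funext i
        refine Fin.lastCases ?_ (fun i => ?_) i <;> simp
      · refine iff_of_eq ?_
        congr 1
        funext i
        refine Fin.lastCases ?_ (fun i => ?_) i <;> simp
    constructor
    · rintro h ⟨_, σ, hσ, rfl⟩
      exact (key ⟨σ, hσ⟩).1 (h σ hσ)
    · exact fun h σ hσ => (key ⟨σ, hσ⟩).2 (h _)

theorem forceable_nameSat (hE : EqDefinable M C P) (hM : IsCTMGB M C) (hP : IsClassForcing C P)
    {n : ℕ} {ι : Type} {Γ : Fin n → Set ZFSet.{u}} (hΓ : ∀ i, Γ i ∈ C) {l : ℕ}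
    (φ : (LSet n).BoundedFormula ι l) {s : ι → (ℕ → ZFSet.{u}) → ZFSet.{u}}
    {x : Fin l → (ℕ → ZFSet.{u}) → ZFSet.{u}} (hs : ∀ i, DFun M C (s i))
    (hx : ∀ i, DFun M C (x i)) :
    Forceable M C P (fun v G => NameSat M P Γ G φ (fun i => s i v) (fun i => x i v)) := by
  have ht : ∀ {l : ℕ} {s : ι → (ℕ → ZFSet.{u}) → ZFSet.{u}}
      {x : Fin l → (ℕ → ZFSet.{u}) → ZFSet.{u}} (_ : ∀ i, DFun M C (s i))
      (_ : ∀ i, DFun M C (x i)) (j : ι ⊕ Fin l),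
      DFun M C (fun v => Sum.elim (fun i => s i v) (fun i => x i v) j) := by
    rintro l s x hs hx (j | j)
    · exact hs j
    · exact hx j
  induction φ generalizing s with
  | falsum => exact Forceable.bot hM hP
  | equal t₁ t₂ => exact Forceable.eq hE hM hP (ht hs hx _) (ht hs hx _)
  | rel R ts =>
    cases R with
    | mem => exact Forceable.mem hE hM hP (ht hs hx _) (ht hs hx _)
    | pred i =>
      exact Forceable.mem_class hE hM hP (ht hs hx _) (Dfn.mem_class (hΓ i) (DFun.var 0))
        fun _ => hM.class_subset _ (hΓ i)
  | imp φ ψ ih₁ ih₂ => exact Forceable.imp hM hP (ih₁ hs hx) (ih₂ hs hx)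
  | all φ ih =>
    refine Forceable.all hM hP (X := fun v y G =>
      NameSat M P Γ G φ (fun i => s i v) (Fin.snoc (fun i => x i v) y)) ?_
    have := ih (s := fun i v => s i fun k => v (k + 1))
      (x := Fin.snoc (fun i v => x i fun k => v (k + 1)) fun v => v 0)
      (fun i => (hs i).reindex (· + 1))
      (fun i => Fin.lastCases (by simpa using DFun.var 0)
        (fun i => by simpa using (hx i).reindex (· + 1)) i)
    convert this using 4
    rename_i v G
    funext i
    refine Fin.lastCases ?_ (fun i => ?_) i <;> simp

theorem EqDefinable.forcingTheorem (hE : EqDefinable M C P) (hM : IsCTMGB M C)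
    (hP : IsClassForcing C P) : ForcingTheorem M C P := by
  intro n m φ
  have hsat : ∀ (Γ : Fin n → Set ZFSet.{u}) (G : Set ZFSet.{u}) (σ : Fin m → Names M P),
      ExtSat M P G Γ φ σ ↔ NameSat M P Γ G φ (fun i => σ i) Fin.elim0 := by
    intro Γ G σ
    refine Iff.trans ?_ ((nameSat_iff Γ G φ σ Fin.elim0).symm.trans ?_)
    · exact iff_of_eq (congrArg (fun x => @BoundedFormula.Realize _ _
        (setStructure (Ext M P G) fun i => evalClass G (Γ i)) _ _ φ
        (fun i => evalExt M P G (σ i)) x) (Subsingleton.elim _ _))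
    · refine iff_of_eq ?_
      congr 1
      exact Subsingleton.elim _ _
  have key : ∀ (Γ : Fin n → Set ZFSet.{u}), (∀ i, Γ i ∈ ClassNames C P) → Forceable M C P
      (fun v G => NameSat M P Γ G φ (fun i : Fin m => v i) Fin.elim0) := fun Γ hΓ => by
    convert forceable_nameSat hE hM hP (fun i => (hΓ i).1) φ (s := fun i : Fin m => fun v => v i)
      (x := Fin.elim0) (fun i => DFun.var i) (fun i => i.elim0) using 4
  constructor
  · intro Γ hΓ
    have h₁ := (key Γ hΓ).dfn
    have h₂ : Dfn M C (fun v => ∃ p ∈ M, ∃ x : Fin m → ZFSet.{u}, (∀ i, x i ∈ M) ∧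
        ((∀ i, x i ∈ Names M P) ∧ v 0 = tuple p x ∧
          (p ∈ P.carrier ∧ Secures C P (fun G => NameSat M P Γ G φ x Fin.elim0) p))) := by
      refine Dfn.ex (Dfn.ex_tuple (R := fun v x => (∀ i, x i ∈ Names M P) ∧ v 1 = tuple (v 0) x ∧
        (v 0 ∈ P.carrier ∧ Secures C P (fun G => NameSat M P Γ G φ x Fin.elim0) (v 0))) ?_)
      refine (Dfn.all_fin fun i => Dfn.mem_class (hM.names_mem hP.carrier_mem) (DFun.var _)).and
        ((Dfn.eq (DFun.var _) (hM.dfun_tuple (x := fun i : Fin m => fun v => v i) (DFun.var _)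
          fun i => DFun.var _)).and ?_)
      -- The tuple occupies the variables below `m`, so the condition is variable `m`.
      refine (h₁.reindex fun k => Nat.casesOn k (0 + m) fun k => k).congr fun v => Iff.rfl
    convert hM.mem_of_dfn (S := fun z => ∃ p ∈ M, ∃ x : Fin m → ZFSet.{u}, (∀ i, x i ∈ M) ∧
      ((∀ i, x i ∈ Names M P) ∧ z = tuple p x ∧
        (p ∈ P.carrier ∧ Secures C P (fun G => NameSat M P Γ G φ x Fin.elim0) p))) h₂ using 1
    ext z
    constructor
    · rintro ⟨p, hp, σ, rfl, hF⟩
      have hpM := hM.class_subset _ hP.carrier_mem hp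
      exact ⟨(hM.dfun_tuple (hM.const hpM) fun i => hM.const (σ i).2.1).1
        fun _ => ⟨p, hpM⟩, p, hpM, fun i => σ i, fun i => (σ i).2.1, fun i => (σ i).2, rfl, hp,
        fun G hG hpG => (hsat Γ G σ).1 (hF G hG hpG)⟩
    · rintro ⟨-, p, -, x, -, hx, rfl, hp, hF⟩
      exact ⟨p, hp, fun i => ⟨x i, hx i⟩, rfl, fun G hG hpG => (hsat Γ G _).2 (hF G hG hpG)⟩
  · intro σ Γ hΓ G hG hS
    obtain ⟨a, ha⟩ := hM.nonempty
    -- Only the first `m` values matter; the remaining ones are filled with any element of `M`.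
    let v : ℕ → M := fun i => if h : i < m then ⟨σ ⟨i, h⟩, (σ ⟨i, h⟩).2.1⟩ else ⟨a, ha⟩
    have hv : (fun i : Fin m => (v i : ZFSet.{u})) = fun i => (σ i : ZFSet.{u}) := by
      funext i
      simp [v]
    obtain ⟨p, hp, h⟩ := (key Γ hΓ).truth v G hG (by
      simp only [hv]
      exact (hsat Γ G σ).1 hS)
    refine ⟨p, hp, fun G' hG' hp' => (hsat Γ G' σ).2 ?_⟩
    simpa only [hv] using h G' hG' hp'

end ClassForcing

namespace ClassForcing

variable {M : Set ZFSet.{u}} {C : Set (Set ZFSet.{u})}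

/-! ### Natural numbers and finite sets in `M` -/

theorem mem_omega_iff {n : ZFSet.{u}} :
    n ∈ ZFSet.omega ↔ n = ∅ ∨ ∃ m ∈ ZFSet.omega, n = insert m m := by
  constructor
  · intro h
    induction n using Quotient.inductionOn with
    | h x =>
      obtain ⟨⟨k⟩, hk⟩ := (ZFSet.mk_mem_iff (x := x) (y := PSet.omega)).1 h
      have e : ZFSet.mk x = ZFSet.mk (PSet.ofNat k) := ZFSet.sound hk
      cases k with
      | zero => exact Or.inl e
      | succ k =>
        exact Or.inr ⟨ZFSet.mk (PSet.ofNat k), ZFSet.mk_mem_iff.2 ⟨⟨k⟩, PSet.Equiv.refl _⟩, e⟩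
  · rintro (rfl | ⟨m, hm, rfl⟩)
    · exact ZFSet.omega_zero
    · exact ZFSet.omega_succ hm

theorem exists_coe_eq {s : Set ZFSet.{u}} (hs : s.Finite) :
    ∃ a : ZFSet.{u}, (a : Set ZFSet.{u}) = s := by
  have := hs.to_subtype
  have : Small.{u} s := inferInstance
  exact ⟨ZFSet.range fun x : s => (x : ZFSet.{u}), by ext; simp⟩

/-- The operator with fixed point "`a` has at most `n` elements", on pairs `⟨n, a⟩`. -/
def SizeStep (S z : ZFSet.{u}) : Prop :=
  ∃ n a, z = ZFSet.pair n a ∧ (a = ∅ ∨ ∃ u ∈ a, ∃ m ∈ n, ZFSet.pair m (a \ {u}) ∈ S)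

/-- The set `a` has at most `n` elements, as witnessed in `M`. -/
def SizeLE (M : Set ZFSet.{u}) (n a : ZFSet.{u}) : Prop := Coind M SizeStep (ZFSet.pair n a)

namespace IsCTMGB

variable (hM : IsCTMGB M C)

include hM

/-- The inductive set in `M` may be too large. Being `∅` or a successor, hereditarily along
predecessors, is a `Coind` condition, and by well-foundedness it holds exactly for the elements of
`ω`. -/
theorem omega_mem : ZFSet.omega ∈ M := by
  let Ψ : ZFSet.{u} → ZFSet.{u} → Prop := fun S n => n = ∅ ∨ ∃ m ∈ n, m ∈ S ∧ n = insert m m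
  have hΨ : Dfn M C (fun v => Ψ (v 1) (v 0)) := by
    apply_rules [Dfn.or, Dfn.and, hM.bex, Dfn.mem, Dfn.eq, hM.dfun_insert, DFun.var, hM.dfun_empty]
  obtain ⟨w, hw, h₀, h₁⟩ := hM.infinity
  have hsub : ∀ n ∈ ZFSet.omega, n ∈ w ∧ Coind M Ψ n := by
    intro n
    induction n using ZFSet.inductionOn with
    | h n ih =>
      intro hn
      have hnw : n ∈ w := by
        rcases mem_omega_iff.1 hn with rfl | ⟨m, hm, rfl⟩
        · exact h₀
        · exact h₁ m (ih m (by simp) hm).1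
      have hnM := hM.transitive _ hw _ hnw
      refine ⟨hnw, hM.coind_intro hΨ (fun S S' z hS => ?_) hnM hnM fun S hS => ?_⟩
      · exact Or.imp_right fun ⟨m, hm, hmS, e⟩ => ⟨m, hm, hS hmS, e⟩
      · refine (mem_omega_iff.1 hn).imp_right fun ⟨m, hm, e⟩ => ?_
        have hmn : m ∈ n := e ▸ ZFSet.mem_insert _ _
        exact ⟨m, hmn, hS m hmn (ih m hmn hm).2, e⟩
  have hsup : ∀ n, Coind M Ψ n → n ∈ ZFSet.omega := by
    rintro n ⟨S, -, hn, hS⟩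
    induction n using ZFSet.inductionOn with
    | h n ih =>
      exact mem_omega_iff.2 ((hS n hn).imp_right fun ⟨m, hmn, hm, e⟩ => ⟨m, ih m hmn hm, e⟩)
  have : ZFSet.omega = w.sep (Coind M Ψ) := by
    ext n
    rw [ZFSet.mem_sep]
    exact ⟨hsub n, fun h => hsup n h.2⟩
  rw [this]
  exact hM.sep_mem (hM.dfn_coind (Ψ := fun _ => Ψ) hΨ (DFun.var 0)) hw

theorem finite_mem {a : ZFSet.{u}} (ha : (a : Set ZFSet.{u}).Finite) (h : ∀ x ∈ a, x ∈ M) :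
    a ∈ M := by
  suffices ∀ s : Set ZFSet.{u}, s.Finite → s ⊆ M → ∃ b ∈ M, (b : Set ZFSet.{u}) = s by
    obtain ⟨b, hb, e⟩ := this a ha h
    exact SetLike.coe_injective e ▸ hb
  intro s hs
  induction s, hs using Set.Finite.induction_on with
  | empty => exact fun _ => ⟨∅, hM.empty_mem, by simp⟩
  | insert _ _ ih =>
    intro hsub
    obtain ⟨b, hb, rfl⟩ := ih fun x hx => hsub (Set.mem_insert_of_mem _ hx)
    exact ⟨_, hM.insert_mem (hsub (Set.mem_insert _ _)) hb, ZFSet.coe_insert _ _⟩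

theorem sdiff_mem {a b : ZFSet.{u}} (ha : a ∈ M) (hb : b ∈ M) : a \ b ∈ M := by
  convert hM.sep_mem (S := fun x => x ∉ b) (Dfn.mem (DFun.var 0) (hM.const hb)).not ha using 1
  ext; simp

theorem dfun_sdiff {s t : (ℕ → ZFSet.{u}) → ZFSet.{u}} (hs : DFun M C s) (ht : DFun M C t) :
    DFun M C (fun v => s v \ t v) :=
  hM.dfun_of_mem_iff (fun v => hM.sdiff_mem (hs.1 v) (ht.1 v))
    (((Dfn.mem (DFun.var 0) (hs.reindex (· + 1))).and
      (Dfn.mem (DFun.var 0) (ht.reindex (· + 1))).not).congr fun _ => ZFSet.mem_sdiff)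

theorem dfn_sizeStep : Dfn M C (fun v => SizeStep (v 1) (v 0)) := by
  have : Dfn M C (fun v => ∃ n ∈ M, ∃ a ∈ M, v 0 = ZFSet.pair n a ∧
      (a = ∅ ∨ ∃ u ∈ a, ∃ m ∈ n, ZFSet.pair m (a \ {u}) ∈ v 1)) := by
    apply_rules (maxDepth := 200) [Dfn.ex, Dfn.or, Dfn.and, hM.bex, Dfn.mem, Dfn.eq, hM.dfun_pair,
      hM.dfun_sdiff, hM.dfun_singleton, DFun.var, hM.dfun_empty]
  refine this.congr fun v => ⟨?_, fun ⟨n, _, a, _, h⟩ => ⟨n, a, h⟩⟩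
  rintro ⟨n, a, e, h⟩
  have e' : (v 0 : ZFSet.{u}) = ZFSet.pair n a := e
  have hz := hM.of_pair_mem (e' ▸ (v 0).2)
  exact ⟨n, hz.1, a, hz.2, e, h⟩

theorem dfn_sizeLE {s t : (ℕ → ZFSet.{u}) → ZFSet.{u}} (hs : DFun M C s) (ht : DFun M C t) :
    Dfn M C (fun v => SizeLE M (s v) (t v)) :=
  hM.dfn_coind (Ψ := fun _ => SizeStep) hM.dfn_sizeStep (hM.dfun_pair hs ht)

theorem sizeLE_iff {n a : ZFSet.{u}} (hn : n ∈ M) (ha : a ∈ M) :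
    SizeLE M n a ↔ a = ∅ ∨ ∃ u ∈ a, ∃ m ∈ n, SizeLE M m (a \ {u}) := by
  constructor
  · rintro ⟨S, hSM, h, hS⟩
    obtain ⟨n', a', e, H⟩ := hS _ h
    obtain ⟨rfl, rfl⟩ := ZFSet.pair_inj.1 e
    exact H.imp_right fun ⟨u, hu, m, hm, h'⟩ => ⟨u, hu, m, hm, S, hSM, h', hS⟩
  · have mono : ∀ S S' z : ZFSet.{u}, S ⊆ S' → SizeStep S z → SizeStep S' z :=
      fun S S' z hS ⟨n, a, e, h⟩ =>
        ⟨n, a, e, h.imp_right fun ⟨u, hu, m, hm, h'⟩ => ⟨u, hu, m, hm, hS h'⟩⟩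
    rintro (rfl | ⟨u, hu, m, hm, h⟩)
    · exact hM.coind_intro hM.dfn_sizeStep mono hn (hM.pair_mem hn ha)
        fun S _ => ⟨n, ∅, rfl, Or.inl rfl⟩
    · have hd := hM.sdiff_mem ha (hM.singleton_mem (hM.transitive _ ha _ hu))
      have hm' := hM.transitive _ hn _ hm
      exact hM.coind_intro hM.dfn_sizeStep mono
        (x := {ZFSet.pair m (a \ {u})}) (hM.singleton_mem (hM.pair_mem hm' hd)) (hM.pair_mem hn ha)
        fun S hS => ⟨n, a, rfl, Or.inr ⟨u, hu, m, hm, hS _ (by simp) h⟩⟩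

/-- Finiteness is absolute: a finite set is counted inside `M`. Conversely, removing elements while
descending along `∈` below `n` must reach `∅` after finitely many steps. -/
theorem finite_iff_sizeLE {a : ZFSet.{u}} (ha : a ∈ M) :
    (a : Set ZFSet.{u}).Finite ↔ ∃ n ∈ ZFSet.omega, SizeLE M n a := by
  constructor
  · suffices ∀ s : Set ZFSet.{u}, s.Finite → ∀ a ∈ M, (a : Set ZFSet.{u}) = s →
        ∃ n ∈ ZFSet.omega, SizeLE M n a from fun h => this _ h a ha rfl
    intro s hs
    induction s, hs using Set.Finite.induction_on with
    | empty =>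
      intro a ha e
      exact ⟨∅, ZFSet.omega_zero, (hM.sizeLE_iff hM.empty_mem ha).2
        (Or.inl (SetLike.coe_injective (e.trans ZFSet.coe_empty.symm)))⟩
    | @insert x s hx _ ih =>
      intro a ha e
      have hxa : x ∈ a := by rw [← SetLike.mem_coe, e]; exact Set.mem_insert _ _
      obtain ⟨n, hn, h⟩ := ih (a \ {x})
        (hM.sdiff_mem ha (hM.singleton_mem (hM.transitive _ ha _ hxa)))
        (by rw [ZFSet.coe_sdiff, e, ZFSet.coe_singleton]; exact Set.insert_sdiff_self_of_notMem hx)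
      exact ⟨insert n n, ZFSet.omega_succ hn, (hM.sizeLE_iff
        (hM.transitive _ hM.omega_mem _ (ZFSet.omega_succ hn)) ha).2
        (Or.inr ⟨x, hxa, n, ZFSet.mem_insert _ _, h⟩)⟩
  · rintro ⟨n, hn, h⟩
    replace hn := hM.transitive _ hM.omega_mem _ hn
    induction n using ZFSet.inductionOn generalizing a with
    | h n ih =>
      rcases (hM.sizeLE_iff hn ha).1 h with rfl | ⟨u, hu, m, hm, h'⟩
      · simp
      · have := ih m hm (hM.sdiff_mem ha (hM.singleton_mem (hM.transitive _ ha _ hu))) h'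
          (hM.transitive _ hn _ hm)
        rw [ZFSet.coe_sdiff, ZFSet.coe_singleton] at this
        exact Set.Finite.of_sdiff this (Set.finite_singleton u)

theorem dfn_finite {t : (ℕ → ZFSet.{u}) → ZFSet.{u}} (ht : DFun M C t) :
    Dfn M C (fun v => (t v : Set ZFSet.{u}).Finite) :=
  (hM.bex (R := fun v n => SizeLE M n (t v)) (hM.const hM.omega_mem)
    (hM.dfn_sizeLE (DFun.var 0) (ht.reindex (· + 1)))).congr fun v => hM.finite_iff_sizeLE (ht.1 v)

/-- A substitute for power set: a nonempty subset of size at most `n` arises by adding one element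
of `X` to a subset of size at most some `m ∈ n`. By induction, these smaller subsets form sets. -/
theorem exists_bounded_subsets {X n : ZFSet.{u}} (hX : X ∈ M) (hn : n ∈ M) :
    ∃ F ∈ M, ∀ y ∈ M, y ∈ F ↔ y ⊆ X ∧ SizeLE M n y := by
  induction n using ZFSet.inductionOn with
  | h n ih =>
    obtain ⟨W, hW, h₁, h₂⟩ := hM.collect (S := fun m F => ∀ y ∈ M, y ∈ F ↔ y ⊆ X ∧ SizeLE M m y)
      (by apply_rules [hM.dfn_sizeLE, hM.subset, Dfn.all, Dfn.iff, Dfn.and, Dfn.mem, DFun.var,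
        hM.const])
      hn fun m hm => ih m hm (hM.transitive _ hn _ hm)
    have hprod := hM.exists_prod (hM.union _ hW) hX
    obtain ⟨I, hI, h₃, -⟩ := hM.collect
      (S := fun z y => ∃ b ∈ M, ∃ u ∈ M, z = ZFSet.pair b u ∧ y = insert u b)
      (by apply_rules [Dfn.ex, Dfn.and, Dfn.eq, hM.dfun_pair, hM.dfun_insert, DFun.var])
      hprod (fun z hz => by
        obtain ⟨b, hb, u, hu, rfl⟩ := ZFSet.mem_prod.1 hz
        have hbM := hM.transitive _ (hM.union _ hW) _ hb
        have huM := hM.transitive _ hX _ hu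
        exact ⟨_, hM.insert_mem huM hbM, b, hbM, u, huM, rfl, rfl⟩)
    -- The collected set `I` contains all one-point extensions but possibly more, so separation
    -- trims it.
    refine ⟨(insert ∅ I).sep fun y => y ⊆ X ∧ SizeLE M n y, hM.sep_mem
      ((hM.subset (DFun.var 0) (hM.const hX)).and (hM.dfn_sizeLE (hM.const hn) (DFun.var 0)))
      (hM.insert_mem hM.empty_mem hI), fun y hy => ?_⟩
    rw [ZFSet.mem_sep]
    refine ⟨fun h => h.2, fun h => ⟨?_, h⟩⟩
    rcases (hM.sizeLE_iff hn hy).1 h.2 with rfl | ⟨u, hu, m, hm, h'⟩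
    · exact ZFSet.mem_insert _ _
    · have huM := hM.transitive _ hy _ hu
      have hd := hM.sdiff_mem hy (hM.singleton_mem huM)
      obtain ⟨F, hF, hF'⟩ := h₁ m hm
      have hmem : y \ {u} ∈ F :=
        (hF' _ hd).2 ⟨fun x hx => h.1 (ZFSet.mem_sdiff.1 hx).1, h'⟩
      obtain ⟨y', hy', b, -, u', -, e, rfl⟩ := h₃ (ZFSet.pair (y \ {u}) u)
        (ZFSet.pair_mem_prod.2 ⟨ZFSet.mem_sUnion_of_mem hmem hF, h.1 hu⟩)
      obtain ⟨rfl, rfl⟩ := ZFSet.pair_inj.1 e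
      refine ZFSet.mem_insert_of_mem _ ?_
      convert hy' using 1
      ext x
      by_cases hx : x = u <;> simp [hx, hu]

theorem exists_finite_subsets {X : ZFSet.{u}} (hX : X ∈ M) :
    ∃ F ∈ M, ∀ y : ZFSet.{u}, y ∈ F ↔ y ⊆ X ∧ (y : Set ZFSet.{u}).Finite := by
  obtain ⟨W, hW, h₁, h₂⟩ := hM.collect (S := fun m F => ∀ y ∈ M, y ∈ F ↔ y ⊆ X ∧ SizeLE M m y)
    (by apply_rules [hM.dfn_sizeLE, hM.subset, Dfn.all, Dfn.iff, Dfn.and, Dfn.mem, DFun.var,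
      hM.const])
    hM.omega_mem fun m hm => hM.exists_bounded_subsets hX (hM.transitive _ hM.omega_mem _ hm)
  refine ⟨ZFSet.sUnion W, hM.union _ hW, fun y => ⟨fun hy => ?_, fun ⟨hy, hfin⟩ => ?_⟩⟩
  · have hyM := hM.transitive _ (hM.union _ hW) _ hy
    obtain ⟨F, hF, hyF⟩ := ZFSet.mem_sUnion.1 hy
    obtain ⟨n, hn, h⟩ := h₂ F hF
    have := (h y hyM).1 hyF
    exact ⟨this.1, (hM.finite_iff_sizeLE hyM).2 ⟨n, hn, this.2⟩⟩
  · have hyM := hM.finite_mem hfin fun x hx => hM.transitive _ hX _ (hy hx)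
    obtain ⟨n, hn, h⟩ := (hM.finite_iff_sizeLE hyM).1 hfin
    obtain ⟨F, hF, hF'⟩ := h₁ n hn
    exact ZFSet.mem_sUnion_of_mem ((hF' y hyM).2 ⟨hy, h⟩) hF

end IsCTMGB

end ClassForcing

namespace ClassForcing

variable {M : Set ZFSet.{u}} {C : Set (Set ZFSet.{u})}

/-! ### Finite partial functions with pointwise ordering -/

/-- The domain of `p` is a natural number. -/
def DomInOmega (p : ZFSet.{u}) : Prop :=
  ∃ k ∈ ZFSet.omega, ∀ n, n ∈ k ↔ ∃ x, ZFSet.pair n x ∈ p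

theorem DomInOmega.congr {p q : ZFSet.{u}} (hp : DomInOmega p)
    (h : ∀ n, (∃ x, ZFSet.pair n x ∈ q) ↔ ∃ x, ZFSet.pair n x ∈ p) : DomInOmega q :=
  let ⟨k, hk, h'⟩ := hp
  ⟨k, hk, fun n => (h' n).trans (h n).symm⟩

/-- A class `V` of values, ordered by `R`, which is approachable by projections `f α` to the sets
`X (α + 1)`. -/
structure IsValueSystem (M : Set ZFSet.{u}) (C : Set (Set ZFSet.{u})) (V : Set ZFSet.{u})
    (R : ZFSet.{u} → ZFSet.{u} → Prop) (X : ZFSet.{u} → ZFSet.{u})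
    (f : ZFSet.{u} → ZFSet.{u} → ZFSet.{u}) : Prop where
  carrier_mem : V ∈ C
  dfn_rel : Dfn M C (fun v => v 0 ∈ V ∧ v 1 ∈ V ∧ R (v 0) (v 1))
  refl : ∀ x ∈ V, R x x
  trans : ∀ x ∈ V, ∀ y ∈ V, ∀ z ∈ V, R x y → R y z → R x z
  set_mem : ∀ α ∈ OrdOf M, X α ∈ M
  dfn_set : Dfn M C (fun v => v 1 ∈ OrdOf M ∧ v 0 ∈ X (v 1))
  set_mono : ∀ α ∈ OrdOf M, ∀ β ∈ OrdOf M, α ⊆ β → X α ⊆ X β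
  set_cont : ∀ l ∈ OrdOf M, IsLimitOrd l → ∀ x ∈ X l, ∃ α ∈ l, x ∈ X α
  mem_iff : ∀ x, x ∈ V ↔ ∃ α ∈ OrdOf M, x ∈ X α
  dfn_proj : Dfn M C (fun v => v 0 ∈ OrdOf M ∧ v 1 ∈ V ∧ v 2 = f (v 0) (v 1))
  proj_mem : ∀ α ∈ OrdOf M, ∀ x ∈ V, f α x ∈ X (insert α α)
  proj_mono : ∀ α ∈ OrdOf M, ∀ x ∈ V, ∀ y ∈ V, R x y → R (f α x) (f α y)
  lift : ∀ α ∈ OrdOf M, ∀ x ∈ V, ∀ w ∈ X (insert α α), R w (f α x) → ∃ u ∈ V, R u x ∧ R (f α u) w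
  reflect : ∀ α ∈ OrdOf M, ∀ y ∈ X α, ∀ x ∈ V, R (f α x) y → R x y
  proj_id : ∀ α ∈ OrdOf M, ∀ x ∈ X (insert α α), f α x = x

/-- The conditions in `P` are the finite partial functions from `ω` to `V` (whose domain is a
natural number, if `st` holds), and the ordering is pointwise. -/
structure IsPointwise (P : Forcing.{u}) (V : Set ZFSet.{u}) (R : ZFSet.{u} → ZFSet.{u} → Prop)
    (st : Prop) : Prop where
  mem_iff : ∀ p, p ∈ P.carrier ↔ p ∈ FinPartFun V ∧ (st → DomInOmega p)
  le_iff : ∀ p ∈ P.carrier, ∀ q ∈ P.carrier, P.le p q ↔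
    ∀ n y, ZFSet.pair n y ∈ q → ∃ x, ZFSet.pair n x ∈ p ∧ R x y

theorem FinPartFun.mono {V W : Set ZFSet.{u}} (h : V ⊆ W) {p : ZFSet.{u}} (hp : p ∈ FinPartFun V) :
    p ∈ FinPartFun W :=
  ⟨hp.1, fun z hz => let ⟨n, hn, x, hx, e⟩ := hp.2.1 z hz; ⟨n, hn, x, h hx, e⟩, hp.2.2⟩

theorem FinPartFun.mem_of_pair_mem {V : Set ZFSet.{u}} {p n x : ZFSet.{u}} (hp : p ∈ FinPartFun V)
    (h : ZFSet.pair n x ∈ p) : n ∈ ZFSet.omega ∧ x ∈ V := by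
  obtain ⟨n', hn, x', hx, e⟩ := hp.2.1 _ h
  obtain ⟨rfl, rfl⟩ := ZFSet.pair_inj.1 e
  exact ⟨hn, hx⟩

namespace IsCTMGB

variable (hM : IsCTMGB M C)

include hM

theorem finPartFun_mem {V : Set ZFSet.{u}} (hV : V ⊆ M) {p : ZFSet.{u}} (hp : p ∈ FinPartFun V) :
    p ∈ M := by
  refine hM.finite_mem hp.1 fun z hz => ?_
  obtain ⟨n, hn, x, hx, rfl⟩ := hp.2.1 z hz
  exact hM.pair_mem (hM.transitive _ hM.omega_mem _ hn) (hV hx)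

theorem dfn_finPartFun {V : (ℕ → ZFSet.{u}) → Set ZFSet.{u}}
    (hV : Dfn M C (fun v => v 0 ∈ V fun i => v (i + 1))) {t : (ℕ → ZFSet.{u}) → ZFSet.{u}}
    (ht : DFun M C t) : Dfn M C (fun v => t v ∈ FinPartFun (V v)) := by
  have hV' : ∀ {i : ℕ} {f : ℕ → ℕ}, Dfn M C (fun v => v i ∈ V fun k => v (f k)) := fun {i f} =>
    hV.reindex fun k => Nat.casesOn k i f
  have : Dfn M C (fun v => (v 0 : Set ZFSet.{u}).Finite ∧
      (∀ z ∈ v 0, ∃ n ∈ ZFSet.omega, ∃ x ∈ M, x ∈ V (fun i => v (i + 1)) ∧ z = ZFSet.pair n x) ∧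
      ∀ n ∈ M, ∀ x ∈ M, ∀ y ∈ M, ZFSet.pair n x ∈ v 0 → ZFSet.pair n y ∈ v 0 → x = y) := by
    have := hM.omega_mem
    apply_rules (maxDepth := 200) [hM.dfn_finite, hV', Dfn.and, Dfn.ex, Dfn.all, Dfn.imp, hM.ball,
      hM.bex, Dfn.mem, Dfn.eq, hM.dfun_pair, DFun.var, hM.const]
  refine (Dfn.subst (R := fun v x => (x : Set ZFSet.{u}).Finite ∧
      (∀ z ∈ x, ∃ n ∈ ZFSet.omega, ∃ y ∈ M, y ∈ V v ∧ z = ZFSet.pair n y) ∧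
      ∀ n ∈ M, ∀ y ∈ M, ∀ y' ∈ M, ZFSet.pair n y ∈ x → ZFSet.pair n y' ∈ x → y = y')
    this ht).congr fun v => and_congr_right fun _ => and_congr ?_ ?_
  · refine forall₂_congr fun z hz => exists_congr fun n => and_congr_right fun _ => ?_
    constructor
    · rintro ⟨x, hx, rfl⟩
      exact ⟨x, hM.pair_right_mem (ht.1 v) hz, hx, rfl⟩
    · rintro ⟨x, -, hx, e⟩
      exact ⟨x, hx, e⟩
  · constructor
    · exact fun h n _ x _ y _ => h n x y
    · exact fun h n x y hx hy => h n (hM.pair_left_mem (ht.1 v) hx) x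
        (hM.pair_right_mem (ht.1 v) hx) y (hM.pair_right_mem (ht.1 v) hy) hx hy

theorem dfn_domInOmega {t : (ℕ → ZFSet.{u}) → ZFSet.{u}} (ht : DFun M C t) :
    Dfn M C (fun v => DomInOmega (t v)) := by
  have : Dfn M C (fun v => ∃ k ∈ ZFSet.omega, ∀ n ∈ M, n ∈ k ↔ ∃ x ∈ M, ZFSet.pair n x ∈ v 0) := by
    have := hM.omega_mem
    apply_rules (maxDepth := 200) [hM.bex, Dfn.all, Dfn.iff, Dfn.ex, Dfn.mem, hM.dfun_pair,
      DFun.var, hM.const]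
  refine (Dfn.subst (R := fun _ x => ∃ k ∈ ZFSet.omega, ∀ n ∈ M, n ∈ k ↔
    ∃ y ∈ M, ZFSet.pair n y ∈ x) this ht).congr fun v =>
    exists_congr fun k => and_congr_right fun hk => ?_
  have hk' := hM.transitive _ hM.omega_mem _ hk
  constructor
  · intro h n _
    rw [h n]
    exact ⟨fun ⟨x, hx⟩ => ⟨x, hM.pair_right_mem (ht.1 v) hx, hx⟩, fun ⟨x, _, hx⟩ => ⟨x, hx⟩⟩
  · intro h n
    constructor
    · intro hn
      obtain ⟨x, -, hx⟩ := (h n (hM.transitive _ hk' _ hn)).1 hn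
      exact ⟨x, hx⟩
    · rintro ⟨x, hx⟩
      exact (h n (hM.pair_left_mem (ht.1 v) hx)).2 ⟨x, hM.pair_right_mem (ht.1 v) hx, hx⟩

end IsCTMGB

/-- The finite partial functions from `ω` to the set `a`, as a set. -/
noncomputable def finPartFunSet (st : Prop) (a : ZFSet.{u}) : ZFSet.{u} :=
  (ZFSet.powerset (ZFSet.prod ZFSet.omega a)).sep fun p =>
    p ∈ FinPartFun {x | x ∈ a} ∧ (st → DomInOmega p)

theorem mem_finPartFunSet {st : Prop} {a p : ZFSet.{u}} :
    p ∈ finPartFunSet st a ↔ p ∈ FinPartFun {x | x ∈ a} ∧ (st → DomInOmega p) := by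
  rw [finPartFunSet, ZFSet.mem_sep, ZFSet.mem_powerset]
  refine ⟨fun h => h.2, fun h => ⟨fun z hz => ?_, h⟩⟩
  obtain ⟨n, hn, x, hx, rfl⟩ := h.1.2.1 z hz
  exact ZFSet.pair_mem_prod.2 ⟨hn, hx⟩

/-- The function `p`, composed with `g`, where `a` is a set of possible values. -/
noncomputable def mapValues (g : ZFSet.{u} → ZFSet.{u}) (a p : ZFSet.{u}) : ZFSet.{u} :=
  (ZFSet.prod ZFSet.omega a).sep fun z => ∃ n x, ZFSet.pair n x ∈ p ∧ z = ZFSet.pair n (g x)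

theorem mem_mapValues {g : ZFSet.{u} → ZFSet.{u}} {a p z : ZFSet.{u}} {V : Set ZFSet.{u}}
    (hp : p ∈ FinPartFun V) (hg : ∀ x ∈ V, g x ∈ a) :
    z ∈ mapValues g a p ↔ ∃ n x, ZFSet.pair n x ∈ p ∧ z = ZFSet.pair n (g x) := by
  rw [mapValues, ZFSet.mem_sep]
  refine ⟨fun h => h.2, fun h => ⟨?_, h⟩⟩
  obtain ⟨n, x, hx, rfl⟩ := h
  have := FinPartFun.mem_of_pair_mem hp hx
  exact ZFSet.pair_mem_prod.2 ⟨this.1, hg x this.2⟩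

theorem pair_mem_mapValues {g : ZFSet.{u} → ZFSet.{u}} {a p n y : ZFSet.{u}} {V : Set ZFSet.{u}}
    (hp : p ∈ FinPartFun V) (hg : ∀ x ∈ V, g x ∈ a) :
    ZFSet.pair n y ∈ mapValues g a p ↔ ∃ x, ZFSet.pair n x ∈ p ∧ y = g x := by
  rw [mem_mapValues hp hg]
  constructor
  · rintro ⟨n', x, hx, e⟩
    obtain ⟨rfl, rfl⟩ := ZFSet.pair_inj.1 e
    exact ⟨x, hx, rfl⟩
  · rintro ⟨x, hx, rfl⟩
    exact ⟨n, x, hx, rfl⟩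

theorem mapValues_mem {g : ZFSet.{u} → ZFSet.{u}} {a p : ZFSet.{u}} {V : Set ZFSet.{u}} {st : Prop}
    (hp : p ∈ FinPartFun V) (hst : st → DomInOmega p) (hg : ∀ x ∈ V, g x ∈ a) :
    mapValues g a p ∈ finPartFunSet st a := by
  rw [mem_finPartFunSet]
  refine ⟨⟨?_, fun z hz => ?_, fun n x y hx hy => ?_⟩, fun h => (hst h).congr fun n => ?_⟩
  · have hp' : ∀ z : ZFSet.{u}, ∃ w, ∀ n x, z = ZFSet.pair n x → w = ZFSet.pair n (g x) := by
      intro z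
      by_cases h : ∃ n x, z = ZFSet.pair n x
      · obtain ⟨n, x, rfl⟩ := h
        refine ⟨ZFSet.pair n (g x), fun n' x' e => ?_⟩
        obtain ⟨rfl, rfl⟩ := ZFSet.pair_inj.1 e
        rfl
      · exact ⟨∅, fun n x e => absurd ⟨n, x, e⟩ h⟩
    choose k hk using hp'
    refine (hp.1.image k).subset fun z hz => ?_
    obtain ⟨n, x, hx, rfl⟩ := (mem_mapValues hp hg).1 hz
    exact ⟨_, hx, hk _ n x rfl⟩
  · obtain ⟨n, x, hx, rfl⟩ := (mem_mapValues hp hg).1 hz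
    have := FinPartFun.mem_of_pair_mem hp hx
    exact ⟨n, this.1, g x, hg x this.2, rfl⟩
  · obtain ⟨x', hx', rfl⟩ := (pair_mem_mapValues hp hg).1 hx
    obtain ⟨y', hy', rfl⟩ := (pair_mem_mapValues hp hg).1 hy
    rw [hp.2.2 n x' y' hx' hy']
  · constructor
    · rintro ⟨y, hy⟩
      obtain ⟨x, hx, -⟩ := (pair_mem_mapValues hp hg).1 hy
      exact ⟨x, hx⟩
    · rintro ⟨x, hx⟩
      exact ⟨g x, (pair_mem_mapValues hp hg).2 ⟨x, hx, rfl⟩⟩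

theorem empty_mem_finPartFun (V : Set ZFSet.{u}) : (∅ : ZFSet.{u}) ∈ FinPartFun V :=
  ⟨by simp, by simp, by simp⟩

theorem domInOmega_empty : DomInOmega (∅ : ZFSet.{u}) := ⟨∅, ZFSet.omega_zero, by simp⟩

/-- The definition uses the power set of the surrounding universe; inside `M` the set is separated
from the finite subsets of `ω × a`. -/
theorem IsCTMGB.finPartFunSet_mem (hM : IsCTMGB M C) (st : Prop) {a : ZFSet.{u}} (ha : a ∈ M) :
    finPartFunSet st a ∈ M := by
  obtain ⟨F, hF, h⟩ := hM.exists_finite_subsets (hM.exists_prod hM.omega_mem ha)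
  convert hM.sep_mem (S := fun p => p ∈ FinPartFun {x | x ∈ a} ∧ (st → DomInOmega p))
    ((hM.dfn_finPartFun (V := fun _ => {x | x ∈ a}) (Dfn.mem (DFun.var 0) (hM.const ha))
      (DFun.var 0)).and ((Dfn.prop st).imp (hM.dfn_domInOmega (DFun.var 0)))) hF using 1
  ext p
  rw [mem_finPartFunSet, ZFSet.mem_sep, h]
  refine ⟨fun hp => ⟨⟨fun z hz => ?_, hp.1.1⟩, hp⟩, fun hp => hp.2⟩
  obtain ⟨n, hn, x, hx, rfl⟩ := hp.1.2.1 z hz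
  exact ZFSet.pair_mem_prod.2 ⟨hn, hx⟩

/-! ### Projections of finite functions from projections of values -/

namespace IsPointwise

variable {P : Forcing.{u}} {V : Set ZFSet.{u}} {R : ZFSet.{u} → ZFSet.{u} → Prop} {st : Prop}
  {X : ZFSet.{u} → ZFSet.{u}} {f : ZFSet.{u} → ZFSet.{u} → ZFSet.{u}}

theorem carrier_mem (hP : IsPointwise P V R st) (hM : IsCTMGB M C)
    (hV : IsValueSystem M C V R X f) : P.carrier ∈ C := by
  convert hM.mem_of_dfn (S := fun p => p ∈ FinPartFun V ∧ (st → DomInOmega p))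
    ((hM.dfn_finPartFun (V := fun _ => V) (Dfn.mem_class hV.carrier_mem (DFun.var 0))
      (DFun.var 0)).and ((Dfn.prop st).imp (hM.dfn_domInOmega (DFun.var 0)))) using 1
  ext p
  rw [hP.mem_iff]
  exact ⟨fun h => ⟨hM.finPartFun_mem (hM.class_subset _ hV.carrier_mem) h.1, h⟩, fun h => h.2⟩

theorem isClassForcing (hP : IsPointwise P V R st) (hM : IsCTMGB M C)
    (hV : IsValueSystem M C V R X f) : IsClassForcing C P where
  carrier_mem := hP.carrier_mem hM hV
  le_mem := by
    have hc := hP.carrier_mem hM hV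
    have hcM := hM.class_subset _ hc
    have hR : ∀ {i j : ℕ}, Dfn M C (fun v => v i ∈ V ∧ v j ∈ V ∧ R (v i) (v j)) := fun {i j} =>
      hV.dfn_rel.reindex fun k => Nat.casesOn k i fun _ => j
    have : Dfn M C (fun v => ∃ p ∈ P.carrier, ∃ q ∈ P.carrier, v 0 = ZFSet.pair p q ∧
        ∀ n ∈ M, ∀ y ∈ M, ZFSet.pair n y ∈ q → ∃ x ∈ M, ZFSet.pair n x ∈ p ∧
          x ∈ V ∧ y ∈ V ∧ R x y) := by
      apply_rules (maxDepth := 200) [hR, Dfn.and, Dfn.ex, hM.ex_class, Dfn.all, Dfn.imp, Dfn.mem,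
        Dfn.eq, hM.dfun_pair, DFun.var]
    convert hM.mem_of_dfn (S := fun z => ∃ p ∈ P.carrier, ∃ q ∈ P.carrier, z = ZFSet.pair p q ∧
        ∀ n ∈ M, ∀ y ∈ M, ZFSet.pair n y ∈ q → ∃ x ∈ M, ZFSet.pair n x ∈ p ∧
          x ∈ V ∧ y ∈ V ∧ R x y) this using 1
    ext z
    constructor
    · rintro ⟨p, hp, q, hq, rfl, h⟩
      rw [hP.le_iff p hp q hq] at h
      refine ⟨hM.pair_mem (hcM hp) (hcM hq), p, hp, q, hq, rfl, fun n _ y _ hy => ?_⟩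
      obtain ⟨x, hx, hxy⟩ := h n y hy
      exact ⟨x, hM.pair_right_mem (hcM hp) hx, hx,
        (FinPartFun.mem_of_pair_mem ((hP.mem_iff p).1 hp).1 hx).2,
        (FinPartFun.mem_of_pair_mem ((hP.mem_iff q).1 hq).1 hy).2, hxy⟩
    · rintro ⟨-, p, hp, q, hq, rfl, h⟩
      refine ⟨p, hp, q, hq, rfl, (hP.le_iff p hp q hq).2 fun n y hy => ?_⟩
      obtain ⟨x, -, hx, -, -, hxy⟩ := h n (hM.pair_left_mem (hcM hq) hy) y
        (hM.pair_right_mem (hcM hq) hy) hy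
      exact ⟨x, hx, hxy⟩
  refl := fun p hp => (hP.le_iff p hp p hp).2 fun n y hy =>
    ⟨y, hy, hV.refl y (FinPartFun.mem_of_pair_mem ((hP.mem_iff p).1 hp).1 hy).2⟩
  trans := fun p hp q hq r hr hpq hqr => by
    rw [hP.le_iff p hp q hq] at hpq
    rw [hP.le_iff q hq r hr] at hqr
    refine (hP.le_iff p hp r hr).2 fun n z hz => ?_
    obtain ⟨y, hy, hyz⟩ := hqr n z hz
    obtain ⟨x, hx, hxy⟩ := hpq n y hy
    exact ⟨x, hx, hV.trans x (FinPartFun.mem_of_pair_mem ((hP.mem_iff p).1 hp).1 hx).2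
      y (FinPartFun.mem_of_pair_mem ((hP.mem_iff q).1 hq).1 hy).2
      z (FinPartFun.mem_of_pair_mem ((hP.mem_iff r).1 hr).1 hz).2 hxy hyz⟩

/-- The lift is built coordinate by coordinate and has exactly the domain of `q`, so it satisfies
the restriction on domains whenever `q` does. This is why one argument covers `Col_*` as well. -/
theorem exists_lift (hM : IsCTMGB M C)
    (hV : IsValueSystem M C V R X f) {α p q : ZFSet.{u}} (hα : α ∈ OrdOf M)
    (hp : p ∈ FinPartFun V) (hq : q ∈ finPartFunSet st (X (insert α α)))
    (hqp : ∀ n y, ZFSet.pair n y ∈ p → ∃ w, ZFSet.pair n w ∈ q ∧ R w (f α y)) :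
    ∃ r, (r ∈ FinPartFun V ∧ (st → DomInOmega r)) ∧
      (∀ n y, ZFSet.pair n y ∈ p → ∃ x, ZFSet.pair n x ∈ r ∧ R x y) ∧
      ∀ n w, ZFSet.pair n w ∈ q → ∃ x, ZFSet.pair n x ∈ r ∧ R (f α x) w := by
  have hα' := hM.succ_mem_ordOf hα
  rw [mem_finPartFunSet] at hq
  have hXV : ∀ x ∈ X (insert α α), x ∈ V := fun x hx => (hV.mem_iff x).2 ⟨_, hα', hx⟩
  have hval : ∀ n w, ZFSet.pair n w ∈ q → ∃ x ∈ V, R (f α x) w ∧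
      ∀ y, ZFSet.pair n y ∈ p → R x y := by
    intro n w hw
    have hwX : w ∈ X (insert α α) := (FinPartFun.mem_of_pair_mem hq.1 hw).2
    by_cases h : ∃ y, ZFSet.pair n y ∈ p
    · obtain ⟨y, hy⟩ := h
      obtain ⟨w', hw', hR⟩ := hqp n y hy
      obtain rfl := hq.1.2.2 n w w' hw hw'
      obtain ⟨x, hx, hxy, hxw⟩ := hV.lift α hα y (FinPartFun.mem_of_pair_mem hp hy).2 w hwX hR
      refine ⟨x, hx, hxw, fun y' hy' => ?_⟩
      rwa [hp.2.2 n y' y hy' hy]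
    -- Outside the domain of `p` the value `w` is kept. This needs `f α` to be the identity on all
    -- of `X (α + 1)`, not only on `X α`.
    · refine ⟨w, hXV w hwX, ?_, fun y hy => absurd ⟨y, hy⟩ h⟩
      rw [hV.proj_id α hα w hwX]
      exact hV.refl w (hXV w hwX)
  have hval' : ∀ z : ZFSet.{u}, ∃ z', z ∈ q → ∃ n w x, z = ZFSet.pair n w ∧ z' = ZFSet.pair n x ∧
      x ∈ V ∧ R (f α x) w ∧ ∀ y, ZFSet.pair n y ∈ p → R x y := by
    intro z
    by_cases hz : z ∈ q
    · obtain ⟨n, -, w, -, rfl⟩ := hq.1.2.1 z hz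
      obtain ⟨x, hx, h₁, h₂⟩ := hval n w hz
      exact ⟨ZFSet.pair n x, fun _ => ⟨n, w, x, rfl, rfl, hx, h₁, h₂⟩⟩
    · exact ⟨∅, fun h => absurd h hz⟩
  choose g hg using hval'
  obtain ⟨r, hr⟩ := exists_coe_eq (hq.1.1.image g)
  have hmem : ∀ z, z ∈ r ↔ ∃ z' ∈ q, g z' = z := fun z => by
    rw [← SetLike.mem_coe, hr]
    exact Iff.rfl
  have hqr : ∀ n w, ZFSet.pair n w ∈ q → ∃ x, ZFSet.pair n x ∈ r ∧ R (f α x) w ∧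
      ∀ y, ZFSet.pair n y ∈ p → R x y := by
    intro n w hw
    obtain ⟨n', w', x, e, e', -, h₁, h₂⟩ := hg _ hw
    obtain ⟨rfl, rfl⟩ := ZFSet.pair_inj.1 e
    exact ⟨x, (hmem _).2 ⟨_, hw, e'⟩, h₁, h₂⟩
  have hrq : ∀ n x, ZFSet.pair n x ∈ r → ∃ w, ZFSet.pair n w ∈ q ∧ g (ZFSet.pair n w) =
      ZFSet.pair n x ∧ x ∈ V := by
    intro n x hx
    obtain ⟨z, hz, e⟩ := (hmem _).1 hx
    obtain ⟨n', w, x', rfl, e', hx', -⟩ := hg z hz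
    obtain ⟨rfl, rfl⟩ := ZFSet.pair_inj.1 (e.symm.trans e')
    exact ⟨w, hz, e, hx'⟩
  refine ⟨r, ⟨⟨?_, fun z hz => ?_, fun n x y hx hy => ?_⟩, fun h => (hq.2 h).congr fun n => ?_⟩,
    fun n y hy => ?_, fun n w hw => ?_⟩
  · rw [hr]
    exact hq.1.1.image g
  · obtain ⟨z', hz', rfl⟩ := (hmem _).1 hz
    obtain ⟨n, w, x, rfl, e', hx, -⟩ := hg z' hz'
    exact ⟨n, (FinPartFun.mem_of_pair_mem hq.1 hz').1, x, hx, e'⟩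
  · obtain ⟨w, hw, e, -⟩ := hrq n x hx
    obtain ⟨w', hw', e', -⟩ := hrq n y hy
    obtain rfl := hq.1.2.2 n w w' hw hw'
    exact (ZFSet.pair_inj.1 (e.symm.trans e')).2
  · constructor
    · rintro ⟨x, hx⟩
      obtain ⟨w, hw, -⟩ := hrq n x hx
      exact ⟨w, hw⟩
    · rintro ⟨w, hw⟩
      obtain ⟨x, hx, -⟩ := hqr n w hw
      exact ⟨x, hx⟩
  · obtain ⟨w, hw, -⟩ := hqp n y hy
    obtain ⟨x, hx, -, h₂⟩ := hqr n w hw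
    exact ⟨x, hx, h₂ y hy⟩
  · obtain ⟨x, hx, h₁, -⟩ := hqr n w hw
    exact ⟨x, hx, h₁⟩

/-- Finitely many ordinals have a maximum. The index class `O` is a limit ordinal in the proof of
continuity and `Ord^M` for the union. -/
theorem exists_index (hV : IsValueSystem M C V R X f)
    {O : Set ZFSet.{u}} (hO : O ⊆ OrdOf M) (h₀ : O.Nonempty) {p : ZFSet.{u}}
    (hp : (p : Set ZFSet.{u}).Finite)
    (h : ∀ z ∈ p, ∃ n ∈ ZFSet.omega, ∃ α ∈ O, ∃ x ∈ X α, z = ZFSet.pair n x) :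
    ∃ α ∈ O, ∀ z ∈ p, ∃ n ∈ ZFSet.omega, ∃ x ∈ X α, z = ZFSet.pair n x := by
  suffices ∀ s : Set ZFSet.{u}, s.Finite →
      (∀ z ∈ s, ∃ n ∈ ZFSet.omega, ∃ α ∈ O, ∃ x ∈ X α, z = ZFSet.pair n x) →
      ∃ α ∈ O, ∀ z ∈ s, ∃ n ∈ ZFSet.omega, ∃ x ∈ X α, z = ZFSet.pair n x from this _ hp h
  intro s hs
  induction s, hs using Set.Finite.induction_on with
  | empty => exact fun _ => let ⟨α, hα⟩ := h₀; ⟨α, hα, by simp⟩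
  | @insert z s _ _ ih =>
    intro h
    obtain ⟨α, hα, hα'⟩ := ih fun w hw => h w (Set.mem_insert_of_mem _ hw)
    obtain ⟨n, hn, β, hβ, x, hx, rfl⟩ := h z (Set.mem_insert _ _)
    rcases (hO hα).2.subset_total (hO hβ).2 with hαβ | hβα
    · refine ⟨β, hβ, fun w hw => ?_⟩
      rcases hw with rfl | hw
      · exact ⟨n, hn, x, hx, rfl⟩
      · obtain ⟨m, hm, y, hy, e⟩ := hα' w hw
        exact ⟨m, hm, y, hV.set_mono α (hO hα) β (hO hβ) hαβ hy, e⟩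
    · refine ⟨α, hα, fun w hw => ?_⟩
      rcases hw with rfl | hw
      · exact ⟨n, hn, x, hV.set_mono β (hO hβ) α (hO hα) hβα hx, rfl⟩
      · exact hα' w hw

theorem isProjectionSystem (hP : IsPointwise P V R st) (hM : IsCTMGB M C)
    (hV : IsValueSystem M C V R X f) :
    IsProjectionSystem M C P ∅ (fun α => finPartFunSet st (X α))
      (fun α p => mapValues (f α) (X (insert α α)) p) := by
  have hc := hP.carrier_mem hM hV
  have hcM := hM.class_subset _ hc
  have hXV : ∀ α ∈ OrdOf M, ∀ x ∈ X α, x ∈ V := fun α hα x hx => (hV.mem_iff x).2 ⟨α, hα, hx⟩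
  have hQ : ∀ α ∈ OrdOf M, ∀ p ∈ finPartFunSet st (X α), p ∈ P.carrier := fun α hα p hp =>
    (hP.mem_iff p).2 ⟨FinPartFun.mono (hXV α hα) (mem_finPartFunSet.1 hp).1,
      (mem_finPartFunSet.1 hp).2⟩
  have hfin : ∀ p ∈ P.carrier, p ∈ FinPartFun V := fun p hp => ((hP.mem_iff p).1 hp).1
  have hπ : ∀ α ∈ OrdOf M, ∀ p ∈ P.carrier,
      mapValues (f α) (X (insert α α)) p ∈ finPartFunSet st (X (insert α α)) := fun α hα p hp =>
    mapValues_mem (hfin p hp) ((hP.mem_iff p).1 hp).2 (hV.proj_mem α hα)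
  have hπP : ∀ α ∈ OrdOf M, ∀ p ∈ P.carrier,
      mapValues (f α) (X (insert α α)) p ∈ P.carrier := fun α hα p hp =>
    hQ _ (hM.succ_mem_ordOf hα) _ (hπ α hα p hp)
  have hmono : ∀ α ∈ OrdOf M, ∀ β ∈ OrdOf M, α ⊆ β →
      finPartFunSet st (X α) ⊆ finPartFunSet st (X β) := by
    intro α hα β hβ h p hp
    rw [mem_finPartFunSet] at hp ⊢
    exact ⟨FinPartFun.mono (fun x hx => hV.set_mono α hα β hβ h hx) hp.1, hp.2⟩
  have hempty : (∅ : ZFSet.{u}) ∈ P.carrier :=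
    (hP.mem_iff ∅).2 ⟨empty_mem_finPartFun V, fun _ => domInOmega_empty⟩
  refine ⟨hempty, ?_, ?_, ?_, hmono, ?_, ?_, ?_, hπ, ?_, ?_, ?_, ?_, ?_⟩
  · exact fun p hp => (hP.le_iff p hp ∅ hempty).2 (by simp)
  · exact fun α hα => hM.finPartFunSet_mem st (hV.set_mem α hα)
  -- Membership in `X α` is definable only jointly with `α ∈ Ord^M`, so the redundant clause stays
  -- inside the set of values.
  · have hset : Dfn M C (fun v => ∃ α ∈ OrdOf M, ∃ S ∈ M, v 0 = ZFSet.pair α S ∧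
        ∀ p ∈ M, p ∈ S ↔ p ∈ FinPartFun {x | α ∈ OrdOf M ∧ x ∈ X α} ∧ (st → DomInOmega p)) := by
      refine hM.ex_class hM.ordOf_mem (Dfn.ex (Dfn.and (Dfn.eq (DFun.var _)
        (hM.dfun_pair (DFun.var _) (DFun.var _))) (Dfn.all (Dfn.iff (Dfn.var_mem _ _)
        (Dfn.and ?_ ((Dfn.prop st).imp (hM.dfn_domInOmega (DFun.var _))))))))
      have h : Dfn M C (fun v => v 3 ∈ OrdOf M ∧ v 0 ∈ X (v 3)) :=
        hV.dfn_set.reindex fun k => Nat.casesOn k 0 fun _ => 3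
      exact hM.dfn_finPartFun (V := fun v => {x | v 2 ∈ OrdOf M ∧ x ∈ X (v 2)}) h (DFun.var 0)
    convert hM.mem_of_dfn (S := fun z => ∃ α ∈ OrdOf M, ∃ S ∈ M, z = ZFSet.pair α S ∧
        ∀ p ∈ M, p ∈ S ↔ p ∈ FinPartFun {x | α ∈ OrdOf M ∧ x ∈ X α} ∧ (st → DomInOmega p))
      hset using 1
    have hset' : ∀ α ∈ OrdOf M, {x | α ∈ OrdOf M ∧ x ∈ X α} = {x | x ∈ X α} := fun α hα =>
      Set.ext fun x => and_iff_right hα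
    ext z
    constructor
    · rintro ⟨α, hα, rfl⟩
      have hS := hM.finPartFunSet_mem st (hV.set_mem α hα)
      refine ⟨hM.pair_mem hα.1 hS, α, hα, _, hS, rfl, fun p _ => ?_⟩
      rw [hset' α hα, mem_finPartFunSet]
    · rintro ⟨-, α, hα, S, hS, rfl, h⟩
      refine ⟨α, hα, congrArg _ (hM.ext_of_mem hS (hM.finPartFunSet_mem st (hV.set_mem α hα))
        fun p hp => ?_)⟩
      rw [h p hp, hset' α hα, mem_finPartFunSet]
  · intro l hl hlim p
    constructor
    · intro hp
      rw [mem_finPartFunSet] at hp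
      have hO : {α | α ∈ l} ⊆ OrdOf M := fun α hα => hM.ordOf_trans hl hα
      obtain ⟨α, hα, h⟩ := exists_index hV hO
        (ZFSet.nonempty_def l |>.1 ((ZFSet.eq_empty_or_nonempty l).resolve_left hlim.2.1))
        hp.1.1 fun z hz => by
          obtain ⟨n, hn, x, hx, e⟩ := hp.1.2.1 z hz
          obtain ⟨α, hα, hx⟩ := hV.set_cont l hl hlim x hx
          exact ⟨n, hn, α, hα, x, hx, e⟩
      exact ⟨α, hα, mem_finPartFunSet.2 ⟨⟨hp.1.1, h, hp.1.2.2⟩, hp.2⟩⟩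
    · rintro ⟨α, hα, hp⟩
      exact hmono α (hM.ordOf_trans hl hα) l hl (hl.2.subset_of_mem hα) hp
  · intro p
    constructor
    · intro hp
      have hp' := (hP.mem_iff p).1 hp
      obtain ⟨α, hα, h⟩ := exists_index hV (Set.Subset.refl _) ⟨∅, hM.empty_mem_ordOf⟩
        hp'.1.1 fun z hz => by
          obtain ⟨n, hn, x, hx, e⟩ := hp'.1.2.1 z hz
          obtain ⟨α, hα, hx⟩ := (hV.mem_iff x).1 hx
          exact ⟨n, hn, α, hα, x, hx, e⟩
      exact ⟨α, hα, mem_finPartFunSet.2 ⟨⟨hp'.1.1, h, hp'.1.2.2⟩, hp'.2⟩⟩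
    · rintro ⟨α, hα, hp⟩
      exact hQ α hα p hp
  · have hf : ∀ {i j k : ℕ}, Dfn M C (fun v => v i ∈ OrdOf M ∧ v j ∈ V ∧ v k = f (v i) (v j)) :=
      fun {i j k} => hV.dfn_proj.reindex fun l =>
        Nat.casesOn l i fun l => Nat.casesOn l j fun _ => k
    have hproj : Dfn M C (fun v => ∃ α ∈ OrdOf M, ∃ p ∈ P.carrier, ∃ S ∈ M,
        v 0 = ZFSet.pair (ZFSet.pair α p) S ∧ ∀ z ∈ M, z ∈ S ↔ ∃ n ∈ M, ∃ x ∈ M,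
          ZFSet.pair n x ∈ p ∧ ∃ w ∈ M, (α ∈ OrdOf M ∧ x ∈ V ∧ w = f α x) ∧
            z = ZFSet.pair n w) := by
      have := hM.ordOf_mem
      apply_rules (maxDepth := 200) [hf, Dfn.and, Dfn.ex, hM.ex_class, Dfn.all, Dfn.iff, Dfn.mem,
        Dfn.eq, hM.dfun_pair, DFun.var]
    convert hM.mem_of_dfn (S := fun y => ∃ α ∈ OrdOf M, ∃ p ∈ P.carrier, ∃ S ∈ M,
        y = ZFSet.pair (ZFSet.pair α p) S ∧ ∀ z ∈ M, z ∈ S ↔ ∃ n ∈ M, ∃ x ∈ M,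
          ZFSet.pair n x ∈ p ∧ ∃ w ∈ M, (α ∈ OrdOf M ∧ x ∈ V ∧ w = f α x) ∧
            z = ZFSet.pair n w) hproj using 1
    have key : ∀ α ∈ OrdOf M, ∀ p ∈ P.carrier, ∀ z,
        z ∈ mapValues (f α) (X (insert α α)) p ↔ ∃ n ∈ M, ∃ x ∈ M,
          ZFSet.pair n x ∈ p ∧ ∃ w ∈ M, (α ∈ OrdOf M ∧ x ∈ V ∧ w = f α x) ∧
            z = ZFSet.pair n w := by
      intro α hα p hp z
      rw [mem_mapValues (hfin p hp) (hV.proj_mem α hα)]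
      constructor
      · rintro ⟨n, x, hx, rfl⟩
        have hxV := (FinPartFun.mem_of_pair_mem (hfin p hp) hx).2
        exact ⟨n, hM.pair_left_mem (hcM hp) hx, x, hM.pair_right_mem (hcM hp) hx, hx, f α x,
          hM.transitive _ (hV.set_mem _ (hM.succ_mem_ordOf hα)) _ (hV.proj_mem α hα x hxV),
          ⟨hα, hxV, rfl⟩, rfl⟩
      · rintro ⟨n, -, x, -, hx, w, -, ⟨-, -, rfl⟩, rfl⟩
        exact ⟨n, x, hx, rfl⟩
    ext y
    constructor
    · rintro ⟨α, hα, p, hp, rfl⟩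
      have hS := hcM (hπP α hα p hp)
      exact ⟨hM.pair_mem (hM.pair_mem hα.1 (hcM hp)) hS, α, hα, p, hp, _, hS, rfl,
        fun z _ => key α hα p hp z⟩
    · rintro ⟨-, α, hα, p, hp, S, hS, rfl, h⟩
      refine ⟨α, hα, p, hp, congrArg _ (hM.ext_of_mem hS (hcM (hπP α hα p hp)) fun z hz => ?_)⟩
      rw [h z hz, key α hα p hp]
  · intro α hα
    refine (ZFSet.eq_empty _).2 fun z hz => ?_
    obtain ⟨n, x, hx, -⟩ := (mem_mapValues (hfin ∅ hempty) (hV.proj_mem α hα)).1 hz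
    exact ZFSet.notMem_empty _ hx
  · intro α hα p hp q hq hpq
    rw [hP.le_iff p hp q hq] at hpq
    refine (hP.le_iff _ (hπP α hα p hp) _ (hπP α hα q hq)).2 fun n y hy => ?_
    obtain ⟨y, hy', rfl⟩ := (pair_mem_mapValues (hfin q hq) (hV.proj_mem α hα)).1 hy
    obtain ⟨x, hx, hxy⟩ := hpq n y hy'
    exact ⟨f α x, (pair_mem_mapValues (hfin p hp) (hV.proj_mem α hα)).2 ⟨x, hx, rfl⟩,
      hV.proj_mono α hα x (FinPartFun.mem_of_pair_mem (hfin p hp) hx).2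
        y (FinPartFun.mem_of_pair_mem (hfin q hq) hy').2 hxy⟩
  · intro α hα p hp q hq hqp
    have hqP := hQ _ (hM.succ_mem_ordOf hα) q hq
    rw [hP.le_iff q hqP _ (hπP α hα p hp)] at hqp
    obtain ⟨r, hr, h₁, h₂⟩ := exists_lift hM hV hα (hfin p hp) hq fun n y hy =>
      hqp n _ ((pair_mem_mapValues (hfin p hp) (hV.proj_mem α hα)).2 ⟨y, hy, rfl⟩)
    have hrP := (hP.mem_iff r).2 hr
    refine ⟨r, hrP, (hP.le_iff r hrP p hp).2 h₁,
      (hP.le_iff _ (hπP α hα r hrP) q hqP).2 fun n w hw => ?_⟩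
    obtain ⟨x, hx, hxw⟩ := h₂ n w hw
    exact ⟨f α x, (pair_mem_mapValues hr.1 (hV.proj_mem α hα)).2 ⟨x, hx, rfl⟩, hxw⟩
  · intro α hα p hp q hq hqp
    have hpP := hQ α hα p hp
    rw [hP.le_iff _ (hπP α hα q hq) p hpP] at hqp
    refine (hP.le_iff q hq p hpP).2 fun n y hy => ?_
    obtain ⟨x, hx, hxy⟩ := hqp n y hy
    obtain ⟨x, hx', rfl⟩ := (pair_mem_mapValues (hfin q hq) (hV.proj_mem α hα)).1 hx
    exact ⟨x, hx', hV.reflect α hα y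
      (FinPartFun.mem_of_pair_mem (mem_finPartFunSet.1 hp).1 hy).2
      x (FinPartFun.mem_of_pair_mem (hfin q hq) hx').2 hxy⟩
  · intro α hα p hp
    have hid : ∀ n x, ZFSet.pair n x ∈ p → f α x = x := fun n x hx =>
      hV.proj_id α hα x (hV.set_mono α hα _ (hM.succ_mem_ordOf hα)
        (fun _ h => ZFSet.mem_insert_of_mem _ h)
        (FinPartFun.mem_of_pair_mem (mem_finPartFunSet.1 hp).1 hx).2)
    have hpP := hfin p (hQ α hα p hp)
    ext z
    rw [mem_mapValues hpP (hV.proj_mem α hα)]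
    constructor
    · rintro ⟨n, x, hx, rfl⟩
      rwa [hid n x hx]
    · intro hz
      obtain ⟨n, -, x, -, rfl⟩ := hpP.2.1 z hz
      exact ⟨n, x, hz, by rw [hid n x hz]⟩

end IsPointwise

end ClassForcing

namespace ClassForcing

variable {M : Set ZFSet.{u}} {C : Set (Set ZFSet.{u})}

/-! ### The collapse forcings -/

theorem FinPartFun.subset_iff {V : Set ZFSet.{u}} {p q : ZFSet.{u}} (hq : q ∈ FinPartFun V) :
    q ⊆ p ↔ ∀ n y, ZFSet.pair n y ∈ q → ∃ x, ZFSet.pair n x ∈ p ∧ x = y := by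
  constructor
  · exact fun h n y hy => ⟨y, h hy, rfl⟩
  · intro h z hz
    obtain ⟨n, -, x, -, rfl⟩ := hq.2.1 z hz
    obtain ⟨_, hx, rfl⟩ := h n x hz
    exact hx

theorem isPointwise_col (M : Set ZFSet.{u}) : IsPointwise (Col M) (OrdOf M) Eq False where
  mem_iff _ := by simp [Col]
  le_iff _ _ _ hq := FinPartFun.subset_iff hq

theorem isPointwise_colStar (M : Set ZFSet.{u}) : IsPointwise (ColStar M) (OrdOf M) Eq True where
  mem_iff _ := by simp [ColStar, DomInOmega]
  le_iff _ _ _ hq := FinPartFun.subset_iff hq.1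

-- The projection is `min(x, α)`, with `X α = α`. The extra value `α` of `X (α + 1)` marks every
-- ordinal that was too large.
open Classical in
theorem IsCTMGB.isValueSystem_ordOf (hM : IsCTMGB M C) :
    IsValueSystem M C (OrdOf M) Eq id (fun α x => if x ∈ α then x else α) where
  carrier_mem := hM.ordOf_mem
  dfn_rel := by
    have hO := fun i => Dfn.var_mem_class (M := M) hM.ordOf_mem i
    apply_rules [hO, Dfn.and, Dfn.eq, DFun.var]
  refl _ _ := rfl
  trans _ _ _ _ _ _ := Eq.trans
  set_mem _ hα := hα.1
  dfn_set := (Dfn.mem_class hM.ordOf_mem (DFun.var 1)).and (Dfn.var_mem 0 1)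
  set_mono _ _ _ _ h := h
  set_cont _ _ hlim x hx := ⟨insert x x, hlim.2.2 x hx, ZFSet.mem_insert _ _⟩
  mem_iff x := ⟨fun hx => ⟨insert x x, hM.succ_mem_ordOf hx, ZFSet.mem_insert _ _⟩,
    fun ⟨_, hα, hx⟩ => hM.ordOf_trans hα hx⟩
  dfn_proj := by
    have : Dfn M C (fun v => v 0 ∈ OrdOf M ∧ v 1 ∈ OrdOf M ∧
        ((v 1 ∈ v 0 ∧ v 2 = v 1) ∨ (¬ v 1 ∈ v 0 ∧ v 2 = v 0))) := by
      have hO := fun i => Dfn.var_mem_class (M := M) hM.ordOf_mem i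
      apply_rules [hO, Dfn.and, Dfn.or, Dfn.not, Dfn.mem, Dfn.eq, DFun.var]
    refine this.congr fun v => and_congr_right fun _ => and_congr_right fun _ => ?_
    split_ifs with h <;> simp [h]
  proj_mem α _ x _ := by
    dsimp only [id]
    split_ifs with h
    · exact ZFSet.mem_insert_of_mem _ h
    · exact ZFSet.mem_insert _ _
  proj_mono _ _ _ _ _ _ h := by rw [h]
  lift _ _ x hx _ _ h := ⟨x, hx, rfl, h.symm⟩
  reflect α _ y hy x _ h := by
    dsimp only [id] at hy
    split_ifs at h with hx
    · exact h
    -- A truncated value is `α` itself, which is not an element of `X α`.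
    · exact absurd (h ▸ hy) (ZFSet.mem_irrefl _)
  proj_id α _ x hx := by
    rcases ZFSet.mem_insert_iff.1 hx with rfl | hx
    · simp
    · simp [hx]

theorem ApproachableByProjections.forcingTheorem {P : Forcing.{u}}
    (h : ApproachableByProjections M C P) (hM : IsCTMGB M C) (hP : IsClassForcing C P) :
    ForcingTheorem M C P :=
  (ApproachableByProjections.eqDefinable hM hP h).forcingTheorem hM hP

theorem IsPointwise.forcingTheorem {P : Forcing.{u}} {V : Set ZFSet.{u}}
    {R : ZFSet.{u} → ZFSet.{u} → Prop} {st : Prop} {X : ZFSet.{u} → ZFSet.{u}}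
    {f : ZFSet.{u} → ZFSet.{u} → ZFSet.{u}} (hP : IsPointwise P V R st) (hM : IsCTMGB M C)
    (hV : IsValueSystem M C V R X f) :
    IsClassForcing C P ∧ ApproachableByProjections M C P ∧ ForcingTheorem M C P := by
  have h₁ := hP.isClassForcing hM hV
  have h₂ : ApproachableByProjections M C P := ⟨_, _, _, hP.isProjectionSystem hM hV⟩
  exact ⟨h₁, h₂, h₂.forcingTheorem hM h₁⟩

/-- The ordering of the values of the conditions of `Col_≥(ω, Ord)^M`. -/
def GeRel (M : Set ZFSet.{u}) (ge : ZFSet.{u} → ZFSet.{u}) (x y : ZFSet.{u}) : Prop :=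
  x = y ∨ ∃ α ∈ OrdOf M, y = ge α ∧ ∃ β ∈ OrdOf M, α ⊆ β ∧ (x = β ∨ x = ge β)

theorem isPointwise_colGe (M : Set ZFSet.{u}) (ge : ZFSet.{u} → ZFSet.{u}) :
    IsPointwise (ColGe M ge) (OrdOf M ∪ ge '' OrdOf M) (GeRel M ge) False where
  mem_iff _ := by simp [ColGe]
  le_iff _ _ _ _ := Iff.rfl

/-- The ordinals in some element of `α`, and the objects `≥β` for `β ∈ α`. -/
noncomputable def geSet (ge : ZFSet.{u} → ZFSet.{u}) (α : ZFSet.{u}) : ZFSet.{u} :=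
  ZFSet.sUnion α ∪ ZFSet.range fun β : α => ge β

theorem mem_geSet {ge : ZFSet.{u} → ZFSet.{u}} {α x : ZFSet.{u}} :
    x ∈ geSet ge α ↔ (∃ z ∈ α, x ∈ z) ∨ ∃ β ∈ α, x = ge β := by
  simp [geSet, ZFSet.mem_union, ZFSet.mem_sUnion, ZFSet.mem_range, eq_comm]

theorem mem_values_iff {ge : ZFSet.{u} → ZFSet.{u}} {x : ZFSet.{u}} :
    x ∈ OrdOf M ∪ ge '' OrdOf M ↔ x ∈ OrdOf M ∨ ∃ α ∈ OrdOf M, x = ge α := by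
  simp [eq_comm]

theorem mem_values_iff_exists {ge : ZFSet.{u} → ZFSet.{u}} (hM : IsCTMGB M C) {x : ZFSet.{u}} :
    x ∈ OrdOf M ∪ ge '' OrdOf M ↔ ∃ α ∈ OrdOf M, x ∈ geSet ge α := by
  rw [mem_values_iff]
  constructor
  · rintro (hx | ⟨α, hα, rfl⟩)
    · exact ⟨_, hM.succ_mem_ordOf (hM.succ_mem_ordOf hx),
        mem_geSet.2 (Or.inl ⟨_, ZFSet.mem_insert _ _, ZFSet.mem_insert _ _⟩)⟩
    · exact ⟨_, hM.succ_mem_ordOf hα, mem_geSet.2 (Or.inr ⟨α, ZFSet.mem_insert _ _, rfl⟩)⟩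
  · rintro ⟨α, hα, hx⟩
    rcases mem_geSet.1 hx with ⟨z, hz, hx⟩ | ⟨β, hβ, rfl⟩
    · exact Or.inl (hM.ordOf_trans (hM.ordOf_trans hα hz) hx)
    · exact Or.inr ⟨β, hM.ordOf_trans hα hβ, rfl⟩

/-! ### The values of `Col_≥(ω, Ord)` -/

namespace IsGeCode

variable {ge : ZFSet.{u} → ZFSet.{u}} (hge : IsGeCode M C ge)

include hge

theorem ne {α β : ZFSet.{u}} (hα : α ∈ OrdOf M) (hβ : β ∈ OrdOf M) : ge α ≠ β :=
  fun h => (hge.mem α hα).2 (h ▸ hβ)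

theorem geRel_left_ge_iff {α y : ZFSet.{u}} (hα : α ∈ OrdOf M) :
    GeRel M ge (ge α) y ↔ ∃ β ∈ OrdOf M, y = ge β ∧ β ⊆ α := by
  constructor
  · rintro (rfl | ⟨β, hβ, rfl, γ, hγ, hβγ, h | h⟩)
    · exact ⟨α, hα, rfl, fun _ => id⟩
    · exact absurd h (hge.ne hα hγ)
    · obtain rfl := hge.inj α hα γ hγ h
      exact ⟨β, hβ, rfl, hβγ⟩
  · rintro ⟨β, hβ, rfl, h⟩
    exact Or.inr ⟨β, hβ, rfl, α, hα, h, Or.inr rfl⟩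

theorem geRel_trans (x y z : ZFSet.{u}) (h₁ : GeRel M ge x y) (h₂ : GeRel M ge y z) :
    GeRel M ge x z := by
  rcases h₁ with rfl | ⟨α, hα, rfl, β, hβ, hαβ, hx⟩
  · exact h₂
  · obtain ⟨γ, hγ, rfl, hγα⟩ := (hge.geRel_left_ge_iff hα).1 h₂
    exact Or.inr ⟨γ, hγ, rfl, β, hβ, fun _ h => hαβ (hγα h), hx⟩

/-- The stage `α + 1` contains `≥α` but not the ordinal `α`. Otherwise `α` would lie below `≥α`, the
projection of `≥(α+1)`, and lifting would fail: no value below `≥(α+1)` projects below `α`. -/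
theorem ord_mem_geSet_succ_iff (hM : IsCTMGB M C) {α β : ZFSet.{u}} (hα : α ∈ OrdOf M)
    (hβ : β ∈ OrdOf M) : β ∈ geSet ge (insert α α) ↔ β ∈ α := by
  rw [mem_geSet]
  constructor
  · rintro (⟨z, hz, h⟩ | ⟨γ, hγ, e⟩)
    · rcases ZFSet.mem_insert_iff.1 hz with rfl | hz
      · exact h
      · exact hα.2.subset_of_mem hz h
    · exact absurd e.symm (hge.ne (hM.ordOf_trans (hM.succ_mem_ordOf hα) hγ) hβ)
  · exact fun h => Or.inl ⟨α, ZFSet.mem_insert _ _, h⟩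

theorem ge_mem_geSet_iff (hM : IsCTMGB M C) {α β : ZFSet.{u}} (hα : α ∈ OrdOf M)
    (hβ : β ∈ OrdOf M) : ge β ∈ geSet ge α ↔ β ∈ α := by
  rw [mem_geSet]
  constructor
  · rintro (⟨z, hz, h⟩ | ⟨γ, hγ, e⟩)
    · exact absurd rfl (hge.ne hβ (hM.ordOf_trans (hM.ordOf_trans hα hz) h))
    · rwa [hge.inj β hβ γ (hM.ordOf_trans hα hγ) e]
  · exact fun h => Or.inr ⟨β, h, rfl⟩

theorem dfn_ge (hM : IsCTMGB M C) (i j : ℕ) :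
    Dfn M C (fun v => v i ∈ OrdOf M ∧ v j = ge (v i)) := by
  refine (Dfn.mem_class hge.graph_mem (hM.dfun_pair (DFun.var i) (DFun.var j))).congr fun v => ?_
  constructor
  · exact fun h => ⟨_, h.1, by rw [h.2]⟩
  · rintro ⟨α, hα, e⟩
    obtain ⟨h₁, h₂⟩ := ZFSet.pair_inj.1 e
    exact ⟨h₁ ▸ hα, by rw [h₁, h₂]⟩

theorem geSet_mem (hM : IsCTMGB M C) {α : ZFSet.{u}} (hα : α ∈ OrdOf M) : geSet ge α ∈ M := by
  obtain ⟨w, hw, h₁, h₂⟩ := hM.collect (S := fun y z => y ∈ OrdOf M ∧ z = ge y)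
    (hge.dfn_ge hM 0 1) hα.1 fun y hy =>
      have hy' := hM.ordOf_trans hα hy
      ⟨ge y, (hge.mem y hy').1, hy', rfl⟩
  convert hM.union_mem (hM.union α hα.1) hw using 1
  ext x
  rw [mem_geSet, ZFSet.mem_union, ZFSet.mem_sUnion]
  refine or_congr Iff.rfl ⟨?_, fun hx => ?_⟩
  · rintro ⟨β, hβ, rfl⟩
    obtain ⟨z, hz, -, rfl⟩ := h₁ β hβ
    exact hz
  · obtain ⟨y, hy, -, e⟩ := h₂ x hx
    exact ⟨y, hy, e⟩

theorem dfn_geSet (hM : IsCTMGB M C) :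
    Dfn M C (fun v => v 1 ∈ OrdOf M ∧ v 0 ∈ geSet ge (v 1)) := by
  have : Dfn M C (fun v => v 1 ∈ OrdOf M ∧
      ((∃ z ∈ v 1, v 0 ∈ z) ∨ ∃ β ∈ v 1, β ∈ OrdOf M ∧ v 0 = ge β)) := by
    have hO := fun i => Dfn.var_mem_class (M := M) hM.ordOf_mem i
    have hG := fun i j => hge.dfn_ge hM i j
    apply_rules [hG, hO, Dfn.and, Dfn.or, hM.bex, Dfn.mem, DFun.var]
  refine this.congr fun v => and_congr_right fun hv => ?_
  rw [mem_geSet]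
  refine or_congr_right (exists_congr fun β => and_congr_right fun hβ => ?_)
  exact (and_iff_right (hM.ordOf_trans hv hβ)).symm

theorem values_mem (hM : IsCTMGB M C) : OrdOf M ∪ ge '' OrdOf M ∈ C := by
  have : Dfn M C (fun v => v 0 ∈ OrdOf M ∨ ∃ α ∈ M, α ∈ OrdOf M ∧ v 0 = ge α) := by
    have hO := fun i => Dfn.var_mem_class (M := M) hM.ordOf_mem i
    have hG := fun i j => hge.dfn_ge hM i j
    apply_rules [hG, hO, Dfn.or, Dfn.ex]
  convert hM.mem_of_dfn (S := fun x => x ∈ OrdOf M ∨ ∃ α ∈ M, α ∈ OrdOf M ∧ x = ge α) this using 1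
  ext x
  rw [mem_values_iff]
  constructor
  · rintro (hx | ⟨α, hα, rfl⟩)
    · exact ⟨hx.1, Or.inl hx⟩
    · exact ⟨(hge.mem α hα).1, Or.inr ⟨α, hα.1, hα, rfl⟩⟩
  · rintro ⟨-, hx | ⟨α, -, hα, rfl⟩⟩
    · exact Or.inl hx
    · exact Or.inr ⟨α, hα, rfl⟩

theorem dfn_geRel (hM : IsCTMGB M C) : Dfn M C (fun v => GeRel M ge (v 0) (v 1)) := by
  have : Dfn M C (fun v => v 0 = v 1 ∨ ∃ α ∈ M, (α ∈ OrdOf M ∧ v 1 = ge α) ∧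
      ∃ β ∈ M, β ∈ OrdOf M ∧ α ⊆ β ∧ (v 0 = β ∨ (β ∈ OrdOf M ∧ v 0 = ge β))) := by
    have hO := fun i => Dfn.var_mem_class (M := M) hM.ordOf_mem i
    have hG := fun i j => hge.dfn_ge hM i j
    apply_rules (maxDepth := 200) [hG, hO, Dfn.and, Dfn.or, Dfn.ex, hM.subset, Dfn.eq, DFun.var]
  refine this.congr fun v => or_congr_right ?_
  constructor
  · rintro ⟨α, hα, e, β, hβ, h, h'⟩
    exact ⟨α, hα.1, ⟨hα, e⟩, β, hβ.1, hβ, h, h'.imp_right fun h => ⟨hβ, h⟩⟩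
  · rintro ⟨α, -, ⟨hα, e⟩, β, -, hβ, h, h'⟩
    exact ⟨α, hα, e, β, hβ, h, h'.imp_right And.right⟩

/-- The values sent to `≥α` are themselves below `≥α`, so replacing them only weakens the condition.
-/
theorem exists_eq_or (hM : IsCTMGB M C) {α x : ZFSet.{u}} (hα : α ∈ OrdOf M)
    (hx : x ∈ OrdOf M ∪ ge '' OrdOf M) (h : x ∉ geSet ge (insert α α)) :
    ∃ β ∈ OrdOf M, α ⊆ β ∧ (x = β ∨ x = ge β) := by
  rcases mem_values_iff.1 hx with hx | ⟨β, hβ, rfl⟩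
  · rw [hge.ord_mem_geSet_succ_iff hM hα hx] at h
    exact ⟨x, hx, (hx.2.notMem_iff_subset hα.2).1 h, Or.inl rfl⟩
  · rw [hge.ge_mem_geSet_iff hM (hM.succ_mem_ordOf hα) hβ] at h
    exact ⟨β, hβ, (hβ.2.notMem_iff_subset hα.2).1 fun h' => h (ZFSet.mem_insert_of_mem _ h'),
      Or.inr rfl⟩

open Classical in
theorem isValueSystem (hM : IsCTMGB M C) :
    IsValueSystem M C (OrdOf M ∪ ge '' OrdOf M) (GeRel M ge) (geSet ge)
      (fun α x => if x ∈ geSet ge (insert α α) then x else ge α) where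
  carrier_mem := hge.values_mem hM
  dfn_rel := by
    have hV := fun i => Dfn.var_mem_class (M := M) (hge.values_mem hM) i
    exact (hV 0).and ((hV 1).and (hge.dfn_geRel hM))
  refl _ _ := Or.inl rfl
  trans x _ y _ z _ := hge.geRel_trans x y z
  set_mem _ hα := hge.geSet_mem hM hα
  dfn_set := hge.dfn_geSet hM
  set_mono α _ β _ h x := by
    simp only [mem_geSet]
    exact Or.imp (fun ⟨z, hz, hx⟩ => ⟨z, h hz, hx⟩) fun ⟨γ, hγ, hx⟩ => ⟨γ, h hγ, hx⟩
  set_cont l _ hlim x hx := by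
    rcases mem_geSet.1 hx with ⟨z, hz, hx⟩ | ⟨β, hβ, rfl⟩
    · exact ⟨_, hlim.2.2 z hz, mem_geSet.2 (Or.inl ⟨z, ZFSet.mem_insert _ _, hx⟩)⟩
    · exact ⟨_, hlim.2.2 β hβ, mem_geSet.2 (Or.inr ⟨β, ZFSet.mem_insert _ _, rfl⟩)⟩
  mem_iff x := mem_values_iff_exists hM
  dfn_proj := by
    have hs : Dfn M C (fun v => insert (v 0) (v 0) ∈ OrdOf M ∧
        v 1 ∈ geSet ge (insert (v 0) (v 0))) :=
      Dfn.subst (R := fun v x => x ∈ OrdOf M ∧ v 1 ∈ geSet ge x)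
        ((hge.dfn_geSet hM).reindex fun k => Nat.casesOn k 2 fun _ => 0)
        (hM.dfun_insert (DFun.var 0) (DFun.var 0))
    have : Dfn M C (fun v => v 0 ∈ OrdOf M ∧ v 1 ∈ OrdOf M ∪ ge '' OrdOf M ∧
        (((insert (v 0) (v 0) ∈ OrdOf M ∧ v 1 ∈ geSet ge (insert (v 0) (v 0))) ∧ v 2 = v 1) ∨
        (¬ (insert (v 0) (v 0) ∈ OrdOf M ∧ v 1 ∈ geSet ge (insert (v 0) (v 0))) ∧
          (v 0 ∈ OrdOf M ∧ v 2 = ge (v 0))))) :=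
      (Dfn.var_mem_class hM.ordOf_mem 0).and ((Dfn.var_mem_class (hge.values_mem hM) 1).and
        ((hs.and (Dfn.var_eq 2 1)).or (hs.not.and (hge.dfn_ge hM 0 2))))
    refine this.congr fun v => and_congr_right fun h₀ => and_congr_right fun _ => ?_
    have := hM.succ_mem_ordOf h₀
    split_ifs with h <;> simp [h, h₀, this]
  proj_mem α _ x _ := by
    split_ifs with h
    · exact h
    · exact mem_geSet.2 (Or.inr ⟨α, ZFSet.mem_insert _ _, rfl⟩)
  proj_mono α hα x hx y hy h := by
    have hα' := hM.succ_mem_ordOf hα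
    rcases h with rfl | ⟨γ, hγ, rfl, β, hβ, hγβ, h⟩
    · exact Or.inl rfl
    · rw [hge.ge_mem_geSet_iff hM hα' hγ]
      by_cases hγα : γ ∈ insert α α
      · rw [if_pos hγα]
        split_ifs with hx'
        · exact Or.inr ⟨γ, hγ, rfl, β, hβ, hγβ, h⟩
        · refine Or.inr ⟨γ, hγ, rfl, α, hα, ?_, Or.inr rfl⟩
          rcases ZFSet.mem_insert_iff.1 hγα with rfl | hγα
          · exact fun _ => id
          · exact hα.2.subset_of_mem hγα
      -- Here `γ` exceeds `α`, hence so does `β`, and both values project to `≥α`.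
      · rw [if_neg hγα, if_neg]
        · exact Or.inl rfl
        · intro hx'
          have hβα : β ∈ insert α α := by
            rcases h with rfl | rfl
            · exact ZFSet.mem_insert_of_mem _ ((hge.ord_mem_geSet_succ_iff hM hα hβ).1 hx')
            · exact (hge.ge_mem_geSet_iff hM hα' hβ).1 hx'
          exact hγα (hγ.2.mem_of_subset_of_mem hα'.2 hγβ hβα)
  lift α hα x hx w hw h := by
    split_ifs at h with hx'
    -- The value `x` is not truncated, so `w` is already below `x` and projects to itself.
    · refine ⟨w, ?_, h, ?_⟩
      · exact (mem_values_iff_exists hM).2 ⟨_, hM.succ_mem_ordOf hα, hw⟩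
      · rw [if_pos hw]
        exact Or.inl rfl
    · refine ⟨x, hx, Or.inl rfl, ?_⟩
      rw [if_neg hx']
      rcases h with rfl | ⟨γ, hγ, e, β, hβ, hγβ, h⟩
      · exact Or.inl rfl
      · obtain rfl := hge.inj _ hα _ hγ e
        rcases h with rfl | rfl
        -- An ordinal below `≥α` is at least `α`, but the stage `α + 1` has only ordinals smaller
        -- than `α`. So `w` can only be `≥α`, and `x` itself is the lift.
        · exact absurd (hγβ ((hge.ord_mem_geSet_succ_iff hM hα hβ).1 hw)) (ZFSet.mem_irrefl _)
        · rcases ZFSet.mem_insert_iff.1 ((hge.ge_mem_geSet_iff hM (hM.succ_mem_ordOf hα) hβ).1 hw)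
            with rfl | h
          · exact Or.inl rfl
          · exact absurd (hγβ h) (ZFSet.mem_irrefl _)
  reflect α hα y hy x hx h := by
    split_ifs at h with hx'
    · exact h
    · obtain ⟨γ, hγ, rfl, hγα⟩ := (hge.geRel_left_ge_iff hα).1 h
      obtain ⟨β, hβ, hαβ, h'⟩ := hge.exists_eq_or hM hα hx hx'
      exact Or.inr ⟨γ, hγ, rfl, β, hβ, fun _ h => hαβ (hγα h), h'⟩
  proj_id α _ x hx := if_pos hx

end IsGeCode

end ClassForcing

theorem mainTheorem9 (M : Set ZFSet.{u}) (C : Set (Set ZFSet.{u}))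
    (hM : ClassForcing.IsCTMGB M C) :
    (∀ P : ClassForcing.Forcing.{u}, ClassForcing.IsClassForcing C P →
      ClassForcing.ApproachableByProjections M C P →
        ClassForcing.DefinabilityLemma M C P ClassForcing.eqFormula ∧
        ClassForcing.ForcingTheorem M C P) ∧
    (ClassForcing.IsClassForcing C (ClassForcing.Col M) ∧
      ClassForcing.ApproachableByProjections M C (ClassForcing.Col M) ∧
      ClassForcing.ForcingTheorem M C (ClassForcing.Col M)) ∧
    (ClassForcing.IsClassForcing C (ClassForcing.ColStar M) ∧
      ClassForcing.ApproachableByProjections M C (ClassForcing.ColStar M) ∧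
      ClassForcing.ForcingTheorem M C (ClassForcing.ColStar M)) ∧
    (∀ ge : ZFSet.{u} → ZFSet.{u}, ClassForcing.IsGeCode M C ge →
      ClassForcing.IsClassForcing C (ClassForcing.ColGe M ge) ∧
      ClassForcing.ApproachableByProjections M C (ClassForcing.ColGe M ge) ∧
      ClassForcing.ForcingTheorem M C (ClassForcing.ColGe M ge)) := by
  refine ⟨fun P hP h => ?_,
    (ClassForcing.isPointwise_col M).forcingTheorem hM hM.isValueSystem_ordOf,
    (ClassForcing.isPointwise_colStar M).forcingTheorem hM hM.isValueSystem_ordOf,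
    fun ge hge => (ClassForcing.isPointwise_colGe M ge).forcingTheorem hM (hge.isValueSystem hM)⟩
  have := h.forcingTheorem hM hP
  exact ⟨(this 0 2 ClassForcing.eqFormula).1, this⟩
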